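/- **Setting.** Let $d\in\{2,3\}$, $L,T>0$, $\mathbb T^d=(\mathbb R/L\mathbb Z)^d$, $a>0$, $\gamma>1$, $\mu>0$, $\lambda\ge 0$, $\nu=\lambda+\frac{d-2}{d}\mu$, $\alpha>-1$, $p(\varrho)=a\varrho^\gamma$, $\mathcal P(\varrho)=\frac{a}{\gamma-1}\varrho^\gamma$. Let $\Omega^f\subset\mathbb T^d$ be open, and let the measurable initial data $\widetilde\varrho_0>0$, $\widetilde{\boldsymbol m}_0$ satisfy, almost everywhere, $\widetilde\varrho_0\le R$, $|\widetilde{\boldsymbol m}_0|\le R$, $\widetilde\varrho_0\ge\underline\varrho$ in $\Omega^f$ for some constant $\underline\varrho>0$, and $\widetilde{\boldsymbol m}_0=0$ outside $\Omega^f$. Put $M_0=\int_{\mathbb T^d}\widetilde\varrho_0\,dx$ and $E_0=\int_{\mathbb T^d}\big(\frac{|\widetilde{\boldsymbol m}_0|^2}{2\widetilde\varrho_0}+\mathcal P(\widetilde\varrho_0)\big)dx$. Let $h=L/N\in(0,1)$ with $N\in\mathbb N$, $N\ge1$, and let $\mathcal T_h$ be the uniform mesh of $\mathbb T^d$ by $N^d$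 cubes of side $h$, with set of faces $\mathcal E$; a face $\sigma\in\mathcal E$ has a unit normal $\boldsymbol n$, along which it is crossed from the "in" to the "out" element. Let $Q_h$ be the space of functions that are constant on each element, $\Pi_{\mathcal T}$ the projection onto $Q_h$ by mean values over elements, and $\Omega^s_h$ the union of the elements that are not contained in $\Omega^f$. On a face put $\{v\}=\frac12(v^{\rm in}+v^{\rm out})$, $[v]=v^{\rm out}-v^{\rm in}$; put $({\rm div}_h\boldsymbol v)_K=\frac1h\sum_{\sigma\subset\partial K}\{\boldsymbol v\}\cdot\boldsymbol n$ with $\boldsymbol n$ outer to $K$, and $\nabla_{\mathcal E}v=\sum_{\sigma\in\mathcal E}\frac1h[v]\,\boldsymbol n\,\mathbf 1_{D_\sigma}$, where $D_\sigma$ is the union of the halves adjacent to $\sigma$ of the two elements that share $\sigma$ (componentwise for vectors). The flux is $F(r,\boldsymbol u)=r^{\rm up}\{\boldsymbol u\}\cdot\boldsymbol n-h^\alpha[r]$ with $r^{\rm up}=r^{\rm in}$ if $\{\boldsymbol u\}\cdot\boldsymbol n\ge0$ and $r^{\rm up}=r^{\rm out}$ otherwise (componentwise for vector-valued $r$). Let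 $\Delta t=T/N_T$ with $N_T\in\mathbb N$, $N_T\ge1$, let $\epsilon\in(0,1)$, and $D_tv^k=(v^k-v^{k-1})/\Delta t$. A *solution of the FV scheme* is a sequence $(\varrho^k,\boldsymbol u^k)\in Q_h\times Q_h^d$, $k=0,\dots,N_T$, with $\varrho^0=\Pi_{\mathcal T}\widetilde\varrho_0$, $\varrho^0\boldsymbol u^0=\Pi_{\mathcal T}\widetilde{\boldsymbol m}_0$ and, for $k=1,\dots,N_T$ and all $\phi\in Q_h$, $\boldsymbol\varphi\in Q_h^d$, $$\int_{\mathbb T^d}D_t\varrho^k\,\phi\,dx-\int_{\mathcal E}F(\varrho^k,\boldsymbol u^k)[\phi]\,dS=0,$$ $$\int_{\mathbb T^d}D_t(\varrho^k\boldsymbol u^k)\cdot\boldsymbol\varphi\,dx-\int_{\mathcal E}F(\varrho^k\boldsymbol u^k,\boldsymbol u^k)\cdot[\boldsymbol\varphi]\,dS-\int_{\mathbb T^d}p(\varrho^k){\rm div}_h\boldsymbol\varphi\,dx+\frac1\epsilon\int_{\Omega^s_h}\boldsymbol u^k\cdot\boldsymbol\varphi\,dx+\mu\int_{\mathbb T^d}\nabla_{\mathcal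 E}\boldsymbol u^k:\nabla_{\mathcal E}\boldsymbol\varphi\,dx+\nu\int_{\mathbb T^d}{\rm div}_h\boldsymbol u^k\,{\rm div}_h\boldsymbol\varphi\,dx=0.$$ Finally $\varrho_h(t)=\varrho^k$, $\boldsymbol u_h(t)=\boldsymbol u^k$ for $t\in[k\Delta t,(k+1)\Delta t)$. **Lemma (negative estimates of density and momentum).** There are a constant $C>0$ and, for each $p\in[\frac{2\gamma}{\gamma-1},\infty)$, a constant $C_p$, which depend only on $d,L,T,a,\gamma,\mu,\lambda,\alpha$ and on $M_0,E_0,R$ (in particular, not on $h,\Delta t,\epsilon$), such that every solution of the FV scheme satisfies $$\|\varrho_h\|_{L^2((0,T)\times\mathbb T^d)}\le C\,h^{\beta_D},\qquad \|\varrho_h\|_{L^2(0,T;L^{6/5}(\mathbb T^d))}\le C\,h^{\widetilde\beta_R},\qquad \|\varrho_h\boldsymbol u_h\|_{L^2((0,T)\times\mathbb T^d)}\le C_p\,h^{\beta_M(p)},$$ where $$\beta_D=\begin{cases}\inf_{p\in[1,\infty)}\min\{\frac{p(\alpha+1)+4}{2p},1\}\cdot\frac{\gamma-2}{\gamma}&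 d=2,\ \gamma\in(1,2),\\ \min\{\frac{\alpha+2}3,1\}\cdot\frac{3(\gamma-2)}{2\gamma}& d=3,\ \gamma\in(1,2),\\ 0&\gamma\ge2,\end{cases}$$ $$\widetilde\beta_R=\begin{cases}\inf_{p\in[\frac{12}{5\gamma},\infty)}\min\{\frac{(1+\alpha)p}{2(p-2)},1\}\cdot\frac{5\gamma-6}{3\gamma}& d=2,\ \gamma\in(1,\frac65),\\ \min\{\frac{1+\alpha}2,1\}\cdot\frac{5\gamma-6}{2\gamma}& d=3,\ \gamma\in(1,\frac65),\\ 0&\gamma\ge\frac65,\end{cases}$$ (the infima apply to the minima only) and $$\beta_M(p)=\begin{cases}\max\{-\frac{p(\alpha+1)+4}{2p\gamma},\frac{p(\gamma-2)-2\gamma}{p\gamma}\}& d=2,\ \gamma\le2,\\ 0& d=2,\ \gamma>2,\\ \max\{-\frac{\alpha+2}{2\gamma},\frac{\gamma-3}\gamma,-\frac3{2\gamma}\}& d=3,\ \gamma\le2,\\ \frac{\gamma-3}\gamma& d=3,\ \gamma\in(2,3),\\ 0& d=3,\ \gamma\ge3.\end{cases}$$ Only in the case $d=2$, $\gamma\le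 2$ does $\beta_M(p)$ depend on $p$; in all other cases one constant serves. -/

import Mathlib

open Set MeasureTheory

noncomputable section

namespace PenalizedFV

/-! ### The flat torus, its uniform mesh, and piecewise constant functions -/

/-- The flat torus `(ℝ / L ℤ)^d`, i.e. a cube of side `L` with periodic boundary conditions.
Its volume is the product of the Lebesgue measures of the circles (total mass `L ^ d`). -/
abbrev Torus (d : ℕ) (L : ℝ) : Type := Fin d → AddCircle L

/-- Labels of the `N ^ d` elements of the uniform mesh; addition is periodic, so that the
neighbours of `K` in the direction `i` are `K + e i` and `K - e i`. -/
abbrev Cell (d N : ℕ) : Type := Fin d → ZMod N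

/-- The mesh parameter `h`, the side of an element when each circle is divided into `N` arcs. -/
def meshSize (L : ℝ) (N : ℕ) : ℝ := L / N

/-- The unit step in the direction `i` on labels. -/
def e {d N : ℕ} (i : Fin d) : Cell d N := Pi.single i 1

section Mesh

variable {d N : ℕ} {L : ℝ} [Fact (0 < L)]

/-- The label of the element that contains the point `x`: in each coordinate `i`, the number
`⌊x i / h⌋`, where `x i` is represented in `[0, L)`. -/
def cellIndex (N : ℕ) (x : Torus d L) : Cell d N :=
  fun i => ((⌊(AddCircle.equivIco L 0 (x i) : ℝ) / meshSize L N⌋₊ : ℕ) : ZMod N)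

/-- The (half-open) element `K` of the mesh; its measure is `h ^ d`. -/
def element (L : ℝ) [Fact (0 < L)] (K : Cell d N) : Set (Torus d L) :=
  {x | cellIndex N x = K}

/-- The piecewise constant function on the torus with the value `v K` on each element `K`. -/
def toFun {E : Type*} (v : Cell d N → E) : Torus d L → E := fun x => v (cellIndex N x)

/-- The projection onto piecewise constant functions: the mean values over the elements. -/
def proj {E : Type*} [NormedAddCommGroup E] [NormedSpace ℝ E] (N : ℕ) (f : Torus d L → E)
    (K : Cell d N) : E :=
  (meshSize L N ^ d)⁻¹ • ∫ x in element L K, f x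

/-- The elements that are not inside the fluid domain, `Ω^s_h`: those whose closure is not
contained in `Ωf`. -/
def solidCells (N : ℕ) (Ωf : Set (Torus d L)) : Set (Cell d N) :=
  {K | ¬ closure (element L K) ⊆ Ωf}

end Mesh

/-! ### Discrete operators

A face orthogonal to the `i`-th direction is given by a pair `(K, i)`: it is the common face of
`K` and `K + e i`. Its normal is the `i`-th basis vector, so that "in" is the side of `K` and
"out" is the side of `K + e i`. -/

section Operators

variable {d N : ℕ}

/-- The integral over the torus of the piecewise constant function with the values `r K`. -/
def intTorus [NeZero N] (h : ℝ) (r : Cell d N → ℝ) : ℝ := h ^ d * ∑ K, r K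

/-- The integral over all faces of a function with the value `g K i` on the face `(K, i)`;
each face has measure `h ^ (d - 1)`. -/
def intFaces [NeZero N] (h : ℝ) (g : Cell d N → Fin d → ℝ) : ℝ :=
  h ^ (d - 1) * ∑ K, ∑ i, g K i

/-- The jump `out - in` on the face `(K, i)`. -/
def jump (r : Cell d N → ℝ) (K : Cell d N) (i : Fin d) : ℝ := r (K + e i) - r K

/-- The average `(in + out) / 2` on the face `(K, i)`. -/
def avg (r : Cell d N → ℝ) (K : Cell d N) (i : Fin d) : ℝ := (r K + r (K + e i)) / 2

/-- The component `j` of a vector valued piecewise constant function. -/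
def comp (v : Cell d N → EuclideanSpace ℝ (Fin d)) (j : Fin d) : Cell d N → ℝ := fun K => v K j

/-- `avg v · n` on the face `(K, i)`. -/
def avgNormal (v : Cell d N → EuclideanSpace ℝ (Fin d)) (K : Cell d N) (i : Fin d) : ℝ :=
  avg (comp v i) K i

open scoped Classical in
/-- The upwind value of `r` on the face `(K, i)` with respect to the velocity `v`. -/
def upwind (r : Cell d N → ℝ) (v : Cell d N → EuclideanSpace ℝ (Fin d)) (K : Cell d N)
    (i : Fin d) : ℝ :=
  if 0 ≤ avgNormal v K i then r K else r (K + e i)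

/-- The numerical flux `r^up (avg v · n) - h ^ α * jump r` on the face `(K, i)`. -/
def flux (h α : ℝ) (r : Cell d N → ℝ) (v : Cell d N → EuclideanSpace ℝ (Fin d)) (K : Cell d N)
    (i : Fin d) : ℝ :=
  upwind r v K i * avgNormal v K i - h ^ α * jump r K i

/-- The discrete divergence on the element `K`: `h⁻¹` times the sum over the `2 d` faces of `K`
of the average of `v` times the outer normal. -/
def divh (h : ℝ) (v : Cell d N → EuclideanSpace ℝ (Fin d)) (K : Cell d N) : ℝ :=
  h⁻¹ * ∑ i, (avgNormal v K i - avgNormal v (K - e i) i)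

/-- The integral over the torus of `∇_E v : ∇_E w`. The discrete gradient `∇_E r` is the sum over
the faces `σ` of `h⁻¹ * jump r * n` on the dual cell `D_σ`, and `D_σ` has measure `h ^ d`; the dual
cells of faces with the same normal are disjoint, and different normals are orthogonal. -/
def intGradGrad [NeZero N] (h : ℝ) (v w : Cell d N → EuclideanSpace ℝ (Fin d)) : ℝ :=
  h ^ d * ∑ K, ∑ i, ∑ j, (h⁻¹ * jump (comp v j) K i) * (h⁻¹ * jump (comp w j) K i)

end Operators

/-! ### The data and the finite volume method -/

/-- The pressure `a ρ ^ γ`. -/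
def pressure (a γ ρ : ℝ) : ℝ := a * ρ ^ γ

/-- The pressure potential `a / (γ - 1) ρ ^ γ`. -/
def pressurePotential (a γ ρ : ℝ) : ℝ := a / (γ - 1) * ρ ^ γ

/-- Initial data of the penalized problem for the fluid domain `Ωf`: a positive density `ρ₀` and a
momentum `m₀`, both bounded (by `R`), with `ρ₀` bounded away from zero in `Ωf` and `m₀ = 0`
outside `Ωf`. The total mass is `M₀` and the total energy is `E₀`. -/
structure IsInitialData {d : ℕ} {L : ℝ} [Fact (0 < L)] (a γ M₀ E₀ R : ℝ) (Ωf : Set (Torus d L))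
    (ρ₀ : Torus d L → ℝ) (m₀ : Torus d L → EuclideanSpace ℝ (Fin d)) : Prop where
  isOpen : IsOpen Ωf
  measurable_density : AEStronglyMeasurable ρ₀ volume
  measurable_momentum : AEStronglyMeasurable m₀ volume
  density_pos : ∀ᵐ x, 0 < ρ₀ x
  density_lower : ∃ c > 0, ∀ᵐ x, x ∈ Ωf → c ≤ ρ₀ x
  density_le : ∀ᵐ x, ρ₀ x ≤ R
  momentum_le : ∀ᵐ x, ‖m₀ x‖ ≤ R
  momentum_solid : ∀ᵐ x, x ∉ Ωf → m₀ x = 0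
  mass : ∫ x, ρ₀ x = M₀
  energy : ∫ x, (‖m₀ x‖ ^ 2 / (2 * ρ₀ x) + pressurePotential a γ (ρ₀ x)) = E₀

open scoped Classical in
/-- `ρ k`, `u k` (`k = 0, …, NT`) are the values at the times `t_k = k Δt`, `Δt = T / NT`, of a
solution of the finite volume method for the penalized problem, on the mesh with `N` elements in
each direction, with penalty parameter `ε` and artificial viscosity exponent `α`. -/
structure IsFVSolution {d : ℕ} {L : ℝ} [Fact (0 < L)] (T a γ μ lam α ε : ℝ) (N NT : ℕ) [NeZero N]
    (Ωf : Set (Torus d L)) (ρ₀ : Torus d L → ℝ) (m₀ : Torus d L → EuclideanSpace ℝ (Fin d))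
    (ρ : ℕ → Cell d N → ℝ) (u : ℕ → Cell d N → EuclideanSpace ℝ (Fin d)) : Prop where
  init_density : ∀ K, ρ 0 K = proj N ρ₀ K
  init_momentum : ∀ K, ρ 0 K • u 0 K = proj N m₀ K
  continuity : ∀ k, k + 1 ≤ NT → ∀ φ : Cell d N → ℝ,
    intTorus (meshSize L N) (fun K => (ρ (k + 1) K - ρ k K) / (T / NT) * φ K)
      - intFaces (meshSize L N)
          (fun K i => flux (meshSize L N) α (ρ (k + 1)) (u (k + 1)) K i * jump φ K i) = 0
  momentum : ∀ k, k + 1 ≤ NT → ∀ φ : Cell d N → EuclideanSpace ℝ (Fin d),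
    intTorus (meshSize L N) (fun K => ∑ j,
        (ρ (k + 1) K * u (k + 1) K j - ρ k K * u k K j) / (T / NT) * φ K j)
      - intFaces (meshSize L N) (fun K i => ∑ j,
          flux (meshSize L N) α (fun K' => ρ (k + 1) K' * u (k + 1) K' j) (u (k + 1)) K i
            * jump (comp φ j) K i)
      - intTorus (meshSize L N)
          (fun K => pressure a γ (ρ (k + 1) K) * divh (meshSize L N) φ K)
      + 1 / ε * intTorus (meshSize L N)
          (fun K => if K ∈ solidCells N Ωf then ∑ j, u (k + 1) K j * φ K j else 0)
      + μ * intGradGrad (meshSize L N) (u (k + 1)) φ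
      + (lam + ((d : ℝ) - 2) / d * μ) * intTorus (meshSize L N)
          (fun K => divh (meshSize L N) (u (k + 1)) K * divh (meshSize L N) φ K) = 0

/-! ### Functions of time and space, and their norms -/

/-- The function that is piecewise constant in time and space with the values `v k K` for
`t ∈ [k Δt, (k + 1) Δt)` and `x` in the element `K` (with `v 0` for all `t < Δt`). -/
def extend {d N : ℕ} {L : ℝ} [Fact (0 < L)] {E : Type*} (Δt : ℝ) (v : ℕ → Cell d N → E) :
    ℝ → Torus d L → E :=
  fun t => toFun (v ⌊t / Δt⌋₊)

/-- The norm of `L^q(0,T; L^p(𝕋^d))`. For `p = q` this is the norm of `L^p((0,T) × 𝕋^d)`. -/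
def mixedNorm {d : ℕ} {L : ℝ} [Fact (0 < L)] {E : Type*} [NormedAddCommGroup E]
    (q p : ENNReal) (T : ℝ) (w : ℝ → Torus d L → E) : ENNReal :=
  eLpNorm (fun t => eLpNorm (w t) p volume) q (volume.restrict (Ioo 0 T))

/-! ### The exponents -/

/-- The exponent `β_D` (for `d = 2, 3`). -/
def betaD (d : ℕ) (γ α : ℝ) : ℝ :=
  if 2 ≤ γ then 0
  else if d = 2 then
    (⨅ p : Ici (1 : ℝ), min (((p : ℝ) * (α + 1) + 4) / (2 * p)) 1) * ((γ - 2) / γ)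
  else min ((α + 2) / 3) 1 * (3 * (γ - 2) / (2 * γ))

/-- The exponent `β̃_R` (for `d = 2, 3`). -/
def betaR (d : ℕ) (γ α : ℝ) : ℝ :=
  if 6 / 5 ≤ γ then 0
  else if d = 2 then
    (⨅ p : Ici (12 / (5 * γ)), min ((1 + α) * (p : ℝ) / (2 * ((p : ℝ) - 2))) 1)
      * ((5 * γ - 6) / (3 * γ))
  else min ((1 + α) / 2) 1 * ((5 * γ - 6) / (2 * γ))

/-- The exponent `β_M` (for `d = 2, 3`). It depends on the integrability parameter `p` only if
`d = 2` and `γ ≤ 2`; then it increases with `p`, and its supremum over `p` is not attained. -/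
def betaM (d : ℕ) (γ α p : ℝ) : ℝ :=
  if d = 2 then
    if γ ≤ 2 then max (-(p * (α + 1) + 4) / (2 * p * γ)) ((p * (γ - 2) - 2 * γ) / (p * γ))
    else 0
  else if γ ≤ 2 then max (max (-(α + 2) / (2 * γ)) ((γ - 3) / γ)) (-3 / (2 * γ))
  else if γ < 3 then (γ - 3) / γ
  else 0

end PenalizedFV

end

/-! The scheme satisfies a discrete energy balance, and all three estimates follow from it together
with Sobolev, interpolation and inverse inequalities on the grid.

A priori bounds. An implicit step preserves mass and positivity of the density (`density_pos_step`,
`mass_step`). Testing the momentum equation with `u` and the continuity equation with `P'(ρ) -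
|u|²/2` gives `energy_step`; the penalty and divergence terms have a good sign and are dropped, so
nothing depends on `ε`. The result, `aprioriBounds_of_isFVSolution`, bounds `ρ` in `L^∞(L^γ)`, `√ρ
u` in `L^∞(L²)`, the discrete gradient of `u` in `L²`, and, for `γ ≤ 2`, `h^{(α+1)/2}` times the
discrete gradient of `ρ^{γ/2}` in `L²`. The last bound is the contribution of the artificial
viscosity (`sq_jump_rpow_half_le`).

Discrete analysis. Mathlib's grid-lines inequality with counting measures gives the embedding of
`W^{1,1}` into `L^{d/(d-1)}` on the grid (`sum_rpow_le_gradient`). Applied to powers of a function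
it yields embeddings of `H¹` into `L^p`, for all finite `p ≥ 2` if `d = 2` and for `p = 6` if `d =
3`, and a Gagliardo–Nirenberg inequality (`sum_rpow_le_interpolation`). The velocity has no
prescribed mean value, so its `L²` norm is controlled by a Poincaré inequality weighted by the
density (`sum_sq_le_weighted`).

Negative powers of `h` arise in three ways. An inverse estimate raises the integrability of `ρ`
above `γ` at every time. The squared `H¹` norm of `ρ^{γ/2}` costs `h^{-(α+1)}` after integration in
time, and is used either through interpolation or through a maximum bound (Sobolev plus an inverse
estimate). Finally, Hölder's inequality combines `ρ` in `L^q` with `u` in `L²(L^p)`. Each exponent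
of the theorem is the result of one of these routes. As `h < 1`, larger exponents are better, and
the minima and maxima in the exponents select the route. -/

noncomputable section

namespace PenalizedFV

/-! ### Gagliardo–Nirenberg–Sobolev inequality on the periodic grid, and gradients of powers -/

section GridInequalities

variable {d N : ℕ} [NeZero N]

lemma sum_comp_add (f : Cell d N → ℝ) (z : Cell d N) : ∑ K, f (K + z) = ∑ K, f K :=
  Equiv.sum_comp (Equiv.addRight z) f

lemma sum_range_natCast (f : ZMod N → ℝ) : ∑ m ∈ Finset.range N, f (m : ZMod N) = ∑ t, f t := by
  refine Finset.sum_nbij' (fun m => (m : ZMod N)) (fun t => t.val) ?_ ?_ ?_ ?_ ?_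
  · simp
  · intro t _
    simpa using ZMod.val_lt t
  · intro m hm
    simpa using ZMod.val_cast_of_lt (Finset.mem_range.1 hm)
  · intro t _
    simp
  · simp

/-- The oscillation on a discrete circle is bounded by the total variation. -/
lemma sub_le_sum_abs_jump (g : ZMod N → ℝ) (a b : ZMod N) :
    g a - g b ≤ ∑ t, |g (t + 1) - g t| := by
  have key : ∀ n : ℕ, g (b + n) - g b ≤ ∑ m ∈ Finset.range n, |g (b + m + 1) - g (b + m)| := by
    intro n
    induction n with
    | zero => simp
    | succ n ih =>
      rw [Finset.sum_range_succ]
      have := le_abs_self (g (b + n + 1) - g (b + n))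
      push_cast
      rw [← add_assoc]
      linarith
  have h1 := key (a - b).val
  rw [ZMod.natCast_zmod_val, add_sub_cancel] at h1
  refine h1.trans ?_
  calc ∑ m ∈ Finset.range (a - b).val, |g (b + m + 1) - g (b + m)|
      ≤ ∑ m ∈ Finset.range N, |g (b + m + 1) - g (b + m)| := by
        refine Finset.sum_le_sum_of_subset_of_nonneg ?_ fun _ _ _ => abs_nonneg _
        exact Finset.range_subset_range.2 (ZMod.val_lt _).le
    _ = ∑ t : ZMod N, |g (b + t + 1) - g (b + t)| :=
        sum_range_natCast (fun t => |g (b + t + 1) - g (b + t)|)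
    _ = ∑ t, |g (t + 1) - g t| := Equiv.sum_comp (Equiv.addLeft b) (fun t => |g (t + 1) - g t|)

/-- Averaging the oscillation bound over the base point `b` replaces `g b` by the mean value. On a
circle no point is forced to vanish, so this zero-order term has to remain. -/
lemma le_sum_line (g : ZMod N → ℝ) (a : ZMod N) :
    g a ≤ ∑ t, (g t / N + |g (t + 1) - g t|) := by
  have hN : (0 : ℝ) < N := by exact_mod_cast Nat.pos_of_ne_zero (NeZero.ne N)
  have h1 : ∑ b, (g a - g b) ≤ ∑ _b : ZMod N, ∑ t, |g (t + 1) - g t| :=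
    Finset.sum_le_sum fun b _ => sub_le_sum_abs_jump g a b
  rw [Finset.sum_sub_distrib, Finset.sum_const, Finset.sum_const, Finset.card_univ, ZMod.card,
    nsmul_eq_mul, nsmul_eq_mul] at h1
  rw [Finset.sum_add_distrib, ← Finset.sum_div]
  rw [← sub_le_iff_le_add', sub_le_iff_le_add']
  have : g a = (N * g a) / N := by field_simp
  rw [this, ← sub_le_iff_le_add', ← sub_div, div_le_iff₀ hN]
  linarith

lemma le_sum_line_update (f : Cell d N → ℝ) (K : Cell d N) (i : Fin d) :
    f K ≤ ∑ t, (f (Function.update K i t) / N + |jump f (Function.update K i t) i|) := by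
  have := le_sum_line (fun t => f (Function.update K i t)) (K i)
  simp only [Function.update_eq_self] at this
  convert this using 4 with t
  have : Function.update K i t + e i = Function.update K i (t + 1) := by
    ext j
    by_cases hj : j = i
    · subst hj; simp [e]
    · simp [e, hj]
  rw [jump, this]

/-- The grid-lines lemma for finite sums. -/
lemma sum_prod_line_rpow_le (hd : 2 ≤ d) (G : Cell d N → ENNReal) :
    ∑ K, ∏ i, (∑ t, G (Function.update K i t)) ^ ((1 : ℝ) / ((d : ℝ) - 1))
      ≤ (∑ K, G K) ^ ((d : ℝ) / (d - 1)) := by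
  -- With the discrete σ-algebra and counting measure the integrals over lines and over the whole
  -- product become finite sums.
  let _ : MeasurableSpace (ZMod N) := ⊤
  have : MeasurableSingletonClass (ZMod N) := ⟨fun _ => trivial⟩
  have hd' : (2 : ℝ) ≤ d := by exact_mod_cast hd
  have hconj : Real.HolderConjugate (Fintype.card (Fin d)) ((d : ℝ) / (d - 1)) := by
    rw [Fintype.card_fin, Real.holderConjugate_iff]
    refine ⟨by linarith, ?_⟩
    rw [inv_div]
    field_simp
    ring
  have hm : Measurable G := measurable_of_countable _
  have := lintegral_prod_lintegral_pow_le (fun _ : Fin d => (Measure.count : Measure (ZMod N)))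
    hconj hm
  simpa [lintegral_fintype] using this

/-- The Gagliardo–Nirenberg–Sobolev inequality on a periodic grid. -/
lemma sum_rpow_le_gradient (hd : 2 ≤ d) (f : Cell d N → ℝ) (hf : ∀ K, 0 ≤ f K) :
    ∑ K, f K ^ ((d : ℝ) / (d - 1))
      ≤ (∑ K, (f K / N + ∑ i, |jump f K i|)) ^ ((d : ℝ) / (d - 1)) := by
  have hd' : (2 : ℝ) ≤ d := by exact_mod_cast hd
  have hp : (0 : ℝ) ≤ d / (d - 1) := div_nonneg (by linarith) (by linarith)
  have hq : (0 : ℝ) ≤ 1 / (d - 1) := div_nonneg (by linarith) (by linarith)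
  set g : Cell d N → ℝ := fun K => f K / N + ∑ i, |jump f K i| with hg
  have hg0 : ∀ K, 0 ≤ g K := fun K =>
    add_nonneg (div_nonneg (hf K) (Nat.cast_nonneg _)) (Finset.sum_nonneg fun _ _ => abs_nonneg _)
  have hline : ∀ K i, f K ≤ ∑ t, g (Function.update K i t) := by
    intro K i
    refine (le_sum_line_update f K i).trans (Finset.sum_le_sum fun t _ => ?_)
    exact add_le_add le_rfl (Finset.single_le_sum
      (f := fun j => |jump f (Function.update K i t) j|)
      (fun _ _ => abs_nonneg _) (Finset.mem_univ i))
  have main := sum_prod_line_rpow_le hd (fun K => ENNReal.ofReal (g K))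
  have hleft : ENNReal.ofReal (∑ K, f K ^ ((d : ℝ) / (d - 1))) ≤
      ∑ K, ∏ i : Fin d, (∑ t, ENNReal.ofReal (g (Function.update K i t)))
        ^ ((1 : ℝ) / ((d : ℝ) - 1)) := by
    rw [ENNReal.ofReal_sum_of_nonneg fun K _ => Real.rpow_nonneg (hf K) _]
    refine Finset.sum_le_sum fun K _ => ?_
    calc ENNReal.ofReal (f K ^ ((d : ℝ) / (d - 1)))
        = ∏ _i : Fin d, (ENNReal.ofReal (f K)) ^ ((1 : ℝ) / ((d : ℝ) - 1)) := by
          rw [Finset.prod_const, Finset.card_univ, Fintype.card_fin, ← ENNReal.rpow_natCast,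
            ← ENNReal.rpow_mul, ENNReal.ofReal_rpow_of_nonneg (hf K) (by positivity)]
          congr 2
          ring
      _ ≤ _ := by
          refine Finset.prod_le_prod' fun i _ => ENNReal.rpow_le_rpow ?_ hq
          rw [← ENNReal.ofReal_sum_of_nonneg fun t _ => hg0 _]
          exact ENNReal.ofReal_le_ofReal (hline K i)
  have h3 := hleft.trans main
  rw [← ENNReal.ofReal_sum_of_nonneg fun K _ => hg0 K,
    ENNReal.ofReal_rpow_of_nonneg (Finset.sum_nonneg fun K _ => hg0 K) hp] at h3
  exact (ENNReal.ofReal_le_ofReal_iff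
    (Real.rpow_nonneg (Finset.sum_nonneg fun K _ => hg0 K) _)).1 h3

/-- The graph of a convex power lies above its tangents. -/
lemma rpow_tangent_le {a b s : ℝ} (ha : 0 < a) (hb : 0 ≤ b) (hs : 1 ≤ s) :
    a ^ s + s * a ^ (s - 1) * (b - a) ≤ b ^ s := by
  have h1 := one_add_mul_self_le_rpow_one_add (s := (b - a) / a) (p := s)
    (by rw [le_div_iff₀ ha]; linarith) hs
  have h2 : 1 + (b - a) / a = b / a := by field_simp; ring
  rw [h2, Real.div_rpow hb ha.le, le_div_iff₀ (Real.rpow_pos_of_pos ha _)] at h1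
  refine le_trans (le_of_eq ?_) h1
  rw [Real.rpow_sub_one ha.ne']; field_simp

/-- The graph of a concave power lies below its tangents. -/
lemma rpow_le_tangent {a b s : ℝ} (ha : 0 < a) (hb : 0 ≤ b) (hs0 : 0 ≤ s) (hs : s ≤ 1) :
    b ^ s ≤ a ^ s + s * a ^ (s - 1) * (b - a) := by
  have h1 := rpow_one_add_le_one_add_mul_self (s := (b - a) / a) (p := s)
    (by rw [le_div_iff₀ ha]; linarith) hs0 hs
  have h2 : 1 + (b - a) / a = b / a := by field_simp; ring
  rw [h2, Real.div_rpow hb ha.le, div_le_iff₀ (Real.rpow_pos_of_pos ha _)] at h1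
  refine h1.trans (le_of_eq ?_)
  rw [Real.rpow_sub_one ha.ne']; field_simp

lemma abs_rpow_sub_rpow_le {a b s : ℝ} (ha : 0 ≤ a) (hb : 0 ≤ b) (hs : 1 ≤ s) :
    |a ^ s - b ^ s| ≤ s * (a ^ (s - 1) + b ^ (s - 1)) * |a - b| := by
  have key : ∀ a b : ℝ, 0 ≤ b → b ≤ a → a ^ s - b ^ s ≤ s * a ^ (s - 1) * (a - b) := by
    intro a b hb hab
    rcases (hb.trans hab).eq_or_lt with h | h
    · have : b = 0 := by linarith
      subst this; rw [← h]; simp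
    · have := rpow_tangent_le h hb hs
      linarith
  have hs0 : 0 ≤ s := by linarith
  rcases le_total b a with hab | hab
  · rw [abs_of_nonneg (sub_nonneg.2 (Real.rpow_le_rpow hb hab hs0)), abs_of_nonneg (sub_nonneg.2 hab)]
    refine (key a b hb hab).trans ?_
    have : 0 ≤ b ^ (s - 1) := Real.rpow_nonneg hb _
    have h2 : 0 ≤ a - b := sub_nonneg.2 hab
    gcongr
    linarith
  · rw [abs_sub_comm, abs_sub_comm a b, abs_of_nonneg (sub_nonneg.2 (Real.rpow_le_rpow ha hab hs0)),
      abs_of_nonneg (sub_nonneg.2 hab)]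
    refine (key b a ha hab).trans ?_
    have : 0 ≤ a ^ (s - 1) := Real.rpow_nonneg ha _
    have h2 : 0 ≤ b - a := sub_nonneg.2 hab
    gcongr
    linarith

/-- The jump of `w ^ s` is at most `s` times the sum of the two values of `w ^ (s - 1)` times the
jump of `w`; Cauchy–Schwarz separates the factors. The exponent `2 * s - 2` is the point: it is low
enough for the resulting power sum to be absorbed or cancelled when this meets
`sum_rpow_le_gradient`. -/
lemma sum_rpow_gradient_sq_le {s : ℝ} (hs : 1 ≤ s) (w : Cell d N → ℝ) (hw : ∀ K, 0 ≤ w K) :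
    (∑ K, (w K ^ s / N + ∑ i, |jump (fun K => w K ^ s) K i|)) ^ 2
      ≤ (2 + 8 * d * s ^ 2) * (∑ K, w K ^ (2 * s - 2))
        * ∑ K, (w K ^ 2 / N ^ 2 + ∑ i, jump w K i ^ 2) := by
  set A : ℝ := ∑ K, w K ^ (2 * s - 2) with hA
  have hA0 : 0 ≤ A := Finset.sum_nonneg fun K _ => Real.rpow_nonneg (hw K) _
  have hsq : ∀ K, (w K ^ (s - 1)) ^ 2 = w K ^ (2 * s - 2) := by
    intro K
    rw [← Real.rpow_natCast, ← Real.rpow_mul (hw K)]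
    congr 1; push_cast; ring
  have h1 : (∑ K, w K ^ s / N) ^ 2 ≤ A * ∑ K, w K ^ 2 / N ^ 2 := by
    have h := Finset.sum_mul_sq_le_sq_mul_sq Finset.univ (fun K => w K ^ (s - 1))
      (fun K => w K / N)
    simp only [hsq, div_pow] at h
    refine le_trans (le_of_eq ?_) h
    congr 1
    refine Finset.sum_congr rfl fun K _ => ?_
    have : w K ^ s = w K ^ (s - 1) * w K := by
      conv_lhs => rw [show s = (s - 1) + 1 by ring,
        Real.rpow_add_of_nonneg (hw K) (by linarith) zero_le_one, Real.rpow_one]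
    rw [this]; ring
  have h2 : (∑ K, ∑ i, |jump (fun K => w K ^ s) K i|) ^ 2
      ≤ (4 * d * s ^ 2 * A) * ∑ K, ∑ i, jump w K i ^ 2 := by
    have hle : ∑ K, ∑ i, |jump (fun K => w K ^ s) K i|
        ≤ ∑ x : Cell d N × Fin d, (s * (w (x.1 + e x.2) ^ (s - 1) + w x.1 ^ (s - 1)))
            * |jump w x.1 x.2| := by
      rw [Fintype.sum_prod_type]
      exact Finset.sum_le_sum fun K _ => Finset.sum_le_sum fun i _ =>
        abs_rpow_sub_rpow_le (hw _) (hw _) hs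
    have h0 : 0 ≤ ∑ K, ∑ i, |jump (fun K => w K ^ s) K i| :=
      Finset.sum_nonneg fun _ _ => Finset.sum_nonneg fun _ _ => abs_nonneg _
    refine (pow_le_pow_left₀ h0 hle 2).trans ?_
    refine (Finset.sum_mul_sq_le_sq_mul_sq _ _ _).trans ?_
    simp only [sq_abs, Fintype.sum_prod_type]
    refine mul_le_mul_of_nonneg_right ?_
      (Finset.sum_nonneg fun _ _ => Finset.sum_nonneg fun _ _ => sq_nonneg _)
    calc ∑ K, ∑ i : Fin d, (s * (w (K + e i) ^ (s - 1) + w K ^ (s - 1))) ^ 2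
        ≤ ∑ K, ∑ i : Fin d, 2 * s ^ 2 * (w (K + e i) ^ (2 * s - 2) + w K ^ (2 * s - 2)) := by
          refine Finset.sum_le_sum fun K _ => Finset.sum_le_sum fun i _ => ?_
          rw [← hsq, ← hsq]
          nlinarith [mul_nonneg (sq_nonneg s)
            (sq_nonneg (w (K + e i) ^ (s - 1) - w K ^ (s - 1)))]
      _ = 4 * d * s ^ 2 * A := by
          rw [Finset.sum_comm]
          simp_rw [← Finset.mul_sum, Finset.sum_add_distrib]
          simp_rw [sum_comp_add (fun K => w K ^ (2 * s - 2))]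
          rw [← hA]
          simp
          ring
  rw [Finset.sum_add_distrib, Finset.sum_add_distrib]
  set a := ∑ K, w K ^ s / N
  set b := ∑ K, ∑ i, |jump (fun K => w K ^ s) K i|
  set X := ∑ K, w K ^ 2 / N ^ 2 with hX
  set Y := ∑ K, ∑ i, jump w K i ^ 2
  have hX0 : 0 ≤ X := Finset.sum_nonneg fun K _ => by positivity
  have hY0 : 0 ≤ Y := Finset.sum_nonneg fun _ _ => Finset.sum_nonneg fun _ _ => sq_nonneg _
  have : (a + b) ^ 2 ≤ 2 * a ^ 2 + 2 * b ^ 2 := by nlinarith [sq_nonneg (a - b)]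
  refine this.trans ?_
  have e1 : 0 ≤ A * Y := mul_nonneg hA0 hY0
  have e2 : 0 ≤ (8 * d * s ^ 2) * (A * X) := by positivity
  nlinarith

end GridInequalities

/-- The square of the discrete `H¹` norm. -/
def sobolevSq {d N : ℕ} [NeZero N] (h : ℝ) (w : Cell d N → ℝ) : ℝ :=
  h ^ d * ∑ K, (w K ^ 2 + ∑ i, (h⁻¹ * jump w K i) ^ 2)

/-! ### Discrete Sobolev embeddings -/

section Sobolev

lemma meshSize_pos (L : ℝ) (N : ℕ) [NeZero N] [hL : Fact (0 < L)] : 0 < meshSize L N :=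
  div_pos hL.out (by exact_mod_cast Nat.pos_of_ne_zero (NeZero.ne N))

variable {d N : ℕ} [NeZero N] {L : ℝ} [hL : Fact (0 < L)]

lemma sobolevSq_nonneg {h : ℝ} (hh : 0 ≤ h) (w : Cell d N → ℝ) : 0 ≤ sobolevSq h w :=
  mul_nonneg (pow_nonneg hh d) (Finset.sum_nonneg fun _ _ =>
    add_nonneg (sq_nonneg _) (Finset.sum_nonneg fun _ _ => sq_nonneg _))

lemma sum_sq_le_sobolevSq {h : ℝ} (hh : 0 ≤ h) (w : Cell d N → ℝ) :
    h ^ d * ∑ K, w K ^ 2 ≤ sobolevSq h w := by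
  refine mul_le_mul_of_nonneg_left (Finset.sum_le_sum fun K _ => ?_) (pow_nonneg hh d)
  exact le_add_of_nonneg_right (Finset.sum_nonneg fun _ _ => sq_nonneg _)

lemma sum_scaled_gradient_le (w : Cell d N → ℝ) :
    ∑ K, (w K ^ 2 / (N : ℝ) ^ 2 + ∑ i, jump w K i ^ 2)
      ≤ (1 + (L ^ 2)⁻¹) * meshSize L N ^ 2 *
        ∑ K, (w K ^ 2 + ∑ i, ((meshSize L N)⁻¹ * jump w K i) ^ 2) := by
  have hh := meshSize_pos L N
  have hN : (0 : ℝ) < N := by exact_mod_cast Nat.pos_of_ne_zero (NeZero.ne N)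
  have hL0 : 0 < L := hL.out
  rw [Finset.mul_sum]
  refine Finset.sum_le_sum fun K _ => ?_
  have h1 : w K ^ 2 / (N : ℝ) ^ 2 = (L ^ 2)⁻¹ * meshSize L N ^ 2 * w K ^ 2 := by
    rw [meshSize]; field_simp
  have h2 : ∑ i, jump w K i ^ 2
      = meshSize L N ^ 2 * ∑ i, ((meshSize L N)⁻¹ * jump w K i) ^ 2 := by
    rw [Finset.mul_sum]
    refine Finset.sum_congr rfl fun i _ => ?_
    field_simp
  rw [h1, h2]
  have h3 : 0 ≤ ∑ i, ((meshSize L N)⁻¹ * jump w K i) ^ 2 :=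
    Finset.sum_nonneg fun _ _ => sq_nonneg _
  have h4 : 0 ≤ (L ^ 2)⁻¹ * meshSize L N ^ 2 * ∑ i, ((meshSize L N)⁻¹ * jump w K i) ^ 2 := by
    positivity
  have h5 : 0 ≤ meshSize L N ^ 2 * w K ^ 2 := by positivity
  nlinarith

lemma sum_rpow_gradient_sq_le_sobolevSq {s : ℝ} (hs : 1 ≤ s) (w : Cell d N → ℝ)
    (hw : ∀ K, 0 ≤ w K) :
    (∑ K, (w K ^ s / N + ∑ i, |jump (fun K => w K ^ s) K i|)) ^ 2
      ≤ (2 + 8 * d * s ^ 2) * (1 + (L ^ 2)⁻¹) * (∑ K, w K ^ (2 * s - 2))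
        * (meshSize L N ^ 2 * ∑ K, (w K ^ 2 + ∑ i, ((meshSize L N)⁻¹ * jump w K i) ^ 2)) := by
  refine (sum_rpow_gradient_sq_le hs w hw).trans ?_
  have hA0 : 0 ≤ ∑ K, w K ^ (2 * s - 2) := Finset.sum_nonneg fun K _ => Real.rpow_nonneg (hw K) _
  refine (mul_le_mul_of_nonneg_left (sum_scaled_gradient_le (L := L) w) (by positivity)).trans ?_
  apply le_of_eq; ring

/-- Two-dimensional multiplicative Sobolev inequality. -/
lemma sum_rpow_two_mul_le {s : ℝ} (hs : 1 ≤ s) (w : Cell 2 N → ℝ) (hw : ∀ K, 0 ≤ w K) :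
    ∑ K, w K ^ (2 * s) ≤ (2 + 16 * s ^ 2) * (1 + (L ^ 2)⁻¹) * (∑ K, w K ^ (2 * s - 2))
        * sobolevSq (meshSize L N) w := by
  have h1 := sum_rpow_le_gradient le_rfl (fun K => w K ^ s) fun K => Real.rpow_nonneg (hw K) _
  have h2 := sum_rpow_gradient_sq_le_sobolevSq (L := L) hs w hw
  have h3 : ((2 : ℕ) : ℝ) / ((2 : ℕ) - 1) = (2 : ℕ) := by norm_num
  rw [h3, Real.rpow_natCast] at h1
  have h4 : ∀ K, (w K ^ s) ^ ((2 : ℕ) : ℝ) = w K ^ (2 * s) := fun K => by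
    rw [← Real.rpow_mul (hw K)]; congr 1; push_cast; ring
  simp only [h4] at h1
  refine h1.trans (h2.trans (le_of_eq ?_))
  rw [sobolevSq]; push_cast; ring

/-- The power `s = 4` makes the scheme close: both `s * d / (d - 1)` and `2 * s - 2` equal `6`. With
`A` the sum of sixth powers, one gets `A ^ 4 ≤ (c * A * G) ^ 3`, and `A ^ 3` cancels. The constant
is `386 = 2 + 8 * 3 * 4 ^ 2`. -/
lemma sum_pow_six_le (w : Cell 3 N → ℝ) (hw : ∀ K, 0 ≤ w K) :
    meshSize L N ^ 3 * ∑ K, w K ^ 6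
      ≤ (386 * (1 + (L ^ 2)⁻¹)) ^ 3 * sobolevSq (meshSize L N) w ^ 3 := by
  have hh := meshSize_pos L N
  have h1 := sum_rpow_le_gradient (by norm_num) (fun K => w K ^ (4 : ℝ))
    fun K => Real.rpow_nonneg (hw K) _
  have h2 := sum_rpow_gradient_sq_le_sobolevSq (L := L) (s := 4) (by norm_num) w hw
  have h3 : ((3 : ℕ) : ℝ) / ((3 : ℕ) - 1) = 3 / 2 := by norm_num
  have h4 : ∀ K, (w K ^ (4 : ℝ)) ^ ((3 : ℝ) / 2) = w K ^ 6 := fun K => by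
    rw [← Real.rpow_mul (hw K), ← Real.rpow_natCast]; congr 1; norm_num
  have h5 : ∀ K, w K ^ (2 * (4 : ℝ) - 2) = w K ^ 6 := fun K => by
    rw [← Real.rpow_natCast]; congr 1; norm_num
  simp only [h3, h4, h5] at h1 h2
  set A := ∑ K, w K ^ 6 with hA
  set S := ∑ K, (w K ^ (4 : ℝ) / N + ∑ i, |jump (fun K => w K ^ (4 : ℝ)) K i|) with hS
  have hA0 : 0 ≤ A := Finset.sum_nonneg fun K _ => pow_nonneg (hw K) 6
  have hS0 : 0 ≤ S := Finset.sum_nonneg fun K _ => add_nonneg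
    (div_nonneg (Real.rpow_nonneg (hw K) _) (Nat.cast_nonneg _))
    (Finset.sum_nonneg fun _ _ => abs_nonneg _)
  set G := meshSize L N ^ 2 * ∑ K, (w K ^ 2 + ∑ i, ((meshSize L N)⁻¹ * jump w K i) ^ 2) with hG
  have hG' : sobolevSq (meshSize L N) w = meshSize L N * G := by rw [sobolevSq, hG]; ring
  have hG0 : 0 ≤ G := by
    have := sobolevSq_nonneg hh.le w
    rw [hG'] at this
    exact nonneg_of_mul_nonneg_right this hh
  set c := (2 + 8 * ((3 : ℕ) : ℝ) * 4 ^ 2) * (1 + (L ^ 2)⁻¹) with hc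
  have hc0 : 0 ≤ c := by positivity
  have hA2 : A ^ 2 ≤ S ^ 3 := by
    refine (pow_le_pow_left₀ hA0 h1 2).trans (le_of_eq ?_)
    rw [← Real.rpow_natCast, ← Real.rpow_mul hS0, ← Real.rpow_natCast]; norm_num
  have hA4 : A ^ 3 * A ≤ A ^ 3 * (c * G) ^ 3 := by
    calc A ^ 3 * A = (A ^ 2) ^ 2 := by ring
      _ ≤ (S ^ 3) ^ 2 := pow_le_pow_left₀ (by positivity) hA2 2
      _ = (S ^ 2) ^ 3 := by ring
      _ ≤ (c * A * G) ^ 3 := pow_le_pow_left₀ (by positivity) h2 3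
      _ = _ := by ring
  have hfin : A ≤ (c * G) ^ 3 := by
    rcases hA0.eq_or_lt with h | h
    · rw [← h]; positivity
    · exact le_of_mul_le_mul_left hA4 (by positivity)
  have hc' : c = 386 * (1 + (L ^ 2)⁻¹) := by rw [hc]; norm_num
  rw [hG', ← hc']
  calc meshSize L N ^ 3 * A ≤ meshSize L N ^ 3 * (c * G) ^ 3 := by gcongr
    _ = _ := by ring

lemma card_cell (d N : ℕ) [NeZero N] : Fintype.card (Cell d N) = N ^ d := by
  simp [Cell, ZMod.card]

lemma meshSize_pow_mul_card (d : ℕ) (L : ℝ) (N : ℕ) [NeZero N] :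
    meshSize L N ^ d * (N : ℝ) ^ d = L ^ d := by
  have hN : (N : ℝ) ≠ 0 := by exact_mod_cast NeZero.ne N
  rw [← mul_pow, meshSize, div_mul_cancel₀ _ hN]

lemma meshSize_pow_mul_sum_const (d : ℕ) (L : ℝ) (N : ℕ) [NeZero N] (c : ℝ) :
    meshSize L N ^ d * ∑ _K : Cell d N, c = L ^ d * c := by
  rw [Finset.sum_const, Finset.card_univ, card_cell, nsmul_eq_mul, Nat.cast_pow, ← mul_assoc,
    meshSize_pow_mul_card]

/-- The discrete Sobolev embedding into `L^p` for all `p ≥ 2` in two dimensions. -/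
lemma sum_rpow_le_sobolevSq_two {s : ℝ} (hs : 1 ≤ s) :
    ∃ C : ℝ, 0 < C ∧ ∀ (N : ℕ) [NeZero N] (w : Cell 2 N → ℝ), (∀ K, 0 ≤ w K) →
      meshSize L N ^ 2 * ∑ K, w K ^ (2 * s) ≤ C * sobolevSq (meshSize L N) w ^ s := by
  have hL0 : 0 < L := hL.out
  set c := (2 + 16 * s ^ 2) * (1 + (L ^ 2)⁻¹) with hc
  have hc0 : 0 < c := by positivity
  refine ⟨2 * c * (2 * c) ^ (s - 1) * L ^ 2, by positivity, fun N _ w hw => ?_⟩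
  have hh := meshSize_pos L N
  have h1 := sum_rpow_two_mul_le (L := L) hs w hw
  rw [← hc] at h1
  set H := sobolevSq (meshSize L N) w
  have hH0 : 0 ≤ H := sobolevSq_nonneg hh.le w
  rcases hH0.eq_or_lt with hH | hH
  · rw [← hH, mul_zero] at h1
    rw [← hH, Real.zero_rpow (by linarith), mul_zero]
    exact mul_nonpos_of_nonneg_of_nonpos (by positivity) h1
  -- The threshold for `w ^ 2`: above it `w ^ (2 * s - 2)` is at most `τ⁻¹ * w ^ (2 * s)`, and this
  -- `τ` makes the coefficient of the left-hand side on the right exactly `1 / 2`, so that it can be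
  -- absorbed.
  set τ := 2 * c * H with hτ
  have hτ0 : 0 < τ := by positivity
  have hsplit : ∀ K, w K ^ (2 * s - 2) ≤ τ ^ (s - 1) + τ⁻¹ * w K ^ (2 * s) := by
    intro K
    have hwK := hw K
    have e1 : w K ^ (2 * s - 2) = (w K ^ 2) ^ (s - 1) := by
      rw [← Real.rpow_natCast, ← Real.rpow_mul hwK]; congr 1; push_cast; ring
    rcases le_total (w K ^ 2) τ with h | h
    · have : 0 ≤ τ⁻¹ * w K ^ (2 * s) := mul_nonneg (by positivity) (Real.rpow_nonneg hwK _)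
      rw [e1]
      have := Real.rpow_le_rpow (sq_nonneg (w K)) h (show 0 ≤ s - 1 by linarith)
      linarith
    · have h0 : 0 ≤ τ ^ (s - 1) := by positivity
      have e2 : w K ^ (2 * s) = w K ^ (2 * s - 2) * w K ^ 2 := by
        rw [← Real.rpow_natCast, ← Real.rpow_add_of_nonneg hwK (by linarith) (by norm_num)]
        congr 1; push_cast; ring
      have e3 : 0 ≤ w K ^ (2 * s - 2) := Real.rpow_nonneg hwK _
      have : w K ^ (2 * s - 2) ≤ τ⁻¹ * w K ^ (2 * s) := by
        rw [e2, inv_mul_eq_div, le_div_iff₀ hτ0]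
        gcongr
      linarith
  have h2 : meshSize L N ^ 2 * ∑ K, w K ^ (2 * s - 2)
      ≤ L ^ 2 * τ ^ (s - 1) + τ⁻¹ * (meshSize L N ^ 2 * ∑ K, w K ^ (2 * s)) := by
    calc meshSize L N ^ 2 * ∑ K, w K ^ (2 * s - 2)
        ≤ meshSize L N ^ 2 * ∑ K, (τ ^ (s - 1) + τ⁻¹ * w K ^ (2 * s)) := by
          gcongr with K; exact hsplit K
      _ = _ := by
          rw [Finset.sum_add_distrib, mul_add, meshSize_pow_mul_sum_const, ← Finset.mul_sum]
          ring
  set A := meshSize L N ^ 2 * ∑ K, w K ^ (2 * s) with hA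
  have h3 : A ≤ c * H * (L ^ 2 * τ ^ (s - 1) + τ⁻¹ * A) := by
    calc A ≤ meshSize L N ^ 2 * (c * (∑ K, w K ^ (2 * s - 2)) * H) := by rw [hA]; gcongr
      _ = c * H * (meshSize L N ^ 2 * ∑ K, w K ^ (2 * s - 2)) := by ring
      _ ≤ _ := by gcongr
  have h4 : c * H * (τ⁻¹ * A) = A / 2 := by rw [hτ]; field_simp
  have h5 : A ≤ 2 * (c * H * (L ^ 2 * τ ^ (s - 1))) := by
    rw [mul_add, h4] at h3; linarith
  refine h5.trans (le_of_eq ?_)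
  have h6 : H ^ s = H ^ (s - 1) * H := by
    rw [Real.rpow_sub_one hH.ne']; field_simp
  rw [hτ, Real.mul_rpow (by positivity) hH.le, h6]
  ring

end Sobolev

/-! ### Translations and a density-weighted Poincaré inequality -/

section Poincare

variable {d N : ℕ} [NeZero N]

lemma sum_translate_single_le (w : Cell d N → ℝ) (i : Fin d) (n : ℕ) :
    ∑ K, (w (K + Pi.single i (n : ZMod N)) - w K) ^ 2 ≤ n ^ 2 * ∑ K, jump w K i ^ 2 := by
  have h1 : ∀ K, w (K + Pi.single i (n : ZMod N)) - w K
      = ∑ m ∈ Finset.range n, jump w (K + Pi.single i (m : ZMod N)) i := by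
    intro K
    induction n with
    | zero => simp
    | succ n ih =>
      have h2 : (Pi.single i ((n + 1 : ℕ) : ZMod N) : Cell d N) = Pi.single i (n : ZMod N) + e i := by
        rw [e, ← Pi.single_add, Nat.cast_succ]
      rw [Finset.sum_range_succ, ← ih, jump, h2, ← add_assoc]
      ring
  have h2 : ∀ K, (w (K + Pi.single i (n : ZMod N)) - w K) ^ 2
      ≤ n * ∑ m ∈ Finset.range n, jump w (K + Pi.single i (m : ZMod N)) i ^ 2 := by
    intro K
    have := sq_sum_le_card_mul_sum_sq (s := Finset.range n)
      (f := fun m : ℕ => jump w (K + Pi.single i (m : ZMod N)) i)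
    rwa [Finset.card_range, ← h1] at this
  refine (Finset.sum_le_sum fun K _ => h2 K).trans (le_of_eq ?_)
  rw [← Finset.mul_sum, Finset.sum_comm]
  have h3 : ∀ m : ℕ, ∑ K : Cell d N, jump w (K + Pi.single i (m : ZMod N)) i ^ 2
      = ∑ K, jump w K i ^ 2 := by
    intro m
    exact sum_comp_add (fun K : Cell d N => jump w K i ^ 2) (Pi.single i (m : ZMod N))
  simp only [h3, Finset.sum_const, Finset.card_range, nsmul_eq_mul]
  ring

lemma sum_translate_sum_le (w : Cell d N → ℝ) (z : Fin d → Cell d N) (S : Finset (Fin d)) :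
    ∑ K, (w (K + ∑ i ∈ S, z i) - w K) ^ 2
      ≤ 2 ^ S.card * ∑ i ∈ S, ∑ K, (w (K + z i) - w K) ^ 2 := by
  classical
  induction S using Finset.induction_on with
  | empty => simp
  | insert i S hi ih =>
    rw [Finset.sum_insert hi, Finset.sum_insert hi, Finset.card_insert_of_notMem hi]
    set σ := ∑ i ∈ S, z i
    have h1 : ∑ K, (w (K + (z i + σ)) - w K) ^ 2
        ≤ 2 * ∑ K, (w (K + z i) - w K) ^ 2 + 2 * ∑ K, (w (K + σ) - w K) ^ 2 := by
      rw [← sum_comp_add (fun K => (w (K + σ) - w K) ^ 2) (z i), Finset.mul_sum, Finset.mul_sum,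
        ← Finset.sum_add_distrib]
      refine Finset.sum_le_sum fun K _ => ?_
      rw [← add_assoc]
      nlinarith [sq_nonneg ((w (K + z i) - w K) - (w (K + z i + σ) - w (K + z i)))]
    have h2 : 0 ≤ ∑ K, (w (K + z i) - w K) ^ 2 := Finset.sum_nonneg fun _ _ => sq_nonneg _
    have h3 : (1 : ℝ) ≤ 2 ^ S.card := one_le_pow₀ (by norm_num)
    rw [pow_succ]
    nlinarith

/-- A shift is composed of fewer than `N` unit steps in each direction, and Cauchy–Schwarz along `n`
steps costs `n ^ 2`. Since `N * h = L`, the factor `N ^ 2` is exactly what turns jumps into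
difference quotients. -/
lemma sum_translate_le (w : Cell d N → ℝ) (z : Cell d N) :
    ∑ K, (w (K + z) - w K) ^ 2 ≤ 2 ^ d * (N : ℝ) ^ 2 * ∑ K, ∑ i, jump w K i ^ 2 := by
  have hz : z = ∑ i, Pi.single i (((z i).val : ℕ) : ZMod N) := by
    simp only [ZMod.natCast_zmod_val, Finset.univ_sum_single]
  have h1 := sum_translate_sum_le w (fun i => Pi.single i (((z i).val : ℕ) : ZMod N)) Finset.univ
  rw [← hz, Finset.card_univ, Fintype.card_fin] at h1
  refine h1.trans ?_
  have h4 : (N : ℝ) ^ 2 * ∑ K, ∑ i, jump w K i ^ 2 = ∑ i, (N : ℝ) ^ 2 * ∑ K, jump w K i ^ 2 := by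
    rw [Finset.sum_comm, Finset.mul_sum]
  rw [mul_assoc, h4]
  gcongr with i
  refine (sum_translate_single_le w i _).trans ?_
  have h2 : 0 ≤ ∑ K, jump w K i ^ 2 := Finset.sum_nonneg fun _ _ => sq_nonneg _
  have h3 : ((z i).val : ℝ) ≤ N := by exact_mod_cast (ZMod.val_lt (z i)).le
  gcongr

/-- A Poincaré inequality in which the mean value is replaced by a weighted `L²` norm; the weight
is only controlled through its mass and its `L^γ` norm. -/
lemma sum_sq_le_weighted {L γ M B : ℝ} [hL : Fact (0 < L)] (hγ : 1 < γ) (hM : 0 < M) (hB : 0 < B) :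
    ∃ C : ℝ, 0 < C ∧ ∀ (N : ℕ) [NeZero N] (r w : Cell d N → ℝ), (∀ K, 0 < r K) →
      meshSize L N ^ d * ∑ K, r K = M → meshSize L N ^ d * ∑ K, r K ^ γ ≤ B →
      meshSize L N ^ d * ∑ K, w K ^ 2 ≤ C * (meshSize L N ^ d * ∑ K, r K * w K ^ 2
        + meshSize L N ^ d * ∑ K, ∑ i, ((meshSize L N)⁻¹ * jump w K i) ^ 2) := by
  have hL0 : 0 < L := hL.out
  -- The truncation level is chosen so that the mass removed by replacing `r` with `min r κ`, which
  -- is at most `κ ^ (1 - γ) * B`, is at most half of the total mass. The truncated weight thus has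
  -- mass at least `M / 2` and is bounded.
  set κ := (2 * B / M) ^ (1 / (γ - 1)) with hκ
  have hκ0 : 0 < κ := by positivity
  have hκB : κ ^ (1 - γ) * B = M / 2 := by
    rw [hκ, ← Real.rpow_mul (by positivity)]
    have : 1 / (γ - 1) * (1 - γ) = -1 := by
      have : γ - 1 ≠ 0 := by linarith
      field_simp; ring
    rw [this, Real.rpow_neg_one]; field_simp
  refine ⟨2 / M * (2 * L ^ d + 2 * κ * L ^ d * 2 ^ d * L ^ 2), by positivity,
    fun N _ r w hr hmass hpress => ?_⟩
  have hh := meshSize_pos L N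
  set h := meshSize L N with hdef
  have hN : (0 : ℝ) < N := by exact_mod_cast Nat.pos_of_ne_zero (NeZero.ne N)
  have hhN : h * N = L := by rw [hdef, meshSize]; field_simp
  set η : Cell d N → ℝ := fun K => min (r K) κ with hη
  have hη0 : ∀ K, 0 ≤ η K := fun K => le_min (hr K).le hκ0.le
  have hle : ∀ K, r K ≤ η K + κ ^ (1 - γ) * r K ^ γ := by
    intro K
    rcases le_total (r K) κ with hc | hc
    · simp only [hη, min_eq_left hc]
      have : 0 ≤ κ ^ (1 - γ) * r K ^ γ :=
        mul_nonneg (by positivity) (Real.rpow_nonneg (hr K).le _)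
      linarith
    · have h1 : r K = r K ^ (1 - γ) * r K ^ γ := by
        rw [← Real.rpow_add (hr K)]; simp
      have h2 : r K ^ (1 - γ) ≤ κ ^ (1 - γ) :=
        Real.rpow_le_rpow_of_nonpos hκ0 hc (by linarith)
      have h3 : r K ^ (1 - γ) * r K ^ γ ≤ κ ^ (1 - γ) * r K ^ γ :=
        mul_le_mul_of_nonneg_right h2 (Real.rpow_nonneg (hr K).le _)
      have := hη0 K
      linarith
  have hηM : M / 2 ≤ h ^ d * ∑ K, η K := by
    have h1 : h ^ d * ∑ K, r K ≤ h ^ d * ∑ K, (η K + κ ^ (1 - γ) * r K ^ γ) := by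
      gcongr with K; exact hle K
    rw [hmass, Finset.sum_add_distrib, ← Finset.mul_sum, mul_add] at h1
    have h2 : h ^ d * (κ ^ (1 - γ) * ∑ K, r K ^ γ) ≤ κ ^ (1 - γ) * B := by
      calc _ = κ ^ (1 - γ) * (h ^ d * ∑ K, r K ^ γ) := by ring
        _ ≤ _ := by gcongr
    linarith
  have hW0 : 0 ≤ ∑ K, w K ^ 2 := Finset.sum_nonneg fun _ _ => sq_nonneg _
  set D := ∑ K, ∑ i, jump w K i ^ 2 with hD
  have hD0 : 0 ≤ D := Finset.sum_nonneg fun _ _ => Finset.sum_nonneg fun _ _ => sq_nonneg _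
  have hmain : (∑ K, η K) * ∑ K, w K ^ 2
      ≤ (N : ℝ) ^ d * (2 * ∑ K, r K * w K ^ 2 + 2 * κ * (2 ^ d * (N : ℝ) ^ 2 * D)) := by
    -- The product is a sum over all translations. For each one, `w K` is compared with `w (K + z)`:
    -- the main part is controlled by `η ≤ r`, the difference by `η ≤ κ` and the translation
    -- estimate.
    have e1 : (∑ K, η K) * ∑ K, w K ^ 2 = ∑ z, ∑ K, η (K + z) * w K ^ 2 := by
      rw [Finset.sum_comm, Finset.mul_sum]
      refine Finset.sum_congr rfl fun K _ => ?_
      rw [← Finset.sum_mul]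
      congr 1
      simp_rw [add_comm K]
      exact (sum_comp_add η K).symm
    have e2 : ∀ z, ∑ K, η (K + z) * w K ^ 2
        ≤ 2 * ∑ K, r K * w K ^ 2 + 2 * κ * (2 ^ d * (N : ℝ) ^ 2 * D) := by
      intro z
      calc ∑ K, η (K + z) * w K ^ 2
          ≤ ∑ K, (2 * (r (K + z) * w (K + z) ^ 2) + 2 * κ * (w (K + z) - w K) ^ 2) := by
            refine Finset.sum_le_sum fun K _ => ?_
            have f1 : η (K + z) ≤ r (K + z) := min_le_left _ _
            have f2 : η (K + z) ≤ κ := min_le_right _ _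
            have f3 := hη0 (K + z)
            have f4 : w K ^ 2 ≤ 2 * w (K + z) ^ 2 + 2 * (w (K + z) - w K) ^ 2 := by
              nlinarith [sq_nonneg (w (K + z) + (w (K + z) - w K))]
            have f5 := mul_le_mul_of_nonneg_left f4 f3
            have f6 := mul_le_mul_of_nonneg_right f1 (sq_nonneg (w (K + z)))
            have f7 := mul_le_mul_of_nonneg_right f2 (sq_nonneg (w (K + z) - w K))
            nlinarith
        _ ≤ _ := by
            rw [Finset.sum_add_distrib, ← Finset.mul_sum, ← Finset.mul_sum,
              sum_comp_add (fun K => r K * w K ^ 2) z]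
            gcongr
            exact sum_translate_le w z
    rw [e1]
    refine (Finset.sum_le_sum fun z _ => e2 z).trans ?_
    rw [Finset.sum_const, Finset.card_univ, card_cell, nsmul_eq_mul]
    push_cast
    exact le_rfl
  have hDG : ∑ K, ∑ i, (h⁻¹ * jump w K i) ^ 2 = (h ^ 2)⁻¹ * D := by
    simp_rw [hD, Finset.mul_sum]
    refine Finset.sum_congr rfl fun K _ => Finset.sum_congr rfl fun i _ => ?_
    rw [mul_pow, inv_pow]
  have hND : (N : ℝ) ^ 2 * D = L ^ 2 * ((h ^ 2)⁻¹ * D) := by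
    rw [← hhN]; field_simp
  rw [hDG]
  set X := ∑ K, r K * w K ^ 2
  have hX0 : 0 ≤ X := Finset.sum_nonneg fun K _ => mul_nonneg (hr K).le (sq_nonneg _)
  set W := ∑ K, w K ^ 2
  set g := (h ^ 2)⁻¹ * D with hg
  have hg0 : 0 ≤ g := by positivity
  have hfin : M / 2 * (h ^ d * W) ≤ h ^ d * (2 * L ^ d * X + 2 * κ * L ^ d * 2 ^ d * L ^ 2 * g) := by
    calc M / 2 * (h ^ d * W) ≤ (h ^ d * ∑ K, η K) * (h ^ d * W) := by gcongr
      _ = h ^ d * h ^ d * ((∑ K, η K) * W) := by ring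
      _ ≤ h ^ d * h ^ d * ((N : ℝ) ^ d * (2 * X + 2 * κ * (2 ^ d * (N : ℝ) ^ 2 * D))) := by gcongr
      _ = h ^ d * ((h ^ d * (N : ℝ) ^ d) * (2 * X + 2 * κ * (2 ^ d * ((N : ℝ) ^ 2 * D)))) := by ring
      _ = _ := by rw [hdef, meshSize_pow_mul_card, hND]; ring
  have hW : h ^ d * W = 2 / M * (M / 2 * (h ^ d * W)) := by field_simp
  rw [hW]
  refine (mul_le_mul_of_nonneg_left hfin (by positivity)).trans ?_
  have : 0 ≤ 2 / M * (h ^ d * (2 * L ^ d * g + 2 * κ * L ^ d * 2 ^ d * L ^ 2 * X)) := by positivity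
  nlinarith

end Poincare

/-! ### Positivity, mass conservation and the energy inequality for one time step -/

section Scheme

variable {d N : ℕ} [NeZero N]

/-- The upwind value of `(x, y)` (in, out) for the normal velocity `s`, times `s`, for values of
opposite sign. -/
lemma ite_mul_sub_nonpos {x y s η : ℝ} (hx : x ≤ 0) (hy : 0 ≤ y) (hη : 0 ≤ η) :
    (if 0 ≤ s then x else y) * s - η * (y - x) ≤ 0 := by
  have h1 : 0 ≤ η * (y - x) := mul_nonneg hη (by linarith)
  split_ifs with hs
  · have := mul_nonpos_of_nonpos_of_nonneg hx hs; linarith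
  · have := mul_nonpos_of_nonneg_of_nonpos hy (not_le.1 hs).le; linarith

lemma ite_mul_sub_nonneg {x y s η : ℝ} (hx : 0 ≤ x) (hy : y ≤ 0) (hη : 0 ≤ η) :
    0 ≤ (if 0 ≤ s then x else y) * s - η * (y - x) := by
  have h1 : 0 ≤ η * (x - y) := mul_nonneg hη (by linarith)
  split_ifs with hs
  · have := mul_nonneg hx hs; linarith
  · have := mul_nonneg_of_nonpos_of_nonpos hy (not_le.1 hs).le; linarith

/-- Test with the indicator of the cells where `r'` is not positive. On faces between that set and
its complement the upwind and diffusive fluxes both have a favourable sign, while the time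
difference is strictly negative on the set because `r` is positive. No restriction on the time step
is needed. -/
lemma density_pos_step {h α τ : ℝ} (hh : 0 < h) (hτ : 0 < τ) {r r' : Cell d N → ℝ}
    {U : Cell d N → EuclideanSpace ℝ (Fin d)} (hr : ∀ K, 0 < r K)
    (hc : ∀ φ : Cell d N → ℝ, intTorus h (fun K => (r' K - r K) / τ * φ K)
      - intFaces h (fun K i => flux h α r' U K i * jump φ K i) = 0) (K : Cell d N) : 0 < r' K := by
  classical
  by_contra hK
  rw [not_lt] at hK
  have h1 := hc (fun K => if r' K ≤ 0 then 1 else 0)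
  have hη : 0 ≤ h ^ α := Real.rpow_nonneg hh.le _
  have h2 : 0 ≤ intFaces h
      (fun K i => flux h α r' U K i * jump (fun K => if r' K ≤ 0 then (1 : ℝ) else 0) K i) := by
    refine mul_nonneg (pow_nonneg hh.le _)
      (Finset.sum_nonneg fun K _ => Finset.sum_nonneg fun i _ => ?_)
    simp only [flux, jump, upwind]
    by_cases hi : r' K ≤ 0 <;> by_cases ho : r' (K + e i) ≤ 0
    · simp [hi, ho]
    · rw [if_pos hi, if_neg ho]
      have := ite_mul_sub_nonpos (s := avgNormal U K i) hi (not_le.1 ho).le hη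
      nlinarith
    · rw [if_neg hi, if_pos ho]
      have := ite_mul_sub_nonneg (s := avgNormal U K i) (not_le.1 hi).le ho hη
      nlinarith
    · simp [hi, ho]
  have h3 : intTorus h (fun K => (r' K - r K) / τ * (if r' K ≤ 0 then 1 else 0)) < 0 := by
    refine mul_neg_of_pos_of_neg (pow_pos hh d) (Finset.sum_neg' (fun K _ => ?_) ⟨K, ?_, ?_⟩)
    · split_ifs with hc
      · have : (r' K - r K) / τ ≤ 0 := div_nonpos_of_nonpos_of_nonneg (by linarith [hr K]) hτ.le
        linarith
      · simp
    · simp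
    · rw [if_pos hK, mul_one]
      exact div_neg_of_neg_of_pos (by linarith [hr K]) hτ
  linarith

lemma mass_step {h α τ : ℝ} (hτ : 0 < τ) {r r' : Cell d N → ℝ}
    {U : Cell d N → EuclideanSpace ℝ (Fin d)}
    (hc : ∀ φ : Cell d N → ℝ, intTorus h (fun K => (r' K - r K) / τ * φ K)
      - intFaces h (fun K i => flux h α r' U K i * jump φ K i) = 0) :
    h ^ d * ∑ K, r' K = h ^ d * ∑ K, r K := by
  have h1 := hc (fun _ => 1)
  simp only [intTorus, intFaces, jump, sub_self, mul_zero, Finset.sum_const_zero, mul_one,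
    sub_zero] at h1
  rw [← Finset.sum_div, Finset.sum_sub_distrib, mul_div_assoc', div_eq_zero_iff] at h1
  rcases h1 with h1 | h1
  · linarith
  · exact absurd h1 hτ.ne'

/-- The derivative of the pressure potential. -/
def enthalpy (a γ r : ℝ) : ℝ := a * γ / (γ - 1) * r ^ (γ - 1)

lemma pressurePotential_tangent_le {a γ x y : ℝ} (ha : 0 < a) (hγ : 1 < γ) (hx : 0 < x)
    (hy : 0 ≤ y) :
    pressurePotential a γ x + enthalpy a γ x * (y - x) ≤ pressurePotential a γ y := by
  have h1 := rpow_tangent_le hx hy hγ.le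
  have h2 : 0 < a / (γ - 1) := div_pos ha (by linarith)
  have h3 := mul_le_mul_of_nonneg_left h1 h2.le
  rw [pressurePotential, pressurePotential, enthalpy]
  refine le_trans (le_of_eq ?_) h3
  ring

lemma pressure_eq_enthalpy {a γ x : ℝ} (hγ : 1 < γ) (hx : 0 < x) :
    pressure a γ x = x * enthalpy a γ x - pressurePotential a γ x := by
  have : γ - 1 ≠ 0 := by linarith
  rw [pressure, pressurePotential, enthalpy, Real.rpow_sub_one hx.ne']
  field_simp

/-- With `p = ρ P' - P`, the difference of the two sides is `s` times the gap between `P` and one of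
its tangents; upwinding selects the tangent for which the sign is right. -/
lemma upwind_mul_jump_enthalpy_le {a γ x y s : ℝ} (ha : 0 < a) (hγ : 1 < γ) (hx : 0 < x)
    (hy : 0 < y) :
    (if 0 ≤ s then x else y) * s * (enthalpy a γ y - enthalpy a γ x)
      ≤ s * (pressure a γ y - pressure a γ x) := by
  have h1 := pressurePotential_tangent_le ha hγ hx hy.le
  have h2 := pressurePotential_tangent_le ha hγ hy hx.le
  rw [pressure_eq_enthalpy hγ hx, pressure_eq_enthalpy hγ hy]
  split_ifs with hs
  · nlinarith
  · rw [not_le] at hs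
    nlinarith

/-- The left-hand side equals minus half the squared velocity jump times the upwind density times
`|s|`, minus `η` times the mean density times the squared velocity jump. This is why the kinetic
energy needs the test function `-|u|²/2` in the continuity equation. -/
lemma convective_dissipation {x y vx vy s η : ℝ} (hx : 0 < x) (hy : 0 < y) (hη : 0 ≤ η) :
    ((if 0 ≤ s then x * vx else y * vy) * s - η * (y * vy - x * vx)) * (vy - vx)
      - ((if 0 ≤ s then x else y) * s - η * (y - x)) * ((vy ^ 2 - vx ^ 2) / 2) ≤ 0 := by
  have h1 : 0 ≤ η * ((x + y) / 2 * (vy - vx) ^ 2) := by positivity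
  split_ifs with h
  · have : 0 ≤ x * s * (vy - vx) ^ 2 := by positivity
    nlinarith
  · have : 0 ≤ y * (-s) * (vy - vx) ^ 2 :=
      mul_nonneg (mul_nonneg hy.le (by linarith)) (sq_nonneg _)
    nlinarith

/-- Summation by parts on the periodic grid. It moves the pressure work to the faces, where it
cancels against the bound in `face_energy_le`. -/
lemma sum_pressure_mul_divh {h : ℝ} (hh : 0 < h) (hd : 0 < d) (q : Cell d N → ℝ)
    (U : Cell d N → EuclideanSpace ℝ (Fin d)) :
    intTorus h (fun K => q K * divh h U K)
      = -intFaces h (fun K i => avgNormal U K i * jump q K i) := by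
  have h1 : h ^ d = h ^ (d - 1) * h := by rw [← pow_succ, Nat.sub_add_cancel hd]
  rw [intTorus, intFaces, h1, mul_assoc, ← mul_neg]
  congr 1
  have h2 : ∀ i : Fin d, ∑ K, q K * avgNormal U (K - e i) i
      = ∑ K, q (K + e i) * avgNormal U K i := by
    intro i
    rw [← sum_comp_add (fun K => q K * avgNormal U (K - e i) i) (e i)]
    simp only [add_sub_cancel_right]
  have h3 : ∀ K, q K * divh h U K
      = h⁻¹ * ∑ i, (q K * avgNormal U K i - q K * avgNormal U (K - e i) i) := by
    intro K
    rw [divh, Finset.mul_sum, Finset.mul_sum, Finset.mul_sum]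
    exact Finset.sum_congr rfl fun i _ => by ring
  simp only [h3]
  rw [← Finset.mul_sum, ← mul_assoc, mul_inv_cancel₀ hh.ne', one_mul, Finset.sum_comm,
    Finset.sum_comm (f := fun K i => avgNormal U K i * jump q K i), ← Finset.sum_neg_distrib]
  refine Finset.sum_congr rfl fun i _ => ?_
  rw [Finset.sum_sub_distrib, h2, ← Finset.sum_sub_distrib, ← Finset.sum_neg_distrib]
  exact Finset.sum_congr rfl fun K _ => by rw [jump]; ring

/-- The total energy. -/
def energy (a γ h : ℝ) (r : Cell d N → ℝ) (v : Cell d N → EuclideanSpace ℝ (Fin d)) : ℝ :=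
  intTorus h (fun K => r K * (∑ j, v K j ^ 2) / 2 + pressurePotential a γ (r K))

/-- Implicit Euler dissipates: the kinetic part leaves the remainder `r * |U - v|² / 2`, and the
potential part the gap of the convex `P` above its tangent at the new density. Both are discarded.
-/
lemma time_difference_energy_le {a γ r r' : ℝ} {v U : EuclideanSpace ℝ (Fin d)} (ha : 0 < a)
    (hγ : 1 < γ) (hr : 0 < r) (hr' : 0 < r') :
    (r' * (∑ j, U j ^ 2) / 2 + pressurePotential a γ r')
        - (r * (∑ j, v j ^ 2) / 2 + pressurePotential a γ r)
      ≤ ∑ j, (r' * U j - r * v j) * U j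
        + (r' - r) * (enthalpy a γ r' - (∑ j, U j ^ 2) / 2) := by
  have h1 := pressurePotential_tangent_le ha hγ hr' hr.le
  have h2 : r' * (∑ j, U j ^ 2) / 2 - r * (∑ j, v j ^ 2) / 2
      ≤ ∑ j, (r' * U j - r * v j) * U j - (r' - r) * ((∑ j, U j ^ 2) / 2) := by
    have h3 : ∑ j, (r' * U j - r * v j) * U j - (r' - r) * ((∑ j, U j ^ 2) / 2)
        - (r' * (∑ j, U j ^ 2) / 2 - r * (∑ j, v j ^ 2) / 2)
        = ∑ j, r * (U j - v j) ^ 2 / 2 := by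
      have e1 : ∀ j, r * (U j - v j) ^ 2 / 2 = (r' * U j - r * v j) * U j
          - (r' - r) / 2 * U j ^ 2 - r' / 2 * U j ^ 2 + r / 2 * v j ^ 2 := fun j => by ring
      simp only [e1, Finset.sum_add_distrib, Finset.sum_sub_distrib, ← Finset.mul_sum]
      ring
    have h4 : 0 ≤ ∑ j, r * (U j - v j) ^ 2 / 2 := Finset.sum_nonneg fun j _ => by positivity
    linarith
  linarith

lemma face_energy_le {a γ h α : ℝ} (ha : 0 < a) (hγ : 1 < γ) (hh : 0 < h) {N : ℕ} {r : Cell d N → ℝ}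
    {U : Cell d N → EuclideanSpace ℝ (Fin d)} (hr : ∀ K, 0 < r K) (K : Cell d N) (i : Fin d) :
    ∑ j, flux h α (fun K' => r K' * U K' j) U K i * jump (comp U j) K i
      + flux h α r U K i * jump (fun K => enthalpy a γ (r K) - (∑ j, U K j ^ 2) / 2) K i
      ≤ avgNormal U K i * jump (fun K => pressure a γ (r K)) K i
        - h ^ α * (jump r K i * jump (fun K => enthalpy a γ (r K)) K i) := by
  have hη : 0 ≤ h ^ α := Real.rpow_nonneg hh.le _
  have h1 := upwind_mul_jump_enthalpy_le (s := avgNormal U K i) ha hγ (hr K) (hr (K + e i))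
  have h2 : ∑ j, (flux h α (fun K' => r K' * U K' j) U K i * jump (comp U j) K i
      - flux h α r U K i * ((U (K + e i) j ^ 2 - U K j ^ 2) / 2)) ≤ 0 :=
    Finset.sum_nonpos fun j _ =>
      convective_dissipation (s := avgNormal U K i) (hr K) (hr (K + e i)) hη
  have h3 : flux h α r U K i * jump (fun K => enthalpy a γ (r K) - (∑ j, U K j ^ 2) / 2) K i
      = (upwind r U K i * avgNormal U K i * jump (fun K => enthalpy a γ (r K)) K i
        - h ^ α * (jump r K i * jump (fun K => enthalpy a γ (r K)) K i))
        - ∑ j, flux h α r U K i * ((U (K + e i) j ^ 2 - U K j ^ 2) / 2) := by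
    rw [← Finset.mul_sum, ← Finset.sum_div, Finset.sum_sub_distrib, flux]
    simp only [jump]
    ring
  rw [Finset.sum_sub_distrib] at h2
  rw [h3]
  have h4 : upwind r U K i * avgNormal U K i * jump (fun K => enthalpy a γ (r K)) K i
      ≤ avgNormal U K i * jump (fun K => pressure a γ (r K)) K i := h1
  linarith

/-- The energy inequality for one time step. -/
lemma energy_step {a γ h α τ μ ν ε : ℝ} (hd : 0 < d) (ha : 0 < a) (hγ : 1 < γ) (hh : 0 < h)
    (hτ : 0 < τ) (hν : 0 ≤ ν) (hε : 0 < ε) {r r' : Cell d N → ℝ}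
    {v U : Cell d N → EuclideanSpace ℝ (Fin d)} (hr : ∀ K, 0 < r K) (hr' : ∀ K, 0 < r' K)
    {S : Set (Cell d N)} [DecidablePred (· ∈ S)]
    (hc : ∀ φ : Cell d N → ℝ, intTorus h (fun K => (r' K - r K) / τ * φ K)
      - intFaces h (fun K i => flux h α r' U K i * jump φ K i) = 0)
    (hm : ∀ φ : Cell d N → EuclideanSpace ℝ (Fin d),
      intTorus h (fun K => ∑ j, (r' K * U K j - r K * v K j) / τ * φ K j)
      - intFaces h (fun K i => ∑ j,
          flux h α (fun K' => r' K' * U K' j) U K i * jump (comp φ j) K i)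
      - intTorus h (fun K => pressure a γ (r' K) * divh h φ K)
      + 1 / ε * intTorus h (fun K => if K ∈ S then ∑ j, U K j * φ K j else 0)
      + μ * intGradGrad h U φ
      + ν * intTorus h (fun K => divh h U K * divh h φ K) = 0) :
    energy a γ h r' U + τ * (intFaces h (fun K i => h ^ α *
        (jump r' K i * jump (fun K => enthalpy a γ (r' K)) K i)) + μ * intGradGrad h U U)
      ≤ energy a γ h r v := by
  have h1 := hm U
  -- This test function supplies the potential energy through `P'(ρ)` and corrects the convective
  -- term by `-|u|²/2`.
  have h2 := hc (fun K => enthalpy a γ (r' K) - (∑ j, U K j ^ 2) / 2)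
  have h3 : 0 ≤ 1 / ε * intTorus h (fun K => if K ∈ S then ∑ j, U K j * U K j else 0) := by
    refine mul_nonneg (by positivity) (mul_nonneg (pow_nonneg hh.le _)
      (Finset.sum_nonneg fun K _ => ?_))
    split_ifs
    · exact Finset.sum_nonneg fun j _ => mul_self_nonneg _
    · exact le_rfl
  have h4 : 0 ≤ ν * intTorus h (fun K => divh h U K * divh h U K) :=
    mul_nonneg hν (mul_nonneg (pow_nonneg hh.le _) (Finset.sum_nonneg fun K _ => mul_self_nonneg _))
  rw [sum_pressure_mul_divh hh hd] at h1
  have h5 : energy a γ h r' U - energy a γ h r v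
      ≤ τ * (intTorus h (fun K => ∑ j, (r' K * U K j - r K * v K j) / τ * U K j)
        + intTorus h (fun K => (r' K - r K) / τ * (enthalpy a γ (r' K) - (∑ j, U K j ^ 2) / 2))) := by
    simp only [energy, intTorus]
    rw [← mul_sub, ← mul_add, ← Finset.sum_sub_distrib, ← Finset.sum_add_distrib, mul_left_comm]
    refine mul_le_mul_of_nonneg_left ?_ (pow_nonneg hh.le _)
    rw [Finset.mul_sum]
    refine Finset.sum_le_sum fun K _ => ?_
    refine (time_difference_energy_le ha hγ (hr K) (hr' K)).trans (le_of_eq ?_)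
    rw [mul_add, Finset.mul_sum]
    congr 1
    · exact Finset.sum_congr rfl fun j _ => by field_simp
    · field_simp
  have h6 : intFaces h (fun K i => ∑ j,
          flux h α (fun K' => r' K' * U K' j) U K i * jump (comp U j) K i)
      + intFaces h (fun K i => flux h α r' U K i
          * jump (fun K => enthalpy a γ (r' K) - (∑ j, U K j ^ 2) / 2) K i)
      ≤ intFaces h (fun K i => avgNormal U K i * jump (fun K => pressure a γ (r' K)) K i)
        - intFaces h (fun K i => h ^ α *
          (jump r' K i * jump (fun K => enthalpy a γ (r' K)) K i)) := by
    simp only [intFaces]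
    rw [← mul_sub, ← mul_add]
    refine mul_le_mul_of_nonneg_left ?_ (pow_nonneg hh.le _)
    simp only [← Finset.sum_sub_distrib, ← Finset.sum_add_distrib]
    exact Finset.sum_le_sum fun K _ => Finset.sum_le_sum fun i _ => face_energy_le ha hγ hh hr' K i
  have h7 : intTorus h (fun K => ∑ j, (r' K * U K j - r K * v K j) / τ * U K j)
        + intTorus h (fun K => (r' K - r K) / τ * (enthalpy a γ (r' K) - (∑ j, U K j ^ 2) / 2))
      ≤ -(intFaces h (fun K i => h ^ α *
        (jump r' K i * jump (fun K => enthalpy a γ (r' K)) K i)) + μ * intGradGrad h U U) := by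
    linarith
  have h8 := mul_le_mul_of_nonneg_left h7 hτ.le
  linarith

/-- In the variables `s = y ^ (γ / 2)`, `t = x ^ (γ / 2)` and with `κ = 2 / γ ∈ [1, 2]`, the density
is the power `κ` and `ρ ^ (γ - 1)` the power `2 - κ`. For `t ≤ s` their differences are at least `s
^ (κ - 1) * (s - t)` and `(2 - κ) * s ^ (1 - κ) * (s - t)`; the powers of `s` cancel in the product.
The constant is `a * γ / (γ - 1) * (2 - κ) = 2 * a`. -/
lemma sq_jump_rpow_half_le {a γ x y : ℝ} (ha : 0 < a) (hγ : 1 < γ) (hγ2 : γ ≤ 2) (hx : 0 < x)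
    (hy : 0 < y) :
    2 * a * (y ^ (γ / 2) - x ^ (γ / 2)) ^ 2 ≤ (y - x) * (enthalpy a γ y - enthalpy a γ x) := by
  have key : ∀ x y : ℝ, 0 < x → x ≤ y →
      2 * a * (y ^ (γ / 2) - x ^ (γ / 2)) ^ 2 ≤ (y - x) * (enthalpy a γ y - enthalpy a γ x) := by
    intro x y hx hxy
    have hy := hx.trans_le hxy
    set s := y ^ (γ / 2) with hs
    set t := x ^ (γ / 2) with ht
    have hs0 : 0 < s := Real.rpow_pos_of_pos hy _
    have ht0 : 0 < t := Real.rpow_pos_of_pos hx _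
    have hts : t ≤ s := Real.rpow_le_rpow hx.le hxy (by linarith)
    have hγ0 : γ ≠ 0 := by linarith
    set κ := 2 / γ with hκ
    have hκ1 : 1 ≤ κ := by rw [hκ, le_div_iff₀ (by linarith)]; linarith
    have hκ2 : κ ≤ 2 := by rw [hκ, div_le_iff₀ (by linarith)]; linarith
    have e1 : ∀ z : ℝ, 0 < z → z = (z ^ (γ / 2)) ^ κ := by
      intro z hz
      rw [← Real.rpow_mul hz.le, hκ, show γ / 2 * (2 / γ) = 1 by field_simp, Real.rpow_one]
    have e2 : ∀ z : ℝ, 0 < z → z ^ (γ - 1) = (z ^ (γ / 2)) ^ (2 - κ) := by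
      intro z hz
      rw [← Real.rpow_mul hz.le, hκ]; congr 1; field_simp
    have f1 : s ^ (κ - 1) * (s - t) ≤ y - x := by
      have g1 : y = s ^ (κ - 1) * s := by
        conv_lhs => rw [e1 y hy]
        rw [← hs, Real.rpow_sub_one hs0.ne']; field_simp
      have g2 : x = t ^ (κ - 1) * t := by
        conv_lhs => rw [e1 x hx]
        rw [← ht, Real.rpow_sub_one ht0.ne']; field_simp
      have g3 : t ^ (κ - 1) ≤ s ^ (κ - 1) := Real.rpow_le_rpow ht0.le hts (by linarith)
      have g4 : t ^ (κ - 1) * t ≤ s ^ (κ - 1) * t := mul_le_mul_of_nonneg_right g3 ht0.le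
      rw [mul_sub]
      linarith
    have f2 : (2 - κ) * s ^ (1 - κ) * (s - t) ≤ y ^ (γ - 1) - x ^ (γ - 1) := by
      have := rpow_le_tangent hs0 ht0.le (s := 2 - κ) (by linarith) (by linarith)
      rw [e2 y hy, e2 x hx, ← hs, ← ht]
      rw [show 2 - κ - 1 = 1 - κ by ring] at this
      linarith
    have f3 : s ^ (κ - 1) * s ^ (1 - κ) = 1 := by
      rw [← Real.rpow_add hs0]; simp
    have f4 : 0 ≤ s - t := by linarith
    have f5 : 0 ≤ s ^ (κ - 1) * (s - t) := mul_nonneg (Real.rpow_nonneg hs0.le _) f4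
    have f6 : 0 ≤ y ^ (γ - 1) - x ^ (γ - 1) :=
      sub_nonneg.2 (Real.rpow_le_rpow hx.le hxy (by linarith))
    have f7 : (2 - κ) * (s - t) ^ 2 ≤ (y - x) * (y ^ (γ - 1) - x ^ (γ - 1)) := by
      calc (2 - κ) * (s - t) ^ 2
          = (s ^ (κ - 1) * (s - t)) * ((2 - κ) * s ^ (1 - κ) * (s - t)) := by
            linear_combination (-(2 - κ) * (s - t) ^ 2) * f3
        _ ≤ (s ^ (κ - 1) * (s - t)) * (y ^ (γ - 1) - x ^ (γ - 1)) :=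
            mul_le_mul_of_nonneg_left f2 f5
        _ ≤ _ := mul_le_mul_of_nonneg_right f1 f6
    have h0 : 0 < a * γ / (γ - 1) := div_pos (by positivity) (by linarith)
    have f8 := mul_le_mul_of_nonneg_left f7 h0.le
    have f9 : a * γ / (γ - 1) * ((2 - κ) * (s - t) ^ 2) = 2 * a * (s - t) ^ 2 := by
      have : γ - 1 ≠ 0 := by linarith
      rw [hκ]; field_simp
    rw [f9] at f8
    rw [enthalpy, enthalpy]
    refine f8.trans (le_of_eq ?_)
    ring
  rcases le_total x y with h | h
  · exact key x y hx h
  · have := key y x hy h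
    nlinarith

end Scheme

/-! ### Measure of the mesh elements, and norms of piecewise constant functions as sums -/

section MeshMeasure

variable {d : ℕ} {L : ℝ} [hL : Fact (0 < L)]

/-- The arc with the label `t` of the mesh of the circle. -/
def arc (L : ℝ) [Fact (0 < L)] {N : ℕ} (t : ZMod N) : Set (AddCircle L) :=
  {y | ((⌊(AddCircle.equivIco L 0 y : ℝ) / meshSize L N⌋₊ : ℕ) : ZMod N) = t}

lemma measurableSet_arc {N : ℕ} (t : ZMod N) : MeasurableSet (arc L t) := by
  have h1 : Measurable fun y : AddCircle L =>
      ⌊(AddCircle.equivIco L 0 y : ℝ) / meshSize L N⌋₊ :=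
    Nat.measurable_floor.comp
      (((AddCircle.measurableEquivIco L 0).measurable.subtype_val).div_const _)
  exact h1 (MeasurableSet.of_discrete (s := {n : ℕ | (n : ZMod N) = t}))

lemma volume_arc {N : ℕ} [NeZero N] (t : ZMod N) :
    volume (arc L t) = ENNReal.ofReal (meshSize L N) := by
  have hh := meshSize_pos L N
  have hN : (0 : ℝ) < N := by exact_mod_cast Nat.pos_of_ne_zero (NeZero.ne N)
  have hhN : meshSize L N * N = L := by rw [meshSize]; field_simp
  have htN : (t.val : ℝ) + 1 ≤ N := by exact_mod_cast ZMod.val_lt t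
  rw [← (AddCircle.measurePreserving_mk L 0).measure_preimage
    (measurableSet_arc t).nullMeasurableSet, zero_add]
  have hmeas : MeasurableSet (((↑) : ℝ → AddCircle L) ⁻¹' arc L t) :=
    AddCircle.measurable_mk' (measurableSet_arc t)
  rw [Measure.restrict_congr_set (Ico_ae_eq_Ioc (μ := volume) (a := (0 : ℝ)) (b := L)).symm,
    Measure.restrict_apply hmeas]
  have hset : ((↑) : ℝ → AddCircle L) ⁻¹' arc L t ∩ Ico 0 L
      = Ico (t.val * meshSize L N) ((t.val + 1) * meshSize L N) := by
    ext x
    simp only [mem_inter_iff, mem_preimage, arc, mem_ofPred_eq, mem_Ico]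
    have hfl : ∀ hx : x ∈ Ico 0 L, (((⌊(AddCircle.equivIco L 0 (x : AddCircle L) : ℝ)
        / meshSize L N⌋₊ : ℕ) : ZMod N) = t ↔ ⌊x / meshSize L N⌋₊ = t.val) := by
      intro hx
      have hx' : x ∈ Ico 0 (0 + L) := by rwa [zero_add]
      rw [AddCircle.equivIco_coe_eq hx']
      have hlt : ⌊x / meshSize L N⌋₊ < N := by
        rw [Nat.floor_lt (div_nonneg hx.1 hh.le), div_lt_iff₀ hh, mul_comm, hhN]
        exact hx.2
      constructor
      · intro h
        rw [← h, ZMod.val_cast_of_lt hlt]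
      · intro h
        change ((⌊x / meshSize L N⌋₊ : ℕ) : ZMod N) = t
        rw [h, ZMod.natCast_zmod_val]
    constructor
    · rintro ⟨h1, h2⟩
      have := (hfl h2).1 h1
      rw [Nat.floor_eq_iff (div_nonneg h2.1 hh.le), le_div_iff₀ hh, div_lt_iff₀ hh] at this
      exact this
    · intro h
      have h2 : x ∈ Ico 0 L := by
        refine ⟨le_trans (by positivity) h.1, h.2.trans_le ?_⟩
        calc (t.val + 1) * meshSize L N ≤ N * meshSize L N := by gcongr
          _ = L := by rw [mul_comm, hhN]
      refine ⟨(hfl h2).2 ?_, h2⟩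
      rwa [Nat.floor_eq_iff (div_nonneg h2.1 hh.le), le_div_iff₀ hh, div_lt_iff₀ hh]
  rw [hset, Real.volume_Ico]
  congr 1
  ring

lemma element_eq_pi {N : ℕ} (K : Cell d N) : element L K = Set.univ.pi fun i => arc L (K i) := by
  ext x
  simp [element, cellIndex, arc, funext_iff]

lemma measurableSet_element {N : ℕ} (K : Cell d N) : MeasurableSet (element L K) := by
  rw [element_eq_pi]
  exact MeasurableSet.univ_pi fun i => measurableSet_arc _

lemma volume_element {N : ℕ} [NeZero N] (K : Cell d N) :
    volume (element L K) = ENNReal.ofReal (meshSize L N ^ d) := by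
  rw [element_eq_pi, volume_pi_pi]
  simp [volume_arc, ENNReal.ofReal_pow (meshSize_pos L N).le]

lemma volume_real_element {N : ℕ} [NeZero N] (K : Cell d N) :
    volume.real (element L K) = meshSize L N ^ d := by
  rw [Measure.real, volume_element, ENNReal.toReal_ofReal (pow_nonneg (meshSize_pos L N).le d)]

lemma iUnion_element (d N : ℕ) (L : ℝ) [Fact (0 < L)] :
    ⋃ K : Cell d N, element L K = Set.univ :=
  Set.eq_univ_of_forall fun x => Set.mem_iUnion.2 ⟨cellIndex N x, rfl⟩

lemma pairwise_disjoint_element (d N : ℕ) (L : ℝ) [Fact (0 < L)] :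
    Pairwise (Function.onFun Disjoint fun K : Cell d N => element L K) := by
  intro K K' hne
  rw [Function.onFun, Set.disjoint_left]
  intro x hx hx'
  exact hne (hx.symm.trans hx')

lemma lintegral_toFun {N : ℕ} [NeZero N] (g : Cell d N → ENNReal) :
    ∫⁻ x : Torus d L, g (cellIndex N x) = ∑ K, g K * ENNReal.ofReal (meshSize L N ^ d) := by
  rw [← setLIntegral_univ, ← iUnion_element d N L,
    lintegral_iUnion (fun K => measurableSet_element K) (pairwise_disjoint_element d N L),
    tsum_fintype]
  refine Finset.sum_congr rfl fun K _ => ?_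
  rw [setLIntegral_congr_fun (g := fun _ => g K) (measurableSet_element K)
    (fun x hx => by rw [show cellIndex N x = K from hx]), setLIntegral_const, volume_element]

lemma sum_setIntegral_element {N : ℕ} [NeZero N] {f : Torus d L → ℝ} (hf : Integrable f) :
    ∑ K : Cell d N, ∫ x in element L K, f x = ∫ x, f x := by
  rw [← integral_iUnion_fintype (fun K => measurableSet_element K) (pairwise_disjoint_element d N L)
    fun K => hf.integrableOn, iUnion_element, setIntegral_univ]

lemma eLpNorm_toFun_le {E : Type*} [NormedAddCommGroup E] {N : ℕ} [NeZero N] (v : Cell d N → E)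
    {p : ℝ} (hp : 0 < p) :
    eLpNorm (toFun (L := L) v) (ENNReal.ofReal p) volume
      ≤ ENNReal.ofReal ((meshSize L N ^ d * ∑ K, ‖v K‖ ^ p) ^ (1 / p)) := by
  have hh := meshSize_pos L N
  have h0 : 0 ≤ meshSize L N ^ d * ∑ K, ‖v K‖ ^ p :=
    mul_nonneg (pow_nonneg hh.le d)
      (Finset.sum_nonneg fun _ _ => Real.rpow_nonneg (norm_nonneg _) _)
  rw [eLpNorm_eq_lintegral_rpow_enorm_toReal (by simpa using hp) ENNReal.ofReal_ne_top,
    ENNReal.toReal_ofReal hp.le, ← ENNReal.ofReal_rpow_of_nonneg h0 (by positivity)]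
  refine ENNReal.rpow_le_rpow (le_of_eq ?_) (by positivity)
  have := lintegral_toFun (L := L) (fun K => ‖v K‖ₑ ^ p)
  simp only [toFun]
  rw [this, ← Finset.sum_mul, mul_comm, ENNReal.ofReal_mul (pow_nonneg hh.le d),
    ENNReal.ofReal_sum_of_nonneg fun K _ => Real.rpow_nonneg (norm_nonneg _) _]
  congr 1
  refine Finset.sum_congr rfl fun K _ => ?_
  rw [← ENNReal.ofReal_rpow_of_nonneg (norm_nonneg _) hp.le, ofReal_norm]

/-- Covering `(0, T)` by the half-open time steps is enough for an upper bound. Only the values with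
index `0, …, n - 1` occur: the initial value counts, the last one does not. -/
lemma lintegral_step_le {T : ℝ} (hT : 0 < T) {n : ℕ} (hn : 0 < n) (g : ℕ → ENNReal) :
    ∫⁻ t in Ioo 0 T, g ⌊t / (T / n)⌋₊ ≤ ∑ k ∈ Finset.range n, ENNReal.ofReal (T / n) * g k := by
  have hn' : (0 : ℝ) < n := by exact_mod_cast hn
  set τ := T / n with hτ
  have hτ0 : 0 < τ := div_pos hT hn'
  have hsub : Ioo 0 T ⊆ ⋃ k : Fin n, Ico ((k : ℕ) * τ) (((k : ℕ) + 1) * τ) := by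
    intro t ht
    have hlt : ⌊t / τ⌋₊ < n := by
      rw [Nat.floor_lt (div_nonneg ht.1.le hτ0.le), div_lt_iff₀ hτ0, hτ, mul_div_cancel₀ _ hn'.ne']
      exact ht.2
    refine Set.mem_iUnion.2 ⟨⟨⌊t / τ⌋₊, hlt⟩, ?_, ?_⟩
    · rw [← le_div_iff₀ hτ0]; exact Nat.floor_le (div_nonneg ht.1.le hτ0.le)
    · rw [← div_lt_iff₀ hτ0]; exact Nat.lt_floor_add_one _
  refine (lintegral_mono_set hsub).trans ((lintegral_iUnion_le _ _).trans ?_)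
  rw [tsum_fintype, ← Fin.sum_univ_eq_sum_range (fun k => ENNReal.ofReal τ * g k)]
  refine Finset.sum_le_sum fun k _ => ?_
  rw [setLIntegral_congr_fun (g := fun _ => g k) measurableSet_Ico, setLIntegral_const,
    Real.volume_Ico, mul_comm]
  · refine le_of_eq ?_
    congr 2; ring
  · intro t ht
    have : ⌊t / τ⌋₊ = k := by
      rw [Nat.floor_eq_iff (div_nonneg (le_trans (by positivity) ht.1) hτ0.le), le_div_iff₀ hτ0,
        div_lt_iff₀ hτ0]
      exact ht
    simp only [this]

lemma mixedNorm_extend_le {E : Type*} [NormedAddCommGroup E] {N : ℕ} [NeZero N]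
    {T : ℝ} (hT : 0 < T) {n : ℕ} (hn : 0 < n) (v : ℕ → Cell d N → E) {p B : ℝ} (hp : 0 < p)
    (hB : 0 ≤ B)
    (h : ∑ k ∈ Finset.range n, T / n * (meshSize L N ^ d * ∑ K, ‖v k K‖ ^ p) ^ (2 / p) ≤ B ^ 2) :
    mixedNorm (L := L) 2 (ENNReal.ofReal p) T (extend (T / n) v) ≤ ENNReal.ofReal B := by
  have hh := meshSize_pos L N
  have hn' : (0 : ℝ) < n := by exact_mod_cast hn
  have h0 : ∀ k, 0 ≤ meshSize L N ^ d * ∑ K, ‖v k K‖ ^ p := fun k =>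
    mul_nonneg (pow_nonneg hh.le d)
      (Finset.sum_nonneg fun _ _ => Real.rpow_nonneg (norm_nonneg _) _)
  rw [mixedNorm, eLpNorm_eq_lintegral_rpow_enorm_toReal (by norm_num) (by norm_num),
    ENNReal.toReal_ofNat]
  have h1 : ENNReal.ofReal B = (ENNReal.ofReal (B ^ 2)) ^ ((1 : ℝ) / 2) := by
    rw [ENNReal.ofReal_rpow_of_nonneg (sq_nonneg B) (by norm_num), ← Real.sqrt_eq_rpow,
      Real.sqrt_sq hB]
  rw [h1]
  refine ENNReal.rpow_le_rpow ?_ (by norm_num)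
  simp only [extend, enorm_eq_self]
  refine (lintegral_step_le hT hn
    (fun k => eLpNorm (toFun (L := L) (v k)) (ENNReal.ofReal p) volume ^ (2 : ℝ))).trans ?_
  refine le_trans ?_ (ENNReal.ofReal_le_ofReal h)
  rw [ENNReal.ofReal_sum_of_nonneg fun k _ =>
    mul_nonneg (by positivity) (Real.rpow_nonneg (h0 k) _)]
  refine Finset.sum_le_sum fun k _ => ?_
  rw [ENNReal.ofReal_mul (by positivity)]
  refine mul_le_mul_right ?_ _
  calc eLpNorm (toFun (L := L) (v k)) (ENNReal.ofReal p) volume ^ (2 : ℝ)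
      ≤ ENNReal.ofReal ((meshSize L N ^ d * ∑ K, ‖v k K‖ ^ p) ^ (1 / p)) ^ (2 : ℝ) :=
        ENNReal.rpow_le_rpow (eLpNorm_toFun_le _ hp) (by norm_num)
    _ = _ := by
        rw [ENNReal.ofReal_rpow_of_nonneg (Real.rpow_nonneg (h0 k) _) (by norm_num),
          ← Real.rpow_mul (h0 k)]
        congr 2; ring

end MeshMeasure

/-! ### Projected initial data -/

section InitialData

variable {d : ℕ} {L : ℝ} [hL : Fact (0 < L)] {a γ M₀ E₀ R : ℝ} {Ωf : Set (Torus d L)}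
  {ρ₀ : Torus d L → ℝ} {m₀ : Torus d L → EuclideanSpace ℝ (Fin d)}

namespace IsInitialData

lemma integrable_density (H : IsInitialData a γ M₀ E₀ R Ωf ρ₀ m₀) : Integrable ρ₀ :=
  Integrable.of_bound H.measurable_density R (by
    filter_upwards [H.density_pos, H.density_le] with x h1 h2
    rwa [Real.norm_of_nonneg h1.le])

lemma integrable_momentum (H : IsInitialData a γ M₀ E₀ R Ωf ρ₀ m₀) : Integrable m₀ :=
  Integrable.of_bound H.measurable_momentum R H.momentum_le

/-- The quotient is bounded because `ρ₀ ≥ c` where `m₀` may be nonzero. The lower bound `c` is used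
only for integrability, without which the Bochner integral defining `E₀` could not be split; it
enters no constant. -/
lemma integrable_kinetic (H : IsInitialData a γ M₀ E₀ R Ωf ρ₀ m₀) :
    Integrable fun x => ‖m₀ x‖ ^ 2 / (2 * ρ₀ x) := by
  obtain ⟨c, hc, hlow⟩ := H.density_lower
  refine Integrable.of_bound
    (((H.measurable_momentum.norm.aemeasurable.pow_const 2).div
      (H.measurable_density.aemeasurable.const_mul 2)).aestronglyMeasurable) (R ^ 2 / (2 * c)) ?_
  filter_upwards [H.density_pos, hlow, H.momentum_le, H.momentum_solid] with x h1 h2 h3 h4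
  rw [Real.norm_of_nonneg (by positivity)]
  by_cases hx : x ∈ Ωf
  · have := h2 hx
    gcongr
  · rw [h4 hx]
    simp only [norm_zero, ne_eq, OfNat.ofNat_ne_zero, not_false_eq_true, zero_pow, zero_div]
    positivity

lemma integrable_pressurePotential (H : IsInitialData a γ M₀ E₀ R Ωf ρ₀ m₀) (ha : 0 < a)
    (hγ : 1 < γ) : Integrable fun x => pressurePotential a γ (ρ₀ x) := by
  refine Integrable.of_bound
    (((H.measurable_density.aemeasurable.pow_const γ).const_mul _).aestronglyMeasurable)
    (a / (γ - 1) * R ^ γ) ?_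
  filter_upwards [H.density_pos, H.density_le] with x h1 h2
  have : 0 < a / (γ - 1) := div_pos ha (by linarith)
  rw [pressurePotential, Real.norm_of_nonneg (by positivity)]
  gcongr

lemma integral_kinetic_le (H : IsInitialData a γ M₀ E₀ R Ωf ρ₀ m₀) (ha : 0 < a) (hγ : 1 < γ) :
    ∫ x, ‖m₀ x‖ ^ 2 / (2 * ρ₀ x) ≤ E₀ := by
  have h1 := H.energy
  rw [integral_add H.integrable_kinetic (H.integrable_pressurePotential ha hγ)] at h1
  have h2 : 0 ≤ ∫ x, pressurePotential a γ (ρ₀ x) := by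
    refine integral_nonneg_of_ae ?_
    filter_upwards [H.density_pos] with x hx
    have : 0 < a / (γ - 1) := div_pos ha (by linarith)
    exact mul_nonneg this.le (Real.rpow_nonneg hx.le _)
  linarith

variable {N : ℕ} [NeZero N]

lemma proj_density_pos (H : IsInitialData a γ M₀ E₀ R Ωf ρ₀ m₀) (K : Cell d N) :
    0 < proj N ρ₀ K := by
  have hh := pow_pos (meshSize_pos L N) d
  refine mul_pos (inv_pos.2 hh) ?_
  rw [setIntegral_pos_iff_support_of_nonneg_ae
    (ae_restrict_of_ae (H.density_pos.mono fun x hx => hx.le)) H.integrable_density.integrableOn]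
  have h1 : volume (Function.support ρ₀ ∩ element L K) = volume (element L K) := by
    refine measure_congr ?_
    filter_upwards [H.density_pos] with x hx
    exact propext ⟨fun h => h.2, fun h => ⟨hx.ne', h⟩⟩
  rw [h1, volume_element]
  exact ENNReal.ofReal_pos.2 hh

lemma norm_proj_le {E : Type*} [NormedAddCommGroup E] [NormedSpace ℝ E] {f : Torus d L → E}
    {R : ℝ} (hf : ∀ᵐ x, ‖f x‖ ≤ R) (K : Cell d N) : ‖proj N f K‖ ≤ R := by
  have hh := pow_pos (meshSize_pos L N) d
  have h1 : ‖∫ x in element L K, f x‖ ≤ R * volume.real (element L K) :=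
    norm_setIntegral_le_of_norm_le_const_ae (by rw [volume_element]; exact ENNReal.ofReal_lt_top)
      (ae_restrict_of_ae hf)
  rw [volume_real_element] at h1
  rw [proj, norm_smul, Real.norm_of_nonneg (inv_nonneg.2 hh.le), inv_mul_le_iff₀ hh]
  linarith

lemma proj_density_le (H : IsInitialData a γ M₀ E₀ R Ωf ρ₀ m₀) (K : Cell d N) :
    proj N ρ₀ K ≤ R :=
  (le_abs_self _).trans (norm_proj_le (by
    filter_upwards [H.density_pos, H.density_le] with x h1 h2
    rwa [Real.norm_of_nonneg h1.le]) K)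

lemma sum_proj_density (H : IsInitialData a γ M₀ E₀ R Ωf ρ₀ m₀) :
    meshSize L N ^ d * ∑ K : Cell d N, proj N ρ₀ K = M₀ := by
  have hh := pow_pos (meshSize_pos L N) d
  simp only [proj, smul_eq_mul]
  rw [← Finset.mul_sum, ← mul_assoc, mul_inv_cancel₀ hh.ne', one_mul,
    sum_setIntegral_element H.integrable_density, H.mass]

/-- Jensen's inequality for the convex function `|m|² / (2 ρ)`, in the form of Young's inequality `v
· m - ρ |v|² / 2 ≤ |m|² / (2 ρ)` integrated over an element with the constant vector `v K`. -/
lemma sum_proj_kinetic_le (H : IsInitialData a γ M₀ E₀ R Ωf ρ₀ m₀) (ha : 0 < a) (hγ : 1 < γ)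
    (v : Cell d N → EuclideanSpace ℝ (Fin d)) (hv : ∀ K, proj N ρ₀ K • v K = proj N m₀ K) :
    meshSize L N ^ d * ∑ K, proj N ρ₀ K * ‖v K‖ ^ 2 / 2 ≤ E₀ := by
  have hh := pow_pos (meshSize_pos L N) d
  refine le_trans ?_ (H.integral_kinetic_le ha hγ)
  rw [← sum_setIntegral_element (N := N) H.integrable_kinetic, Finset.mul_sum]
  refine Finset.sum_le_sum fun K _ => ?_
  have h1 : ∫ x in element L K, m₀ x = (meshSize L N ^ d * proj N ρ₀ K) • v K := by
    rw [mul_smul, hv K, proj, smul_inv_smul₀ hh.ne']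
  have h2 : ∫ x in element L K, ρ₀ x = meshSize L N ^ d * proj N ρ₀ K := by
    rw [proj, smul_eq_mul, mul_inv_cancel_left₀ hh.ne']
  have hi1 : IntegrableOn (fun x => inner ℝ (v K) (m₀ x)) (element L K) :=
    (H.integrable_momentum.integrableOn).const_inner (v K)
  have hi2 : IntegrableOn (fun x => ρ₀ x * (‖v K‖ ^ 2 / 2)) (element L K) :=
    (H.integrable_density.integrableOn).mul_const _
  have h3 : ∫ x in element L K, (inner ℝ (v K) (m₀ x) - ρ₀ x * (‖v K‖ ^ 2 / 2))
      ≤ ∫ x in element L K, ‖m₀ x‖ ^ 2 / (2 * ρ₀ x) := by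
    refine setIntegral_mono_ae (hi1.sub hi2) H.integrable_kinetic.integrableOn ?_
    filter_upwards [H.density_pos] with x hx
    have h4 := real_inner_le_norm (v K) (m₀ x)
    have h5 : ‖v K‖ * ‖m₀ x‖ ≤ ‖m₀ x‖ ^ 2 / (2 * ρ₀ x) + ρ₀ x * (‖v K‖ ^ 2 / 2) := by
      have : 0 ≤ (‖m₀ x‖ - ρ₀ x * ‖v K‖) ^ 2 / (2 * ρ₀ x) := by positivity
      have h6 : (‖m₀ x‖ - ρ₀ x * ‖v K‖) ^ 2 / (2 * ρ₀ x)
          = ‖m₀ x‖ ^ 2 / (2 * ρ₀ x) + ρ₀ x * (‖v K‖ ^ 2 / 2) - ‖v K‖ * ‖m₀ x‖ := by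
        field_simp; ring
      linarith
    linarith
  rw [integral_sub hi1 hi2, integral_inner H.integrable_momentum.integrableOn, h1,
    integral_mul_const, h2, real_inner_smul_right, real_inner_self_eq_norm_sq] at h3
  linarith

end IsInitialData

end InitialData

/-- The uniform bounds satisfied by the solutions of the finite volume method. -/
structure AprioriBounds {d : ℕ} (L T γ α M R B : ℝ) (N NT : ℕ) [NeZero N]
    (ρ : ℕ → Cell d N → ℝ) (u : ℕ → Cell d N → EuclideanSpace ℝ (Fin d)) : Prop where
  density_pos : ∀ k ≤ NT, ∀ K, 0 < ρ k K
  mass : ∀ k ≤ NT, meshSize L N ^ d * ∑ K, ρ k K = M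
  density_rpow : ∀ k ≤ NT, meshSize L N ^ d * ∑ K, ρ k K ^ γ ≤ B
  kinetic : ∀ k ≤ NT, meshSize L N ^ d * ∑ K, ρ k K * ‖u k K‖ ^ 2 ≤ B
  density_jump : γ ≤ 2 → ∑ k ∈ Finset.range NT, T / NT * (meshSize L N ^ (α + 1) *
    (meshSize L N ^ d * ∑ K, ∑ i,
      ((meshSize L N)⁻¹ * jump (fun K => ρ (k + 1) K ^ (γ / 2)) K i) ^ 2)) ≤ B
  velocity_jump : ∑ k ∈ Finset.range NT, T / NT * intGradGrad (meshSize L N) (u (k + 1)) (u (k + 1))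
    ≤ B
  init_density : ∀ K, ρ 0 K ≤ R
  init_momentum : ∀ K, ‖ρ 0 K • u 0 K‖ ≤ R

/-! ### Uniform bounds from the energy inequality -/

section

variable {d N : ℕ} [NeZero N] {L : ℝ} [hL : Fact (0 < L)]

/-- Bookkeeping of powers of `h`: faces have measure `h ^ (d - 1)` and a squared jump is `h ^ 2`
times a squared difference quotient, so the viscosity `h ^ α` becomes the weight `h ^ (α + 1)` on a
volume integral. -/
lemma dissipation_faces_ge {a γ α h : ℝ} (hd : 0 < d) (ha : 0 < a) (hγ : 1 < γ) (hγ2 : γ ≤ 2)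
    (hh : 0 < h) {r : Cell d N → ℝ} (hr : ∀ K, 0 < r K) :
    2 * a * (h ^ (α + 1) * (h ^ d * ∑ K, ∑ i, (h⁻¹ * jump (fun K => r K ^ (γ / 2)) K i) ^ 2))
      ≤ intFaces h (fun K i => h ^ α * (jump r K i * jump (fun K => enthalpy a γ (r K)) K i)) := by
  have e1 : h ^ (α + 1) = h ^ α * h := by rw [Real.rpow_add hh, Real.rpow_one]
  have e2 : h ^ d = h ^ (d - 1) * h := by rw [← pow_succ, Nat.sub_add_cancel hd]
  have e3 : 2 * a * (h ^ (α + 1) * (h ^ d *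
        ∑ K, ∑ i, (h⁻¹ * jump (fun K => r K ^ (γ / 2)) K i) ^ 2))
      = h ^ (d - 1) * ∑ K, ∑ i,
        h ^ α * (2 * a * (r (K + e i) ^ (γ / 2) - r K ^ (γ / 2)) ^ 2) := by
    rw [e1, e2]
    simp only [Finset.mul_sum]
    refine Finset.sum_congr rfl fun K _ => Finset.sum_congr rfl fun i _ => ?_
    rw [jump]; field_simp
  rw [e3, intFaces]
  exact mul_le_mul_of_nonneg_left (Finset.sum_le_sum fun K _ => Finset.sum_le_sum fun i _ =>
    mul_le_mul_of_nonneg_left (sq_jump_rpow_half_le ha hγ hγ2 (hr K) (hr (K + e i)))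
      (Real.rpow_nonneg hh.le _)) (pow_nonneg hh.le _)

lemma intFaces_dissipation_nonneg {a γ α h : ℝ} (ha : 0 < a) (hγ : 1 < γ) (hh : 0 < h)
    {r : Cell d N → ℝ} (hr : ∀ K, 0 < r K) :
    0 ≤ intFaces h (fun K i => h ^ α *
      (jump r K i * jump (fun K => enthalpy a γ (r K)) K i)) := by
  have hmono : ∀ x y : ℝ, 0 < x → x ≤ y → enthalpy a γ x ≤ enthalpy a γ y := by
    intro x y hx hxy
    have : 0 < a * γ / (γ - 1) := div_pos (by positivity) (by linarith)
    exact mul_le_mul_of_nonneg_left (Real.rpow_le_rpow hx.le hxy (by linarith)) this.le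
  refine mul_nonneg (pow_nonneg hh.le _) (Finset.sum_nonneg fun K _ => Finset.sum_nonneg
    fun i _ => mul_nonneg (Real.rpow_nonneg hh.le _) ?_)
  simp only [jump]
  rcases le_total (r K) (r (K + e i)) with h1 | h1
  · exact mul_nonneg (by linarith) (sub_nonneg.2 (hmono _ _ (hr _) h1))
  · exact mul_nonneg_of_nonpos_of_nonpos (by linarith) (sub_nonpos.2 (hmono _ _ (hr _) h1))

lemma intGradGrad_self_nonneg {h : ℝ} (hh : 0 < h) (v : Cell d N → EuclideanSpace ℝ (Fin d)) :
    0 ≤ intGradGrad h v v :=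
  mul_nonneg (pow_nonneg hh.le _) (Finset.sum_nonneg fun _ _ => Finset.sum_nonneg fun _ _ =>
    Finset.sum_nonneg fun _ _ => mul_self_nonneg _)

/-- The four summands of the constant correspond to the four bounds: `(γ - 1) / a` for the `L^γ`
norm of the density, `2` for the kinetic energy, `1 / (2 * a)` for the density jumps, `1 / μ` for
the velocity gradient. Each multiplies a bound for the initial discrete energy. -/
lemma aprioriBounds_of_isFVSolution {T a γ μ lam α ε M₀ E₀ R : ℝ} (hd : d = 2 ∨ d = 3)
    (hT : 0 < T) (ha : 0 < a) (hγ : 1 < γ) (hμ : 0 < μ) (hlam : 0 ≤ lam) (hε : 0 < ε)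
    {Ωf : Set (Torus d L)} {ρ₀ : Torus d L → ℝ} {m₀ : Torus d L → EuclideanSpace ℝ (Fin d)}
    (H : IsInitialData a γ M₀ E₀ R Ωf ρ₀ m₀) {NT : ℕ} (hNT : 0 < NT)
    {ρ : ℕ → Cell d N → ℝ} {u : ℕ → Cell d N → EuclideanSpace ℝ (Fin d)}
    (S : IsFVSolution T a γ μ lam α ε N NT Ωf ρ₀ m₀ ρ u) :
    AprioriBounds L T γ α M₀ R
      (((γ - 1) / a + 2 + 1 / (2 * a) + 1 / μ) * (E₀ + L ^ d * (a / (γ - 1) * R ^ γ)))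
      N NT ρ u := by
  classical
  have hh := meshSize_pos L N
  set h := meshSize L N with hdef
  have hNT' : (0 : ℝ) < NT := by exact_mod_cast hNT
  have hd0 : 0 < d := by rcases hd with h | h <;> omega
  set τ := T / NT with hτ
  have hτ0 : 0 < τ := div_pos hT hNT'
  have hν : 0 ≤ lam + ((d : ℝ) - 2) / d * μ := by
    have : (0 : ℝ) ≤ ((d : ℝ) - 2) / d := by rcases hd with h | h <;> rw [h] <;> norm_num
    positivity
  set E := E₀ + L ^ d * (a / (γ - 1) * R ^ γ) with hE
  have hp0 : 0 < a / (γ - 1) := div_pos ha (by linarith)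
  have hpos : ∀ k ≤ NT, ∀ K, 0 < ρ k K := by
    intro k
    induction k with
    | zero => intro _ K; rw [S.init_density]; exact H.proj_density_pos K
    | succ k ih =>
      intro hk
      exact density_pos_step hh hτ0 (ih (by omega)) (S.continuity k hk)
  have hmass : ∀ k ≤ NT, h ^ d * ∑ K, ρ k K = M₀ := by
    intro k
    induction k with
    | zero => intro _; simp only [S.init_density]; exact H.sum_proj_density
    | succ k ih =>
      intro hk
      rw [mass_step hτ0 (S.continuity k hk), ih (by omega)]
  have hinit : ∀ K, ρ 0 K ≤ R := fun K => by rw [S.init_density]; exact H.proj_density_le K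
  set D : ℕ → ℝ := fun k => intFaces h (fun K i => h ^ α *
        (jump (ρ (k + 1)) K i * jump (fun K => enthalpy a γ (ρ (k + 1) K)) K i)) with hD
  set G : ℕ → ℝ := fun k => intGradGrad h (u (k + 1)) (u (k + 1)) with hG
  have hstep : ∀ k, k + 1 ≤ NT → energy a γ h (ρ (k + 1)) (u (k + 1)) + τ * (D k + μ * G k)
      ≤ energy a γ h (ρ k) (u k) := fun k hk =>
    energy_step hd0 ha hγ hh hτ0 hν hε (hpos k (by omega)) (hpos (k + 1) hk)
      (S.continuity k hk) (S.momentum k hk)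
  -- The potential energy of the projected density is estimated pointwise by `ρ 0 ≤ R`; this is the
  -- second term of `E`.
  have hE0 : energy a γ h (ρ 0) (u 0) ≤ E := by
    have h1 := H.sum_proj_kinetic_le ha hγ (u 0) (fun K => by
      rw [← S.init_density]; exact S.init_momentum K)
    simp only [← S.init_density] at h1
    rw [energy, intTorus, Finset.sum_add_distrib, mul_add, hE]
    simp only [EuclideanSpace.real_norm_sq_eq] at h1
    refine add_le_add h1 ?_
    rw [← meshSize_pow_mul_sum_const d L N]
    gcongr with K
    exact mul_le_mul_of_nonneg_left
      (Real.rpow_le_rpow (hpos 0 (Nat.zero_le _) K).le (hinit K) (by linarith)) hp0.le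
  have hsum : ∀ k ≤ NT, energy a γ h (ρ k) (u k)
      + ∑ j ∈ Finset.range k, τ * (D j + μ * G j) ≤ E := by
    intro k
    induction k with
    | zero => intro _; simpa using hE0
    | succ k ih =>
      intro hk
      rw [Finset.sum_range_succ]
      have h1 := hstep k hk
      have h2 := ih (by omega)
      linarith
  have hD0 : ∀ k, k + 1 ≤ NT → 0 ≤ D k := fun k hk =>
    intFaces_dissipation_nonneg ha hγ hh (hpos (k + 1) hk)
  have hG0 : ∀ k, 0 ≤ G k := fun k => intGradGrad_self_nonneg hh _
  have hkin0 : ∀ k ≤ NT, 0 ≤ h ^ d * ∑ K, ρ k K * (∑ j, u k K j ^ 2) / 2 := fun k hk =>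
    mul_nonneg (pow_nonneg hh.le _) (Finset.sum_nonneg fun K _ => div_nonneg
      (mul_nonneg (hpos k hk K).le (Finset.sum_nonneg fun _ _ => sq_nonneg _)) zero_le_two)
  have hpot0 : ∀ k ≤ NT, 0 ≤ h ^ d * ∑ K, pressurePotential a γ (ρ k K) := fun k hk =>
    mul_nonneg (pow_nonneg hh.le _) (Finset.sum_nonneg fun K _ =>
      mul_nonneg hp0.le (Real.rpow_nonneg (hpos k hk K).le _))
  have hen : ∀ k, energy a γ h (ρ k) (u k) = h ^ d * ∑ K, ρ k K * (∑ j, u k K j ^ 2) / 2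
      + h ^ d * ∑ K, pressurePotential a γ (ρ k K) := fun k => by
    rw [energy, intTorus, Finset.sum_add_distrib, mul_add]
  have hdiss0 : ∀ k ≤ NT, 0 ≤ ∑ j ∈ Finset.range k, τ * (D j + μ * G j) := fun k hk =>
    Finset.sum_nonneg fun j hj => mul_nonneg hτ0.le (add_nonneg
      (hD0 j (by have := Finset.mem_range.1 hj; omega)) (mul_nonneg hμ.le (hG0 j)))
  have hEn : 0 ≤ E := by
    have h1 := hsum 0 (Nat.zero_le _)
    rw [hen] at h1
    have h2 := hkin0 0 (Nat.zero_le _)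
    have h3 := hpot0 0 (Nat.zero_le _)
    have h4 := hdiss0 0 (Nat.zero_le _)
    linarith
  have hdissE : ∑ j ∈ Finset.range NT, τ * D j + μ * ∑ j ∈ Finset.range NT, τ * G j ≤ E := by
    have h1 := hsum NT le_rfl
    rw [hen] at h1
    have h2 := hkin0 NT le_rfl
    have h3 := hpot0 NT le_rfl
    have h4 : ∑ j ∈ Finset.range NT, τ * (D j + μ * G j)
        = ∑ j ∈ Finset.range NT, τ * D j + μ * ∑ j ∈ Finset.range NT, τ * G j := by
      rw [Finset.mul_sum, ← Finset.sum_add_distrib]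
      exact Finset.sum_congr rfl fun j _ => by ring
    linarith
  have hDs : 0 ≤ ∑ j ∈ Finset.range NT, τ * D j := Finset.sum_nonneg fun j hj =>
    mul_nonneg hτ0.le (hD0 j (by have := Finset.mem_range.1 hj; omega))
  have hGs : 0 ≤ ∑ j ∈ Finset.range NT, τ * G j := Finset.sum_nonneg fun j _ =>
    mul_nonneg hτ0.le (hG0 j)
  have c1 : 0 ≤ (γ - 1) / a * E := mul_nonneg (div_nonneg (by linarith) ha.le) hEn
  have c2 : 0 ≤ 1 / (2 * a) * E := by positivity
  have c3 : 0 ≤ 1 / μ * E := by positivity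
  have hexp : ((γ - 1) / a + 2 + 1 / (2 * a) + 1 / μ) * E
      = (γ - 1) / a * E + 2 * E + 1 / (2 * a) * E + 1 / μ * E := by ring
  rw [hexp]
  refine ⟨hpos, hmass, fun k hk => ?_, fun k hk => ?_, fun hγ2 => ?_, ?_, hinit, fun K => ?_⟩
  · have h1 := hsum k hk
    rw [hen] at h1
    have h2 := hkin0 k hk
    have h4 := hdiss0 k hk
    have h5 : h ^ d * ∑ K, pressurePotential a γ (ρ k K) ≤ E := by linarith
    simp only [pressurePotential] at h5
    rw [← Finset.mul_sum] at h5
    have h6 : h ^ d * ∑ K, ρ k K ^ γ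
        = (γ - 1) / a * (h ^ d * (a / (γ - 1) * ∑ K, ρ k K ^ γ)) := by
      have : γ - 1 ≠ 0 := by linarith
      field_simp
    have h7 : (γ - 1) / a * (h ^ d * (a / (γ - 1) * ∑ K, ρ k K ^ γ)) ≤ (γ - 1) / a * E :=
      mul_le_mul_of_nonneg_left h5 (div_nonneg (by linarith) ha.le)
    rw [h6]
    linarith
  · have h1 := hsum k hk
    rw [hen] at h1
    have h3 := hpot0 k hk
    have h4 := hdiss0 k hk
    rw [← Finset.sum_div] at h1
    simp only [EuclideanSpace.real_norm_sq_eq]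
    linarith
  · have h1 : ∑ k ∈ Finset.range NT, τ * (h ^ (α + 1) * (h ^ d * ∑ K, ∑ i,
        (h⁻¹ * jump (fun K => ρ (k + 1) K ^ (γ / 2)) K i) ^ 2))
        ≤ 1 / (2 * a) * ∑ k ∈ Finset.range NT, τ * D k := by
      rw [Finset.mul_sum]
      refine Finset.sum_le_sum fun k hk => ?_
      have hk' : k + 1 ≤ NT := Finset.mem_range.1 hk
      have h2 := dissipation_faces_ge (α := α) hd0 ha hγ hγ2 hh (hpos (k + 1) hk')
      have h3 := mul_le_mul_of_nonneg_left h2 (show 0 ≤ 1 / (2 * a) * τ by positivity)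
      refine le_trans (le_of_eq ?_) (h3.trans (le_of_eq ?_))
      · field_simp
      · ring
    have h2 : 1 / (2 * a) * ∑ k ∈ Finset.range NT, τ * D k ≤ 1 / (2 * a) * E := by
      have := mul_nonneg hμ.le hGs
      gcongr; linarith
    linarith
  · have h1 : ∑ j ∈ Finset.range NT, τ * G j ≤ 1 / μ * E := by
      rw [one_div, ← div_eq_inv_mul, le_div_iff₀ hμ]
      linarith
    linarith
  · rw [S.init_momentum]
    exact IsInitialData.norm_proj_le H.momentum_le K

end

/-! ### Interpolation, inverse and Hölder inequalities -/

section Interpolation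

variable {d N : ℕ} [NeZero N] {L : ℝ} [hL : Fact (0 < L)]

/-- Where `w ^ 2 ≤ τ` the second power dominates, elsewhere the `m`-th one does. Optimizing `τ`
afterwards replaces a Hölder interpolation. -/
lemma rpow_le_add_of_level {w τ q m : ℝ} (hw : 0 ≤ w) (hτ : 0 < τ) (hq : 2 ≤ q) (hqm : q ≤ m) :
    w ^ q ≤ τ ^ ((q - 2) / 2) * w ^ 2 + τ ^ ((q - m) / 2) * w ^ m := by
  have a1 : 0 ≤ τ ^ ((q - 2) / 2) * w ^ 2 := by positivity
  have a2 : 0 ≤ τ ^ ((q - m) / 2) * w ^ m := by positivity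
  rcases hw.eq_or_lt with h0 | h0
  · have : w ^ q = 0 := by rw [← h0, Real.zero_rpow (by linarith)]
    linarith
  have e : ∀ s : ℝ, w ^ s = (w ^ 2) ^ (s / 2) := fun s => by
    rw [← Real.rpow_natCast, ← Real.rpow_mul hw]; congr 1; push_cast; ring
  rcases le_total (w ^ 2) τ with h | h
  · have h1 : w ^ q = w ^ (q - 2) * w ^ 2 := by
      rw [← Real.rpow_natCast, ← Real.rpow_add h0]; congr 1; push_cast; ring
    have h2 : w ^ (q - 2) ≤ τ ^ ((q - 2) / 2) := by
      rw [e]; exact Real.rpow_le_rpow (sq_nonneg w) h (by linarith)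
    have h3 := mul_le_mul_of_nonneg_right h2 (sq_nonneg w)
    linarith
  · have h1 : w ^ q = w ^ (q - m) * w ^ m := by
      rw [← Real.rpow_add h0]; congr 1; ring
    have h2 : w ^ (q - m) ≤ τ ^ ((q - m) / 2) := by
      rw [e]; exact Real.rpow_le_rpow_of_nonpos hτ h (by linarith)
    have h3 := mul_le_mul_of_nonneg_right h2 (Real.rpow_nonneg hw m)
    linarith

/-- The Gagliardo–Nirenberg inequality, interpolating between `L²` and `H¹`. -/
lemma sum_rpow_le_interpolation (L : ℝ) [hL : Fact (0 < L)] {d : ℕ} (hd : d = 2 ∨ d = 3)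
    {q B : ℝ} (hq2 : 2 ≤ q) (hq4 : q ≤ 4) (hB : 0 < B) :
    ∃ C : ℝ, 0 < C ∧ ∀ (N : ℕ) [NeZero N] (w : Cell d N → ℝ), (∀ K, 0 ≤ w K) →
      meshSize L N ^ d * ∑ K, w K ^ 2 ≤ B →
      meshSize L N ^ d * ∑ K, w K ^ q ≤ C * sobolevSq (meshSize L N) w ^ (d * (q - 2) / 4) := by
  have hL0 : 0 < L := hL.out
  have split : ∀ (N : ℕ) [NeZero N] (w : Cell d N → ℝ), (∀ K, 0 ≤ w K) → ∀ (τ m : ℝ), 0 < τ →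
      q ≤ m → meshSize L N ^ d * ∑ K, w K ^ 2 ≤ B → meshSize L N ^ d * ∑ K, w K ^ q
        ≤ τ ^ ((q - 2) / 2) * B + τ ^ ((q - m) / 2) * (meshSize L N ^ d * ∑ K, w K ^ m) := by
    intro N _ w hw τ m hτ hm hB
    have hh := meshSize_pos L N
    calc meshSize L N ^ d * ∑ K, w K ^ q
        ≤ meshSize L N ^ d * ∑ K, (τ ^ ((q - 2) / 2) * w K ^ 2 + τ ^ ((q - m) / 2) * w K ^ m) := by
          gcongr with K
          exact rpow_le_add_of_level (hw K) hτ hq2 hm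
      _ = τ ^ ((q - 2) / 2) * (meshSize L N ^ d * ∑ K, w K ^ 2)
          + τ ^ ((q - m) / 2) * (meshSize L N ^ d * ∑ K, w K ^ m) := by
          rw [Finset.sum_add_distrib, ← Finset.mul_sum, ← Finset.mul_sum]; ring
      _ ≤ _ := by gcongr
  have zero : ∀ (N : ℕ) [NeZero N] (w : Cell d N → ℝ), 0 = sobolevSq (meshSize L N) w →
      meshSize L N ^ d * ∑ K, w K ^ q = 0 := by
    intro N _ w h0
    have hh := meshSize_pos L N
    have h1 := sum_sq_le_sobolevSq hh.le w
    rw [← h0] at h1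
    have h2 : ∑ K, w K ^ 2 ≤ 0 := by
      by_contra hc
      have := mul_pos (pow_pos hh d) (not_le.1 hc)
      linarith
    have h3 : ∀ K, w K = 0 := fun K => by
      have := Finset.single_le_sum (f := fun K => w K ^ 2) (fun _ _ => sq_nonneg _)
        (Finset.mem_univ K)
      exact pow_eq_zero_iff two_ne_zero |>.1 (le_antisymm (this.trans h2) (sq_nonneg _))
    simp [h3, Real.zero_rpow (show q ≠ 0 by linarith)]
  rcases hd with rfl | rfl
  · set c := (2 + 16 * (2 : ℝ) ^ 2) * (1 + (L ^ 2)⁻¹) with hc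
    have hc0 : 0 < c := by positivity
    refine ⟨B + c * B, by positivity, fun N _ w hw hwB => ?_⟩
    have hh := meshSize_pos L N
    set H := sobolevSq (meshSize L N) w
    have hH0 : 0 ≤ H := sobolevSq_nonneg hh.le w
    rcases hH0.eq_or_lt with hH | hH
    · rw [zero N w hH]; positivity
    have h1 := sum_rpow_two_mul_le (L := L) (s := 2) (by norm_num) w hw
    rw [← hc] at h1
    have e2 : ∀ K, w K ^ (2 * (2 : ℝ) - 2) = w K ^ 2 := fun K => by
      rw [← Real.rpow_natCast]; congr 1; norm_num
    have e4 : ∀ K, w K ^ (2 * (2 : ℝ)) = w K ^ (4 : ℝ) := fun K => by norm_num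
    simp only [e2, e4] at h1
    have h2 : meshSize L N ^ 2 * ∑ K, w K ^ (4 : ℝ) ≤ c * B * H := by
      calc meshSize L N ^ 2 * ∑ K, w K ^ (4 : ℝ)
          ≤ meshSize L N ^ 2 * (c * (∑ K, w K ^ 2) * H) := by gcongr
        _ = c * (meshSize L N ^ 2 * ∑ K, w K ^ 2) * H := by ring
        _ ≤ _ := by gcongr
    -- The level `τ = H` balances the two terms: both become multiples of `H ^ ((q - 2) / 2)`.
    refine (split N w hw H 4 hH hq4 hwB).trans ?_
    have h3 : H ^ ((q - 4) / 2) * (c * B * H) = c * B * H ^ ((q - 2) / 2) := by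
      rw [show (q - 2) / 2 = (q - 4) / 2 + 1 by ring, Real.rpow_add hH, Real.rpow_one]; ring
    have h4 : ((2 : ℕ) : ℝ) * (q - 2) / 4 = (q - 2) / 2 := by push_cast; ring
    rw [h4]
    have h5 : H ^ ((q - 4) / 2) * (meshSize L N ^ 2 * ∑ K, w K ^ (4 : ℝ))
        ≤ H ^ ((q - 4) / 2) * (c * B * H) := by gcongr
    rw [h3] at h5
    linarith
  · set c := (386 * (1 + (L ^ 2)⁻¹)) ^ 3 with hc
    have hc0 : 0 < c := by positivity
    refine ⟨B + c, by positivity, fun N _ w hw hwB => ?_⟩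
    have hh := meshSize_pos L N
    have h1 := sum_pow_six_le (L := L) w hw
    rw [← hc] at h1
    set H := sobolevSq (meshSize L N) w
    have hH0 : 0 ≤ H := sobolevSq_nonneg hh.le w
    rcases hH0.eq_or_lt with hH | hH
    · rw [zero N w hH]; positivity
    -- In three dimensions the balancing level, for the sixth power, is `H ^ (3 / 2)`.
    have hτ : 0 < H ^ ((3 : ℝ) / 2) := by positivity
    refine (split N w hw (H ^ ((3 : ℝ) / 2)) 6 hτ (by linarith) hwB).trans ?_
    have e6 : ∀ K, w K ^ (6 : ℝ) = w K ^ 6 := fun K => by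
      rw [← Real.rpow_natCast]; norm_num
    simp only [e6, ← Real.rpow_mul hH0]
    have h3 : H ^ ((3 : ℝ) / 2 * ((q - 6) / 2)) * (c * H ^ 3)
        = c * H ^ ((3 : ℝ) / 2 * ((q - 2) / 2)) := by
      rw [← Real.rpow_natCast, mul_left_comm, ← Real.rpow_add hH]; congr 2; push_cast; ring
    have h4 : ((3 : ℕ) : ℝ) * (q - 2) / 4 = (3 : ℝ) / 2 * ((q - 2) / 2) := by push_cast; ring
    rw [h4]
    have h5 : H ^ ((3 : ℝ) / 2 * ((q - 6) / 2)) * (meshSize L N ^ 3 * ∑ K, w K ^ 6)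
        ≤ H ^ ((3 : ℝ) / 2 * ((q - 6) / 2)) * (c * H ^ 3) := by gcongr
    rw [h3] at h5
    linarith

/-- The discrete Sobolev inequality with the constant `C`. -/
def SobolevEmbedding (d : ℕ) (L p C : ℝ) : Prop :=
  ∀ (N : ℕ) [NeZero N] (w : Cell d N → ℝ), (∀ K, 0 ≤ w K) →
    meshSize L N ^ d * ∑ K, w K ^ p ≤ C * sobolevSq (meshSize L N) w ^ (p / 2)

lemma exists_sobolevEmbedding_two (L : ℝ) [hL : Fact (0 < L)] {p : ℝ} (hp : 2 ≤ p) :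
    ∃ C : ℝ, 0 < C ∧ SobolevEmbedding 2 L p C := by
  obtain ⟨C, hC, h⟩ := sum_rpow_le_sobolevSq_two (L := L) (s := p / 2) (by linarith)
  refine ⟨C, hC, fun N _ w hw => ?_⟩
  have := h N w hw
  rwa [mul_div_cancel₀ p two_ne_zero] at this

lemma exists_sobolevEmbedding_three (L : ℝ) [hL : Fact (0 < L)] :
    ∃ C : ℝ, 0 < C ∧ SobolevEmbedding 3 L 6 C := by
  have hL0 : 0 < L := hL.out
  refine ⟨(386 * (1 + (L ^ 2)⁻¹)) ^ 3, by positivity, fun N _ w hw => ?_⟩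
  have h := sum_pow_six_le (L := L) w hw
  have e6 : ∀ K, w K ^ (6 : ℝ) = w K ^ 6 := fun K => by
    rw [← Real.rpow_natCast]; norm_num
  have e3 : sobolevSq (meshSize L N) w ^ ((6 : ℝ) / 2) = sobolevSq (meshSize L N) w ^ 3 := by
    rw [← Real.rpow_natCast]; norm_num
  simp only [e6, e3]
  exact h

/-- One cell contributes `h ^ d * w K ^ p` to the `p`-th power sum; this inverse estimate after the
embedding loses only `h ^ (-(2 * d / p))`, less than a direct one from `L²` when `p > 2`. -/
lemma sq_le_of_sobolevEmbedding {p C : ℝ} (hp : 0 < p) (hC : 0 < C)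
    (hS : SobolevEmbedding d L p C) (w : Cell d N → ℝ) (hw : ∀ K, 0 ≤ w K) (K : Cell d N) :
    w K ^ 2 ≤ C ^ (2 / p) * (meshSize L N ^ (-(2 * d / p)) * sobolevSq (meshSize L N) w) := by
  have hh := meshSize_pos L N
  have hH0 := sobolevSq_nonneg hh.le w
  have hhd : 0 < meshSize L N ^ d := pow_pos hh d
  have h1 : meshSize L N ^ d * w K ^ p ≤ C * sobolevSq (meshSize L N) w ^ (p / 2) := by
    refine le_trans ?_ (hS N w hw)
    gcongr
    exact Finset.single_le_sum (f := fun K => w K ^ p) (fun K _ => Real.rpow_nonneg (hw K) p)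
      (Finset.mem_univ K)
  have h2 : w K ^ p ≤ C * sobolevSq (meshSize L N) w ^ (p / 2) * (meshSize L N ^ d)⁻¹ := by
    rw [← div_eq_mul_inv, le_div_iff₀ hhd]; linarith
  have h3 := Real.rpow_le_rpow (Real.rpow_nonneg (hw K) p) h2 (show 0 ≤ 2 / p by positivity)
  have h4 : (w K ^ p) ^ (2 / p) = w K ^ 2 := by
    rw [← Real.rpow_mul (hw K), mul_div_cancel₀ _ hp.ne', ← Real.rpow_natCast]; norm_num
  rw [h4, Real.mul_rpow (by positivity) (by positivity), Real.mul_rpow hC.le (by positivity),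
    ← Real.rpow_mul hH0, show p / 2 * (2 / p) = 1 by field_simp, Real.rpow_one] at h3
  refine h3.trans (le_of_eq ?_)
  rw [← Real.rpow_natCast, ← Real.rpow_neg hh.le, ← Real.rpow_mul hh.le]
  rw [show -(d : ℝ) * (2 / p) = -(2 * d / p) by ring]
  ring

/-- Inverse estimate. -/
lemma le_of_sum_le {f : Cell d N → ℝ} {B : ℝ} (hf : ∀ K, 0 ≤ f K)
    (hB : meshSize L N ^ d * ∑ K, f K ≤ B) (K : Cell d N) :
    f K ≤ B * meshSize L N ^ (-(d : ℝ)) := by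
  have hhd : 0 < meshSize L N ^ d := pow_pos (meshSize_pos L N) d
  rw [Real.rpow_neg (meshSize_pos L N).le, Real.rpow_natCast, ← div_eq_mul_inv, le_div_iff₀ hhd,
    mul_comm]
  refine le_trans ?_ hB
  gcongr
  exact Finset.single_le_sum (fun K _ => hf K) (Finset.mem_univ K)

lemma sum_rpow_le_of_le {r : Cell d N → ℝ} {γ q B Q : ℝ} (hγ : 0 < γ) (hq : γ ≤ q) (hQ : 0 ≤ Q)
    (hr : ∀ K, 0 < r K) (hB : meshSize L N ^ d * ∑ K, r K ^ γ ≤ B) (hrQ : ∀ K, r K ^ γ ≤ Q) :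
    meshSize L N ^ d * ∑ K, r K ^ q ≤ Q ^ ((q - γ) / γ) * B := by
  have hh := meshSize_pos L N
  calc meshSize L N ^ d * ∑ K, r K ^ q
      ≤ meshSize L N ^ d * ∑ K, Q ^ ((q - γ) / γ) * r K ^ γ := by
        gcongr with K
        have h1 : r K ^ q = (r K ^ γ) ^ ((q - γ) / γ) * r K ^ γ := by
          rw [← Real.rpow_mul (hr K).le, ← Real.rpow_add (hr K)]; congr 1; field_simp; ring
        rw [h1]
        have h2 := Real.rpow_le_rpow (Real.rpow_nonneg (hr K).le γ) (hrQ K)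
          (show 0 ≤ (q - γ) / γ from div_nonneg (by linarith) hγ.le)
        exact mul_le_mul_of_nonneg_right h2 (Real.rpow_nonneg (hr K).le γ)
    _ = Q ^ ((q - γ) / γ) * (meshSize L N ^ d * ∑ K, r K ^ γ) := by
        rw [← Finset.mul_sum]; ring
    _ ≤ _ := by gcongr

lemma sum_rpow_le_add {r : Cell d N → ℝ} {γ q B : ℝ} (hq0 : 0 ≤ q) (hq : q ≤ γ)
    (hr : ∀ K, 0 < r K) (hB : meshSize L N ^ d * ∑ K, r K ^ γ ≤ B) :
    meshSize L N ^ d * ∑ K, r K ^ q ≤ L ^ d + B := by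
  have hh := meshSize_pos L N
  calc meshSize L N ^ d * ∑ K, r K ^ q
      ≤ meshSize L N ^ d * ∑ K, (1 + r K ^ γ) := by
        gcongr with K
        rcases le_total (r K) 1 with h | h
        · have h1 := Real.rpow_le_one (hr K).le h hq0
          have h2 := Real.rpow_nonneg (hr K).le γ
          linarith
        · have := Real.rpow_le_rpow_of_exponent_le h hq
          linarith
    _ = L ^ d + meshSize L N ^ d * ∑ K, r K ^ γ := by
        rw [Finset.sum_add_distrib, mul_add, meshSize_pow_mul_sum_const, mul_one]
    _ ≤ _ := by gcongr

lemma sum_mul_sq_le_holder {f g : Cell d N → ℝ} {q p : ℝ} (hq : 0 < q) (hp : 0 < p)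
    (hpq : 1 / q + 1 / p = 1 / 2) (hf : ∀ K, 0 ≤ f K) (hg : ∀ K, 0 ≤ g K) :
    meshSize L N ^ d * ∑ K, (f K * g K) ^ 2
      ≤ (meshSize L N ^ d * ∑ K, f K ^ q) ^ (2 / q)
        * (meshSize L N ^ d * ∑ K, g K ^ p) ^ (2 / p) := by
  have hh := meshSize_pos L N
  have hconj : Real.HolderConjugate (q / 2) (p / 2) := by
    have h1 : (q / 2)⁻¹ + (p / 2)⁻¹ = 1 := by
      have : (q / 2)⁻¹ + (p / 2)⁻¹ = 2 * (1 / q + 1 / p) := by field_simp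
      rw [this, hpq]; norm_num
    rw [Real.holderConjugate_iff]
    refine ⟨?_, h1⟩
    have h2 : 0 < (p / 2)⁻¹ := by positivity
    have h3 : (q / 2)⁻¹ < 1 := by linarith
    exact (inv_lt_one₀ (by positivity)).1 h3
  have h1 := Real.inner_le_Lp_mul_Lq_of_nonneg Finset.univ (f := fun K => f K ^ 2)
    (g := fun K => g K ^ 2) hconj (fun K _ => sq_nonneg _) (fun K _ => sq_nonneg _)
  have e1 : ∀ (x s : ℝ), 0 ≤ x → (x ^ 2) ^ (s / 2) = x ^ s := fun x s hx => by
    rw [← Real.rpow_natCast, ← Real.rpow_mul hx]; congr 1; push_cast; ring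
  simp only [e1 _ _ (hf _), e1 _ _ (hg _), one_div_div, ← mul_pow] at h1
  have hhd : 0 < meshSize L N ^ d := pow_pos hh d
  have e2 : meshSize L N ^ d = (meshSize L N ^ d) ^ (2 / q) * (meshSize L N ^ d) ^ (2 / p) := by
    rw [← Real.rpow_add hhd]
    have : 2 / q + 2 / p = 1 := by
      have : 2 / q + 2 / p = 2 * (1 / q + 1 / p) := by ring
      rw [this, hpq]; norm_num
    rw [this, Real.rpow_one]
  rw [Real.mul_rpow hhd.le (Finset.sum_nonneg fun K _ => Real.rpow_nonneg (hf K) _),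
    Real.mul_rpow hhd.le (Finset.sum_nonneg fun K _ => Real.rpow_nonneg (hg K) _)]
  calc meshSize L N ^ d * ∑ K, (f K * g K) ^ 2
      ≤ meshSize L N ^ d * ((∑ K, f K ^ q) ^ (2 / q) * (∑ K, g K ^ p) ^ (2 / p)) := by gcongr
    _ = _ := by
        conv_lhs => rw [e2]
        ring

end Interpolation

/-! ### Sums over the time steps -/

section TimeSums

/-- Concave powers are linearized at the scale `lam`, so that a bound `S * lam` for a time sum of
`y` becomes a multiple of `lam ^ θ` for the sum of `y ^ θ`. -/
lemma rpow_le_mul_one_add_div {y lam θ : ℝ} (hy : 0 ≤ y) (hlam : 0 < lam) (h0 : 0 ≤ θ)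
    (h1 : θ ≤ 1) : y ^ θ ≤ lam ^ θ * (1 + y / lam) := by
  have e : y ^ θ = lam ^ θ * (y / lam) ^ θ := by
    rw [← Real.mul_rpow hlam.le (by positivity), mul_div_cancel₀ _ hlam.ne']
  rw [e]
  refine mul_le_mul_of_nonneg_left ?_ (by positivity)
  have hz : 0 ≤ y / lam := by positivity
  rcases le_total (y / lam) 1 with h | h
  · have := Real.rpow_le_one hz h h0
    linarith
  · have := Real.rpow_le_rpow_of_exponent_le h h1
    rw [Real.rpow_one] at this
    linarith

/-- Jensen's inequality for sums over the time steps. -/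
lemma sum_time_le {T : ℝ} (hT : 0 < T) {n : ℕ} (hn : 0 < n) {X Y : ℕ → ℝ}
    {c₀ c S lam θ : ℝ} (hc₀ : 0 ≤ c₀) (hc : 0 ≤ c) (hlam : 1 ≤ lam) (h0 : 0 ≤ θ) (h1 : θ ≤ 1)
    (hX0 : X 0 ≤ c₀) (hX : ∀ k, k + 1 ≤ n → X (k + 1) ≤ c * Y (k + 1) ^ θ) (hY0 : ∀ k, 0 ≤ Y k)
    (hY : ∑ k ∈ Finset.range n, T / n * Y (k + 1) ≤ S * lam) :
    ∑ k ∈ Finset.range n, T / n * X k ≤ (T * c₀ + c * (T + S)) * lam ^ θ := by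
  have hn' : (0 : ℝ) < n := by exact_mod_cast hn
  have hlam0 : 0 < lam := by linarith
  have hτ0 : 0 < T / n := by positivity
  have hlamθ : 1 ≤ lam ^ θ := Real.one_le_rpow hlam h0
  have hle : ∑ k ∈ Finset.range n, T / n * (c * Y (k + 1) ^ θ) ≤ c * (T + S) * lam ^ θ := by
    calc ∑ k ∈ Finset.range n, T / n * (c * Y (k + 1) ^ θ)
        ≤ ∑ k ∈ Finset.range n, T / n * (c * (lam ^ θ * (1 + Y (k + 1) / lam))) := by
          refine Finset.sum_le_sum fun k _ => ?_
          have := rpow_le_mul_one_add_div (hY0 (k + 1)) hlam0 h0 h1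
          gcongr
      _ = c * lam ^ θ * (T + (∑ k ∈ Finset.range n, T / n * Y (k + 1)) / lam) := by
          have e : ∀ k, T / n * (c * (lam ^ θ * (1 + Y (k + 1) / lam)))
              = c * lam ^ θ * (T / n + T / n * Y (k + 1) / lam) := fun k => by ring
          simp only [e]
          rw [← Finset.mul_sum, Finset.sum_add_distrib, Finset.sum_const, Finset.card_range,
            nsmul_eq_mul, mul_div_cancel₀ _ hn'.ne', Finset.sum_div]
      _ ≤ c * lam ^ θ * (T + S) := by
          have : (∑ k ∈ Finset.range n, T / n * Y (k + 1)) / lam ≤ S := by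
            rwa [div_le_iff₀ hlam0]
          gcongr
      _ = _ := by ring
  have hfirst : T / n * X 0 ≤ T * c₀ * lam ^ θ := by
    have h2 : T / n ≤ T := div_le_self hT.le (by exact_mod_cast hn)
    calc T / n * X 0 ≤ T / n * c₀ := by gcongr
      _ ≤ T * c₀ := by gcongr
      _ ≤ T * c₀ * lam ^ θ := le_mul_of_one_le_right (by positivity) hlamθ
  -- The norm sees the indices `0, …, n - 1`, whereas the dissipation is available for `1, …, n`.
  -- The index `0` is covered by the bound on the initial data, and the unused last term on the
  -- right is nonnegative.
  obtain ⟨m, rfl⟩ : ∃ m, n = m + 1 := ⟨n - 1, by omega⟩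
  rw [Finset.sum_range_succ']
  have hrest : ∑ k ∈ Finset.range m, T / ((m + 1 : ℕ) : ℝ) * X (k + 1)
      ≤ ∑ k ∈ Finset.range (m + 1), T / ((m + 1 : ℕ) : ℝ) * (c * Y (k + 1) ^ θ) := by
    rw [Finset.sum_range_succ]
    have : 0 ≤ T / ((m + 1 : ℕ) : ℝ) * (c * Y (m + 1) ^ θ) :=
      mul_nonneg hτ0.le (mul_nonneg hc (Real.rpow_nonneg (hY0 _) _))
    refine le_add_of_le_of_nonneg (Finset.sum_le_sum fun k hk => ?_) this
    have hk' := Finset.mem_range.1 hk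
    exact mul_le_mul_of_nonneg_left (hX k (by omega)) hτ0.le
  rw [add_mul]
  linarith

lemma sum_time_le_of_le {T : ℝ} {n : ℕ} (hT : 0 < T) (hn : 0 < n) {X : ℕ → ℝ} {c : ℝ}
    (hX : ∀ k ≤ n, X k ≤ c) : ∑ k ∈ Finset.range n, T / n * X k ≤ T * c := by
  have hn' : (0 : ℝ) < n := by exact_mod_cast hn
  calc ∑ k ∈ Finset.range n, T / n * X k ≤ ∑ _k ∈ Finset.range n, T / n * c := by
        refine Finset.sum_le_sum fun k hk => ?_
        exact mul_le_mul_of_nonneg_left (hX k (Finset.mem_range.1 hk).le) (by positivity)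
    _ = T * c := by
        rw [Finset.sum_const, Finset.card_range, nsmul_eq_mul]; field_simp

lemma mixedNorm_extend_le_rpow {d : ℕ} {L : ℝ} [hL : Fact (0 < L)] {E : Type*}
    [NormedAddCommGroup E] {N : ℕ} [NeZero N]
    {T : ℝ} (hT : 0 < T) {n : ℕ} (hn : 0 < n) (v : ℕ → Cell d N → E) {p C β : ℝ} (hp : 0 < p)
    (hC : 0 ≤ C)
    (h : ∑ k ∈ Finset.range n, T / n * (meshSize L N ^ d * ∑ K, ‖v k K‖ ^ p) ^ (2 / p)
      ≤ C * meshSize L N ^ (2 * β)) :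
    mixedNorm (L := L) 2 (ENNReal.ofReal p) T (extend (T / n) v)
      ≤ ENNReal.ofReal (√C * meshSize L N ^ β) := by
  have hh := meshSize_pos L N
  refine mixedNorm_extend_le hT hn v hp (by positivity) (h.trans (le_of_eq ?_))
  rw [mul_pow, Real.sq_sqrt hC, ← Real.rpow_natCast (meshSize L N ^ β), ← Real.rpow_mul hh.le]
  congr 2
  push_cast; ring

end TimeSums

/-! ### The available bounds for density and momentum, one for each route -/

section NegativeEstimates

namespace AprioriBounds

variable {d : ℕ} {L T γ α M R B : ℝ} {N NT : ℕ} [NeZero N] {ρ : ℕ → Cell d N → ℝ}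
  {u : ℕ → Cell d N → EuclideanSpace ℝ (Fin d)}

lemma mono (A : AprioriBounds L T γ α M R B N NT ρ u) {B' : ℝ} (hB : B ≤ B') :
    AprioriBounds L T γ α M R B' N NT ρ u where
  density_pos := A.density_pos
  mass := A.mass
  density_rpow k hk := (A.density_rpow k hk).trans hB
  kinetic k hk := (A.kinetic k hk).trans hB
  density_jump h := (A.density_jump h).trans hB
  velocity_jump := A.velocity_jump.trans hB
  init_density := A.init_density
  init_momentum := A.init_momentum

lemma bound_pos (A : AprioriBounds L T γ α M R B N NT ρ u) : 0 < R :=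
  (A.density_pos 0 (Nat.zero_le _) 0).trans_le (A.init_density 0)

lemma sum_sq_rpow_half_le (A : AprioriBounds L T γ α M R B N NT ρ u) {k : ℕ} (hk : k ≤ NT) :
    meshSize L N ^ d * ∑ K, (ρ k K ^ (γ / 2)) ^ 2 ≤ B := by
  refine le_trans (le_of_eq ?_) (A.density_rpow k hk)
  congr 1
  refine Finset.sum_congr rfl fun K _ => ?_
  rw [← Real.rpow_natCast, ← Real.rpow_mul (A.density_pos k hk K).le]
  congr 1; push_cast; ring

lemma mass_pos [hL : Fact (0 < L)] (A : AprioriBounds L T γ α M R B N NT ρ u) : 0 < M := by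
  rw [← A.mass 0 (Nat.zero_le _)]
  exact mul_pos (pow_pos (meshSize_pos L N) d)
    (Finset.sum_pos (fun K _ => A.density_pos 0 (Nat.zero_le _) K) Finset.univ_nonempty)

/-- Artificial viscosity controls the gradient of `ρ ^ (γ / 2)` only with weight `h ^ (α + 1)`,
hence the loss; the `L²` part is bounded by the energy and fits since `h < 1`. -/
lemma sum_sobolevSq_density_le [hL : Fact (0 < L)] (A : AprioriBounds L T γ α M R B N NT ρ u) (hT : 0 < T)
    (hB : 0 ≤ B) (hNT : 0 < NT) (hα : -1 < α) (hγ2 : γ ≤ 2) (hh1 : meshSize L N < 1) :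
    ∑ k ∈ Finset.range NT, T / NT *
        sobolevSq (meshSize L N) (fun K => ρ (k + 1) K ^ (γ / 2))
      ≤ (T + 1) * B * meshSize L N ^ (-(α + 1)) := by
  have hh := meshSize_pos L N
  set h := meshSize L N
  have hNT' : (0 : ℝ) < NT := by exact_mod_cast hNT
  have hτ0 : 0 < T / NT := by positivity
  have hlam : 1 ≤ h ^ (-(α + 1)) :=
    Real.one_le_rpow_of_pos_of_le_one_of_nonpos hh hh1.le (by linarith)
  have h1 := A.density_jump hγ2
  have hinv : h ^ (-(α + 1)) * h ^ (α + 1) = 1 := by rw [← Real.rpow_add hh]; simp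
  have e : ∀ k ∈ Finset.range NT, T / NT * sobolevSq h (fun K => ρ (k + 1) K ^ (γ / 2))
      ≤ T / NT * B + h ^ (-(α + 1)) * (T / NT * (h ^ (α + 1) *
        (h ^ d * ∑ K, ∑ i, (h⁻¹ * jump (fun K => ρ (k + 1) K ^ (γ / 2)) K i) ^ 2))) := by
    intro k hk
    have h2 := A.sum_sq_rpow_half_le (k := k + 1) (Finset.mem_range.1 hk)
    rw [sobolevSq, Finset.sum_add_distrib, mul_add, mul_add]
    refine add_le_add (mul_le_mul_of_nonneg_left h2 hτ0.le) (le_of_eq ?_)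
    linear_combination (-(T / NT * (h ^ d *
      ∑ K, ∑ i, (h⁻¹ * jump (fun K => ρ (k + 1) K ^ (γ / 2)) K i) ^ 2))) * hinv
  refine (Finset.sum_le_sum e).trans ?_
  rw [Finset.sum_add_distrib, Finset.sum_const, Finset.card_range, nsmul_eq_mul,
    ← Finset.mul_sum]
  have h3 : (NT : ℝ) * (T / NT * B) = T * B := by field_simp
  have h4 : T * B ≤ T * B * h ^ (-(α + 1)) := le_mul_of_one_le_right (by positivity) hlam
  have h5 := mul_le_mul_of_nonneg_left h1 (show 0 ≤ h ^ (-(α + 1)) by positivity)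
  rw [h3]
  linarith

end AprioriBounds

variable {d : ℕ} {L : ℝ} [hL : Fact (0 < L)] {T γ α M R B : ℝ}

/-- The reverse triangle inequality allows the scalar inequalities for nonnegative functions to be
applied to `|u|`. -/
lemma jump_norm_sq_le {N : ℕ} (v : Cell d N → EuclideanSpace ℝ (Fin d)) (K : Cell d N)
    (i : Fin d) : jump (fun K => ‖v K‖) K i ^ 2 ≤ ∑ j, jump (comp v j) K i ^ 2 := by
  have h1 : |‖v (K + e i)‖ - ‖v K‖| ≤ ‖v (K + e i) - v K‖ := abs_norm_sub_norm_le _ _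
  have h2 := pow_le_pow_left₀ (abs_nonneg _) h1 2
  rw [sq_abs, EuclideanSpace.real_norm_sq_eq] at h2
  exact h2

/-- The viscous dissipation bounds the gradient; the kinetic energy is the weighted `L²` norm in
`sum_sq_le_weighted`, whose constant sees the density only through mass and `L^γ` norm. -/
lemma exists_sum_sobolevSq_velocity_le (hT : 0 < T) (hγ : 1 < γ) (hM : 0 < M) (hB : 0 < B) :
    ∃ C : ℝ, 0 < C ∧ ∀ {N NT : ℕ} [NeZero N] {ρ : ℕ → Cell d N → ℝ}
      {u : ℕ → Cell d N → EuclideanSpace ℝ (Fin d)}, 0 < NT →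
      AprioriBounds L T γ α M R B N NT ρ u →
      ∑ k ∈ Finset.range NT, T / NT * sobolevSq (meshSize L N) (fun K => ‖u (k + 1) K‖) ≤ C := by
  obtain ⟨C, hC, hP⟩ := sum_sq_le_weighted (d := d) (L := L) hγ hM hB
  refine ⟨C * (T * B) + (C + 1) * B, by positivity, fun {N NT} _ {ρ u} hNT A => ?_⟩
  have hh := meshSize_pos L N
  set h := meshSize L N with hdef
  have hNT' : (0 : ℝ) < NT := by exact_mod_cast hNT
  have hτ0 : 0 < T / NT := by positivity
  have e : ∀ k ∈ Finset.range NT, T / NT * sobolevSq h (fun K => ‖u (k + 1) K‖)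
      ≤ T / NT * (C * B) + (C + 1) * (T / NT * intGradGrad h (u (k + 1)) (u (k + 1))) := by
    intro k hk
    have hk' : k + 1 ≤ NT := Finset.mem_range.1 hk
    have h1 := hP N (ρ (k + 1)) (fun K => ‖u (k + 1) K‖) (A.density_pos _ hk') (A.mass _ hk')
      (A.density_rpow _ hk')
    have h2 := A.kinetic _ hk'
    have h3 : h ^ d * ∑ K, ∑ i, (h⁻¹ * jump (fun K => ‖u (k + 1) K‖) K i) ^ 2
        ≤ intGradGrad h (u (k + 1)) (u (k + 1)) := by
      rw [intGradGrad]
      refine mul_le_mul_of_nonneg_left (Finset.sum_le_sum fun K _ => Finset.sum_le_sum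
        fun i _ => ?_) (pow_nonneg hh.le d)
      have h4 := mul_le_mul_of_nonneg_left (jump_norm_sq_le (u (k + 1)) K i) (sq_nonneg h⁻¹)
      rw [Finset.mul_sum] at h4
      rw [mul_pow]
      refine h4.trans (le_of_eq (Finset.sum_congr rfl fun j _ => by ring))
    have h5 : sobolevSq h (fun K => ‖u (k + 1) K‖)
        ≤ C * B + (C + 1) * intGradGrad h (u (k + 1)) (u (k + 1)) := by
      rw [sobolevSq, Finset.sum_add_distrib, mul_add]
      have h6 : C * (h ^ d * ∑ K, ρ (k + 1) K * ‖u (k + 1) K‖ ^ 2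
          + h ^ d * ∑ K, ∑ i, (h⁻¹ * jump (fun K => ‖u (k + 1) K‖) K i) ^ 2)
          ≤ C * (B + intGradGrad h (u (k + 1)) (u (k + 1))) := by gcongr
      linarith
    have h7 := mul_le_mul_of_nonneg_left h5 hτ0.le
    linarith
  refine (Finset.sum_le_sum e).trans ?_
  rw [Finset.sum_add_distrib, Finset.sum_const, Finset.card_range, nsmul_eq_mul,
    ← Finset.mul_sum]
  have h3 : (NT : ℝ) * (T / NT * (C * B)) = C * (T * B) := by field_simp
  have h4 := mul_le_mul_of_nonneg_left A.velocity_jump (show 0 ≤ C + 1 by positivity)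
  rw [h3]
  linarith

/-- Reduction of a bound for the density to a bound for sums over the cells. -/
lemma mixedNorm_density_le {N NT : ℕ} [NeZero N] {ρ : ℕ → Cell d N → ℝ}
    {u : ℕ → Cell d N → EuclideanSpace ℝ (Fin d)} (A : AprioriBounds L T γ α M R B N NT ρ u)
    (hT : 0 < T) (hNT : 0 < NT) {p C β : ℝ} (hp : 0 < p) (hC : 0 ≤ C)
    (h : ∑ k ∈ Finset.range NT, T / NT * (meshSize L N ^ d * ∑ K, ρ k K ^ p) ^ (2 / p)
      ≤ C * meshSize L N ^ (2 * β)) :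
    mixedNorm (L := L) 2 (ENNReal.ofReal p) T (extend (T / NT) ρ)
      ≤ ENNReal.ofReal (√C * meshSize L N ^ β) := by
  refine mixedNorm_extend_le_rpow hT hNT ρ hp hC (le_trans (le_of_eq ?_) h)
  refine Finset.sum_congr rfl fun k hk => ?_
  have hk' := (Finset.mem_range.1 hk).le
  simp only [Real.norm_of_nonneg (A.density_pos k hk' _).le]

lemma exists_density_bound_of_le (hT : 0 < T) (hB : 0 < B) {p : ℝ} (hp : 0 < p)
    (hpγ : p ≤ γ) :
    ∃ C : ℝ, 0 < C ∧ ∀ {N NT : ℕ} [NeZero N] {ρ : ℕ → Cell d N → ℝ}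
      {u : ℕ → Cell d N → EuclideanSpace ℝ (Fin d)}, 0 < NT →
      AprioriBounds L T γ α M R B N NT ρ u →
      mixedNorm (L := L) 2 (ENNReal.ofReal p) T (extend (T / NT) ρ)
        ≤ ENNReal.ofReal (C * meshSize L N ^ (0 : ℝ)) := by
  have hL0 : 0 < L := hL.out
  refine ⟨√(T * (L ^ d + B) ^ (2 / p)), by positivity, fun {N NT} _ {ρ u} hNT A => ?_⟩
  refine mixedNorm_density_le A hT hNT hp (by positivity) ?_
  rw [mul_zero, Real.rpow_zero, mul_one]
  refine sum_time_le_of_le hT hNT fun k hk => ?_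
  have := sum_rpow_le_add (L := L) hp.le hpγ (A.density_pos k hk) (A.density_rpow k hk)
  refine Real.rpow_le_rpow ?_ this (by positivity)
  exact mul_nonneg (pow_nonneg (meshSize_pos L N).le d)
    (Finset.sum_nonneg fun K _ => Real.rpow_nonneg (A.density_pos k hk K).le _)

/-- The `L^γ` bound on a single cell gives a maximum bound at every time, and interpolation with
`L^γ` gives `L^p`. No dissipation is used, so `α` does not appear in the exponent. -/
lemma exists_density_bound_inverse (hT : 0 < T) (hγ : 1 < γ) (hB : 0 < B) {p : ℝ}
    (hpγ : γ ≤ p) :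
    ∃ C : ℝ, 0 < C ∧ ∀ {N NT : ℕ} [NeZero N] {ρ : ℕ → Cell d N → ℝ}
      {u : ℕ → Cell d N → EuclideanSpace ℝ (Fin d)}, 0 < NT →
      AprioriBounds L T γ α M R B N NT ρ u →
      mixedNorm (L := L) 2 (ENNReal.ofReal p) T (extend (T / NT) ρ)
        ≤ ENNReal.ofReal (C * meshSize L N ^ (-(d * (p - γ) / (γ * p)))) := by
  have hp : 0 < p := by linarith
  have hγ0 : 0 < γ := by linarith
  refine ⟨√(T * (B ^ ((p - γ) / γ) * B) ^ (2 / p)), by positivity,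
    fun {N NT} _ {ρ u} hNT A => ?_⟩
  refine mixedNorm_density_le A hT hNT hp (by positivity) ?_
  have hh := meshSize_pos L N
  rw [mul_assoc]
  refine sum_time_le_of_le hT hNT fun k hk => ?_
  have h1 := sum_rpow_le_of_le hγ0 hpγ (by positivity) (A.density_pos k hk) (A.density_rpow k hk)
    (le_of_sum_le (fun K => Real.rpow_nonneg (A.density_pos k hk K).le γ) (A.density_rpow k hk))
  have h0 : 0 ≤ meshSize L N ^ d * ∑ K, ρ k K ^ p := mul_nonneg (pow_nonneg hh.le d)
    (Finset.sum_nonneg fun K _ => Real.rpow_nonneg (A.density_pos k hk K).le _)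
  refine (Real.rpow_le_rpow h0 h1 (by positivity)).trans (le_of_eq ?_)
  rw [Real.mul_rpow hB.le (by positivity), ← Real.rpow_mul hh.le, mul_right_comm,
    Real.mul_rpow (by positivity) (by positivity), ← Real.rpow_mul hh.le]
  congr 2
  field_simp

/-- Gagliardo–Nirenberg for `w = ρ ^ (γ / 2)` with `q = 2 * p / γ`. The squared `L^p` norm of `ρ` is
then bounded by the power `θ = d * (p - γ) / (γ * p)` of the squared `H¹` norm of `w`; the
hypothesis `d * (p - γ) ≤ γ * p` says that `θ ≤ 1`, so that time summation is possible. -/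
lemma exists_density_bound_interpolation (hd : d = 2 ∨ d = 3) (hT : 0 < T) (hγ : 1 < γ)
    (hγ2 : γ ≤ 2) (hα : -1 < α) (hB : 0 < B) (hR : 0 < R) {p : ℝ} (hpγ : γ ≤ p)
    (hp2 : p ≤ 2 * γ) (hdp : d * (p - γ) ≤ γ * p) :
    ∃ C : ℝ, 0 < C ∧ ∀ {N NT : ℕ} [NeZero N] {ρ : ℕ → Cell d N → ℝ}
      {u : ℕ → Cell d N → EuclideanSpace ℝ (Fin d)}, 0 < NT → meshSize L N < 1 →
      AprioriBounds L T γ α M R B N NT ρ u →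
      mixedNorm (L := L) 2 (ENNReal.ofReal p) T (extend (T / NT) ρ)
        ≤ ENNReal.ofReal (C * meshSize L N ^ (-((α + 1) / 2 * (d * (p - γ) / (γ * p))))) := by
  have hL0 : 0 < L := hL.out
  have hp : 0 < p := by linarith
  have hγ0 : 0 < γ := by linarith
  obtain ⟨C, hC, hI⟩ := sum_rpow_le_interpolation L hd (q := 2 * p / γ)
    (by rw [le_div_iff₀ hγ0]; linarith) (by rw [div_le_iff₀ hγ0]; linarith) hB
  refine ⟨√(T * (L ^ d * R ^ p) ^ (2 / p) + C ^ (2 / p) * (T + (T + 1) * B)), by positivity,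
    fun {N NT} _ {ρ u} hNT hh1 A => ?_⟩
  refine mixedNorm_density_le A hT hNT hp (by positivity) ?_
  have hh := meshSize_pos L N
  set h := meshSize L N with hdef
  set θ := d * (p - γ) / (γ * p) with hθ
  have hX0 : ∀ k ≤ NT, 0 ≤ h ^ d * ∑ K, ρ k K ^ p := fun k hk => mul_nonneg (pow_nonneg hh.le d)
    (Finset.sum_nonneg fun K _ => Real.rpow_nonneg (A.density_pos k hk K).le _)
  have key := sum_time_le hT hNT (X := fun k => (h ^ d * ∑ K, ρ k K ^ p) ^ (2 / p))
    (Y := fun k => sobolevSq h (fun K => ρ k K ^ (γ / 2))) (c₀ := (L ^ d * R ^ p) ^ (2 / p))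
    (c := C ^ (2 / p)) (S := (T + 1) * B) (lam := h ^ (-(α + 1))) (θ := θ)
    (by positivity) (by positivity)
    (Real.one_le_rpow_of_pos_of_le_one_of_nonpos hh hh1.le (by linarith))
    (div_nonneg (mul_nonneg (Nat.cast_nonneg _) (by linarith)) (by positivity))
    (by rw [hθ, div_le_one (by positivity)]; exact hdp) ?_ ?_
    (fun k => sobolevSq_nonneg hh.le _) (A.sum_sobolevSq_density_le hT hB.le hNT hα hγ2 hh1)
  · refine key.trans (le_of_eq ?_)
    rw [← Real.rpow_mul hh.le]
    congr 2
    ring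
  · refine Real.rpow_le_rpow (hX0 0 (Nat.zero_le _)) ?_ (by positivity)
    rw [hdef, ← meshSize_pow_mul_sum_const d L N]
    gcongr with K
    · exact (A.density_pos 0 (Nat.zero_le _) K).le
    · exact A.init_density K
  · intro k hk
    have h1 := hI N (fun K => ρ (k + 1) K ^ (γ / 2))
      (fun K => Real.rpow_nonneg (A.density_pos _ hk K).le _) (A.sum_sq_rpow_half_le hk)
    have e1 : ∀ K, (ρ (k + 1) K ^ (γ / 2)) ^ (2 * p / γ) = ρ (k + 1) K ^ p := fun K => by
      rw [← Real.rpow_mul (A.density_pos _ hk K).le]; congr 1; field_simp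
    simp only [e1] at h1
    have hs0 := sobolevSq_nonneg hh.le (fun K => ρ (k + 1) K ^ (γ / 2))
    refine (Real.rpow_le_rpow (hX0 _ hk) h1 (by positivity)).trans (le_of_eq ?_)
    rw [Real.mul_rpow hC.le (Real.rpow_nonneg hs0 _), ← Real.rpow_mul hs0]
    congr 2
    rw [hθ]; field_simp; ring

/-- From `ρ² = (ρ^γ)^{(2-γ)/γ} ρ^γ`, with the first factor bounded by its maximum through
`sq_le_of_sobolevEmbedding`. The exponent `(2 - γ) / γ` is at most `1` for every `γ > 1`, so no
further restriction arises in three dimensions. -/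
lemma exists_density_bound_sup (hT : 0 < T) (hγ : 1 < γ)
    (hγ2 : γ ≤ 2) (hα : -1 < α) (hB : 0 < B) (hR : 0 < R) {p Cs : ℝ} (hp : 0 < p) (hCs : 0 < Cs)
    (hS : SobolevEmbedding d L p Cs) :
    ∃ C : ℝ, 0 < C ∧ ∀ {N NT : ℕ} [NeZero N] {ρ : ℕ → Cell d N → ℝ}
      {u : ℕ → Cell d N → EuclideanSpace ℝ (Fin d)}, 0 < NT → meshSize L N < 1 →
      AprioriBounds L T γ α M R B N NT ρ u →
      mixedNorm (L := L) 2 (ENNReal.ofReal 2) T (extend (T / NT) ρ)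
        ≤ ENNReal.ofReal (C * meshSize L N ^ (-((2 * d / p + α + 1) * (2 - γ) / (2 * γ)))) := by
  have hL0 : 0 < L := hL.out
  have hγ0 : 0 < γ := by linarith
  set θ := (2 - γ) / γ with hθ
  refine ⟨√(T * (L ^ d * R ^ (2 : ℝ)) ^ ((2 : ℝ) / 2)
      + (Cs ^ (2 / p)) ^ θ * B * (T + (T + 1) * B)),
    by positivity, fun {N NT} _ {ρ u} hNT hh1 A => ?_⟩
  refine mixedNorm_density_le A hT hNT two_pos (by positivity) ?_
  have hh := meshSize_pos L N
  set h := meshSize L N with hdef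
  have hX0 : ∀ k ≤ NT, 0 ≤ h ^ d * ∑ K, ρ k K ^ (2 : ℝ) := fun k hk =>
    mul_nonneg (pow_nonneg hh.le d)
      (Finset.sum_nonneg fun K _ => Real.rpow_nonneg (A.density_pos k hk K).le _)
  have hη : 1 ≤ h ^ (-(2 * d / p)) := Real.one_le_rpow_of_pos_of_le_one_of_nonpos hh hh1.le
    (neg_nonpos.2 (by positivity))
  have hlam : 1 ≤ h ^ (-(α + 1)) :=
    Real.one_le_rpow_of_pos_of_le_one_of_nonpos hh hh1.le (by linarith)
  have key := sum_time_le hT hNT (X := fun k => (h ^ d * ∑ K, ρ k K ^ (2 : ℝ)) ^ ((2 : ℝ) / 2))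
    (Y := fun k => h ^ (-(2 * d / p)) * sobolevSq h (fun K => ρ k K ^ (γ / 2)))
    (c₀ := (L ^ d * R ^ (2 : ℝ)) ^ ((2 : ℝ) / 2))
    (c := (Cs ^ (2 / p)) ^ θ * B) (S := (T + 1) * B)
    (lam := h ^ (-(2 * d / p)) * h ^ (-(α + 1))) (θ := θ)
    (by positivity) (by positivity) (one_le_mul_of_one_le_of_one_le hη hlam)
    (div_nonneg (by linarith) hγ0.le)
    (by rw [hθ, div_le_one hγ0]; linarith) ?_ ?_
    (fun k => mul_nonneg (by positivity) (sobolevSq_nonneg hh.le _)) ?_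
  · refine key.trans (le_of_eq ?_)
    rw [← Real.rpow_add hh, ← Real.rpow_mul hh.le]
    congr 2
    rw [hθ]; field_simp; ring
  · refine Real.rpow_le_rpow (hX0 0 (Nat.zero_le _)) ?_ (by positivity)
    rw [hdef, ← meshSize_pow_mul_sum_const d L N]
    gcongr with K
    · exact (A.density_pos 0 (Nat.zero_le _) K).le
    · exact A.init_density K
  · intro k hk
    have hs0 := sobolevSq_nonneg hh.le (fun K => ρ (k + 1) K ^ (γ / 2))
    have h1 : ∀ K, ρ (k + 1) K ^ γ ≤ Cs ^ (2 / p) *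
        (h ^ (-(2 * d / p)) * sobolevSq h (fun K => ρ (k + 1) K ^ (γ / 2))) := fun K => by
      have h2 := sq_le_of_sobolevEmbedding hp hCs hS (fun K => ρ (k + 1) K ^ (γ / 2))
        (fun K => Real.rpow_nonneg (A.density_pos _ hk K).le _) K
      refine le_trans (le_of_eq ?_) h2
      rw [← Real.rpow_natCast, ← Real.rpow_mul (A.density_pos _ hk K).le]
      congr 1; push_cast; ring
    have h3 := sum_rpow_le_of_le hγ0 hγ2 (by positivity) (A.density_pos _ hk)
      (A.density_rpow _ hk) h1
    rw [Real.mul_rpow (by positivity) (by positivity)] at h3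
    rw [div_self two_ne_zero, Real.rpow_one]
    refine h3.trans (le_of_eq ?_)
    ring
  · have h1 := A.sum_sobolevSq_density_le hT hB.le hNT hα hγ2 hh1
    have h2 := mul_le_mul_of_nonneg_left h1 (show 0 ≤ h ^ (-(2 * d / p)) by positivity)
    rw [Finset.mul_sum] at h2
    refine le_trans (le_of_eq ?_) (h2.trans (le_of_eq ?_))
    · exact Finset.sum_congr rfl fun k _ => by ring
    · ring

/-- Reduction of a bound for the momentum to a bound for sums over the cells. -/
lemma mixedNorm_momentum_le {N NT : ℕ} [NeZero N] {ρ : ℕ → Cell d N → ℝ}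
    {u : ℕ → Cell d N → EuclideanSpace ℝ (Fin d)}
    (hT : 0 < T) (hNT : 0 < NT) {C β : ℝ} (hC : 0 ≤ C)
    (h : ∑ k ∈ Finset.range NT, T / NT * (meshSize L N ^ d * ∑ K, ‖ρ k K • u k K‖ ^ 2)
      ≤ C * meshSize L N ^ (2 * β)) :
    mixedNorm (L := L) 2 2 T (extend (T / NT) (fun k K => ρ k K • u k K))
      ≤ ENNReal.ofReal (√C * meshSize L N ^ β) := by
  have h2 : (2 : ENNReal) = ENNReal.ofReal 2 := by simp
  have := mixedNorm_extend_le_rpow (L := L) hT hNT (fun k K => ρ k K • u k K) (p := 2) (β := β)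
    two_pos hC (by simpa using h)
  rwa [← h2] at this

lemma AprioriBounds.sum_init_momentum_le {N NT : ℕ} [NeZero N] {ρ : ℕ → Cell d N → ℝ}
    {u : ℕ → Cell d N → EuclideanSpace ℝ (Fin d)} (A : AprioriBounds L T γ α M R B N NT ρ u) :
    meshSize L N ^ d * ∑ K, ‖ρ 0 K • u 0 K‖ ^ 2 ≤ L ^ d * R ^ 2 := by
  have hh := meshSize_pos L N
  rw [← meshSize_pow_mul_sum_const d L N]
  gcongr with K
  exact A.init_momentum K

/-- One factor `ρ` of `ρ² |u|²` is estimated by its maximum, the rest is kinetic energy. -/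
lemma AprioriBounds.sum_momentum_le {N NT : ℕ} [NeZero N] {ρ : ℕ → Cell d N → ℝ}
    {u : ℕ → Cell d N → EuclideanSpace ℝ (Fin d)} (A : AprioriBounds L T γ α M R B N NT ρ u)
    (hγ : 0 < γ) {Q : ℝ} (hQ : 0 ≤ Q) {k : ℕ} (hk : k ≤ NT) (h : ∀ K, ρ k K ^ γ ≤ Q) :
    meshSize L N ^ d * ∑ K, ‖ρ k K • u k K‖ ^ 2 ≤ Q ^ (1 / γ) * B := by
  have hh := meshSize_pos L N
  calc meshSize L N ^ d * ∑ K, ‖ρ k K • u k K‖ ^ 2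
      ≤ meshSize L N ^ d * ∑ K, Q ^ (1 / γ) * (ρ k K * ‖u k K‖ ^ 2) := by
        gcongr with K
        have hρ := A.density_pos k hk K
        have h1 : ρ k K ≤ Q ^ (1 / γ) := by
          have := Real.rpow_le_rpow (Real.rpow_nonneg hρ.le γ) (h K) (show 0 ≤ 1 / γ by positivity)
          rwa [← Real.rpow_mul hρ.le, mul_one_div_cancel hγ.ne', Real.rpow_one] at this
        rw [norm_smul, Real.norm_of_nonneg hρ.le, mul_pow]
        have h2 := mul_le_mul_of_nonneg_right h1 (show 0 ≤ ρ k K * ‖u k K‖ ^ 2 by positivity)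
        linarith
    _ = Q ^ (1 / γ) * (meshSize L N ^ d * ∑ K, ρ k K * ‖u k K‖ ^ 2) := by
        rw [← Finset.mul_sum]; ring
    _ ≤ _ := mul_le_mul_of_nonneg_left (A.kinetic k hk) (by positivity)

lemma exists_momentum_bound_inverse (hT : 0 < T) (hγ : 1 < γ) (hB : 0 < B) :
    ∃ C : ℝ, 0 < C ∧ ∀ {N NT : ℕ} [NeZero N] {ρ : ℕ → Cell d N → ℝ}
      {u : ℕ → Cell d N → EuclideanSpace ℝ (Fin d)}, 0 < NT →
      AprioriBounds L T γ α M R B N NT ρ u →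
      mixedNorm (L := L) 2 2 T (extend (T / NT) (fun k K => ρ k K • u k K))
        ≤ ENNReal.ofReal (C * meshSize L N ^ (-(d / (2 * γ)))) := by
  have hγ0 : 0 < γ := by linarith
  refine ⟨√(T * (B ^ (1 / γ) * B)), by positivity, fun {N NT} _ {ρ u} hNT A => ?_⟩
  refine mixedNorm_momentum_le hT hNT (by positivity) ?_
  have hh := meshSize_pos L N
  rw [mul_assoc]
  refine sum_time_le_of_le hT hNT fun k hk => ?_
  refine (A.sum_momentum_le hγ0 (by positivity) hk
    (le_of_sum_le (fun K => Real.rpow_nonneg (A.density_pos k hk K).le γ)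
      (A.density_rpow k hk))).trans (le_of_eq ?_)
  rw [Real.mul_rpow hB.le (by positivity), ← Real.rpow_mul hh.le, mul_right_comm]
  congr 2
  field_simp

lemma exists_momentum_bound_sup (hT : 0 < T) (hγ : 1 < γ)
    (hγ2 : γ ≤ 2) (hα : -1 < α) (hB : 0 < B) (hR : 0 < R) {p Cs : ℝ} (hp : 0 < p) (hCs : 0 < Cs)
    (hS : SobolevEmbedding d L p Cs) :
    ∃ C : ℝ, 0 < C ∧ ∀ {N NT : ℕ} [NeZero N] {ρ : ℕ → Cell d N → ℝ}
      {u : ℕ → Cell d N → EuclideanSpace ℝ (Fin d)}, 0 < NT → meshSize L N < 1 →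
      AprioriBounds L T γ α M R B N NT ρ u →
      mixedNorm (L := L) 2 2 T (extend (T / NT) (fun k K => ρ k K • u k K))
        ≤ ENNReal.ofReal (C * meshSize L N ^ (-((2 * d / p + α + 1) / (2 * γ)))) := by
  have hL0 : 0 < L := hL.out
  have hγ0 : 0 < γ := by linarith
  refine ⟨√(T * (L ^ d * R ^ 2) + (Cs ^ (2 / p)) ^ (1 / γ) * B * (T + (T + 1) * B)),
    by positivity, fun {N NT} _ {ρ u} hNT hh1 A => ?_⟩
  refine mixedNorm_momentum_le hT hNT (by positivity) ?_
  have hh := meshSize_pos L N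
  set h := meshSize L N with hdef
  have hη : 1 ≤ h ^ (-(2 * d / p)) := Real.one_le_rpow_of_pos_of_le_one_of_nonpos hh hh1.le
    (neg_nonpos.2 (by positivity))
  have hlam : 1 ≤ h ^ (-(α + 1)) :=
    Real.one_le_rpow_of_pos_of_le_one_of_nonpos hh hh1.le (by linarith)
  have key := sum_time_le hT hNT (X := fun k => h ^ d * ∑ K, ‖ρ k K • u k K‖ ^ 2)
    (Y := fun k => h ^ (-(2 * d / p)) * sobolevSq h (fun K => ρ k K ^ (γ / 2)))
    (c₀ := L ^ d * R ^ 2) (c := (Cs ^ (2 / p)) ^ (1 / γ) * B) (S := (T + 1) * B)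
    (lam := h ^ (-(2 * d / p)) * h ^ (-(α + 1))) (θ := 1 / γ)
    (by positivity) (by positivity) (one_le_mul_of_one_le_of_one_le hη hlam)
    (by positivity) (by rw [div_le_one hγ0]; linarith) A.sum_init_momentum_le ?_
    (fun k => mul_nonneg (by positivity) (sobolevSq_nonneg hh.le _)) ?_
  · refine key.trans (le_of_eq ?_)
    rw [← Real.rpow_add hh, ← Real.rpow_mul hh.le]
    congr 2
    field_simp; ring
  · intro k hk
    have hs0 := sobolevSq_nonneg hh.le (fun K => ρ (k + 1) K ^ (γ / 2))
    have h1 : ∀ K, ρ (k + 1) K ^ γ ≤ Cs ^ (2 / p) *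
        (h ^ (-(2 * d / p)) * sobolevSq h (fun K => ρ (k + 1) K ^ (γ / 2))) := fun K => by
      have h2 := sq_le_of_sobolevEmbedding hp hCs hS (fun K => ρ (k + 1) K ^ (γ / 2))
        (fun K => Real.rpow_nonneg (A.density_pos _ hk K).le _) K
      refine le_trans (le_of_eq ?_) h2
      rw [← Real.rpow_natCast, ← Real.rpow_mul (A.density_pos _ hk K).le]
      congr 1; push_cast; ring
    refine (A.sum_momentum_le hγ0 (by positivity) hk h1).trans (le_of_eq ?_)
    rw [Real.mul_rpow (by positivity) (by positivity)]
    ring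
  · have h1 := A.sum_sobolevSq_density_le hT hB.le hNT hα hγ2 hh1
    have h2 := mul_le_mul_of_nonneg_left h1 (show 0 ≤ h ^ (-(2 * d / p)) by positivity)
    rw [Finset.mul_sum] at h2
    refine le_trans (le_of_eq ?_) (h2.trans (le_of_eq ?_))
    · exact Finset.sum_congr rfl fun k _ => by ring
    · ring

/-- Here `ρ` is bounded in `L^q` at every time with loss `h ^ (-m)` in the `q`-th power sum, and `u`
lies in `L²(L^p)` by the embedding of `H¹`. The time sum is linear in the squared `H¹` norm of
`|u|`, so `θ = 1`. -/
lemma exists_momentum_bound_holder (hT : 0 < T) (hγ : 1 < γ) (hM : 0 < M)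
    (hB : 0 < B) (hR : 0 < R) {q p Cs Cq m : ℝ} (hq : 0 < q) (hp : 0 < p)
    (hqp : 1 / q + 1 / p = 1 / 2) (hCs : 0 < Cs) (hS : SobolevEmbedding d L p Cs)
    (hCq : 0 < Cq) (hm : 0 ≤ m)
    (hρq : ∀ (N : ℕ) [NeZero N] (r : Cell d N → ℝ), (∀ K, 0 < r K) →
      meshSize L N ^ d * ∑ K, r K ^ γ ≤ B →
      meshSize L N ^ d * ∑ K, r K ^ q ≤ Cq * meshSize L N ^ (-m)) :
    ∃ C : ℝ, 0 < C ∧ ∀ {N NT : ℕ} [NeZero N] {ρ : ℕ → Cell d N → ℝ}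
      {u : ℕ → Cell d N → EuclideanSpace ℝ (Fin d)}, 0 < NT → meshSize L N < 1 →
      AprioriBounds L T γ α M R B N NT ρ u →
      mixedNorm (L := L) 2 2 T (extend (T / NT) (fun k K => ρ k K • u k K))
        ≤ ENNReal.ofReal (C * meshSize L N ^ (-(m / q))) := by
  have hL0 : 0 < L := hL.out
  obtain ⟨Cv, hCv, hv⟩ := exists_sum_sobolevSq_velocity_le (d := d) (L := L) (T := T) (γ := γ)
    (α := α) (M := M) (R := R) (B := B) hT hγ hM hB
  refine ⟨√(T * (L ^ d * R ^ 2) + Cq ^ (2 / q) * Cs ^ (2 / p) * (T + Cv)),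
    by positivity, fun {N NT} _ {ρ u} hNT hh1 A => ?_⟩
  refine mixedNorm_momentum_le hT hNT (by positivity) ?_
  have hh := meshSize_pos L N
  set h := meshSize L N with hdef
  have hη : 1 ≤ h ^ (-(2 * m / q)) := Real.one_le_rpow_of_pos_of_le_one_of_nonpos hh hh1.le
    (neg_nonpos.2 (by positivity))
  have key := sum_time_le hT hNT (X := fun k => h ^ d * ∑ K, ‖ρ k K • u k K‖ ^ 2)
    (Y := fun k => h ^ (-(2 * m / q)) * sobolevSq h (fun K => ‖u k K‖))
    (c₀ := L ^ d * R ^ 2) (c := Cq ^ (2 / q) * Cs ^ (2 / p)) (S := Cv)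
    (lam := h ^ (-(2 * m / q))) (θ := 1)
    (by positivity) (by positivity) hη zero_le_one le_rfl A.sum_init_momentum_le ?_
    (fun k => mul_nonneg (by positivity) (sobolevSq_nonneg hh.le _)) ?_
  · refine key.trans (le_of_eq ?_)
    rw [Real.rpow_one]
    congr 2
    ring
  · intro k hk
    have hs0 := sobolevSq_nonneg hh.le (fun K => ‖u (k + 1) K‖)
    have h1 := sum_mul_sq_le_holder (L := L) hq hp hqp
      (fun K => (A.density_pos _ hk K).le) (fun K => norm_nonneg (u (k + 1) K))
    have h2 := hρq N (ρ (k + 1)) (A.density_pos _ hk) (A.density_rpow _ hk)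
    have h3 := hS N (fun K => ‖u (k + 1) K‖) (fun K => norm_nonneg _)
    have h2' : (h ^ d * ∑ K, ρ (k + 1) K ^ q) ^ (2 / q) ≤ Cq ^ (2 / q) * h ^ (-(2 * m / q)) := by
      have := Real.rpow_le_rpow (mul_nonneg (pow_nonneg hh.le d)
        (Finset.sum_nonneg fun K _ => Real.rpow_nonneg (A.density_pos _ hk K).le _)) h2
        (show 0 ≤ 2 / q by positivity)
      refine this.trans (le_of_eq ?_)
      rw [Real.mul_rpow hCq.le (by positivity), ← Real.rpow_mul hh.le]
      congr 2; ring
    have h3' : (h ^ d * ∑ K, ‖u (k + 1) K‖ ^ p) ^ (2 / p)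
        ≤ Cs ^ (2 / p) * sobolevSq h (fun K => ‖u (k + 1) K‖) := by
      have := Real.rpow_le_rpow (mul_nonneg (pow_nonneg hh.le d)
        (Finset.sum_nonneg fun K _ => Real.rpow_nonneg (norm_nonneg _) _)) h3
        (show 0 ≤ 2 / p by positivity)
      refine this.trans (le_of_eq ?_)
      rw [Real.mul_rpow hCs.le (Real.rpow_nonneg hs0 _), ← Real.rpow_mul hs0,
        show p / 2 * (2 / p) = 1 by field_simp, Real.rpow_one]
    have e1 : ∀ K, ‖ρ (k + 1) K • u (k + 1) K‖ = ρ (k + 1) K * ‖u (k + 1) K‖ := fun K => by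
      rw [norm_smul, Real.norm_of_nonneg (A.density_pos _ hk K).le]
    simp only [e1, Real.rpow_one]
    refine h1.trans ?_
    calc (h ^ d * ∑ K, ρ (k + 1) K ^ q) ^ (2 / q) * (h ^ d * ∑ K, ‖u (k + 1) K‖ ^ p) ^ (2 / p)
        ≤ (Cq ^ (2 / q) * h ^ (-(2 * m / q)))
          * (Cs ^ (2 / p) * sobolevSq h (fun K => ‖u (k + 1) K‖)) :=
          mul_le_mul h2' h3' (Real.rpow_nonneg (mul_nonneg (pow_nonneg hh.le d)
            (Finset.sum_nonneg fun K _ => Real.rpow_nonneg (norm_nonneg _) _)) _) (by positivity)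
      _ = _ := by ring
  · have h1 := hv hNT A
    have h2 := mul_le_mul_of_nonneg_left h1 (show 0 ≤ h ^ (-(2 * m / q)) by positivity)
    rw [Finset.mul_sum] at h2
    refine le_trans (le_of_eq ?_) (h2.trans (le_of_eq ?_))
    · exact Finset.sum_congr rfl fun k _ => by ring
    · ring

end NegativeEstimates

/-! ### Matching the bounds with the exponents of the theorem -/

section Exponents

variable {d : ℕ} {L : ℝ} [hL : Fact (0 < L)] {T γ α M R B : ℝ}

lemma ofReal_mul_rpow_le {h C β β' : ℝ} (hh : 0 < h) (hh1 : h < 1) (hC : 0 ≤ C) (hβ : β' ≤ β) :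
    ENNReal.ofReal (C * h ^ β) ≤ ENNReal.ofReal (C * h ^ β') :=
  ENNReal.ofReal_le_ofReal
    (mul_le_mul_of_nonneg_left (Real.rpow_le_rpow_of_exponent_ge hh hh1.le hβ) hC)

/-- The lower bound is the limit `p → ∞` inside the infimum. As the factor `(γ - 2) / γ` is negative
for `γ < 2`, a lower bound on the infimum is the direction needed. -/
lemma min_le_iInf_betaD (α : ℝ) :
    min ((α + 1) / 2) 1 ≤ ⨅ p : Ici (1 : ℝ), min (((p : ℝ) * (α + 1) + 4) / (2 * p)) 1 := by
  refine le_ciInf fun p => min_le_min ?_ le_rfl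
  have hp : (1 : ℝ) ≤ p := p.2
  rw [div_le_div_iff₀ two_pos (by positivity)]
  nlinarith

lemma min_le_iInf_betaR (hα : -1 < α) (hγ : 1 < γ) (hγ2 : γ < 6 / 5) :
    min ((α + 1) / 2) 1
      ≤ ⨅ p : Ici (12 / (5 * γ)), min ((1 + α) * (p : ℝ) / (2 * ((p : ℝ) - 2))) 1 := by
  refine le_ciInf fun p => min_le_min ?_ le_rfl
  have hp : 12 / (5 * γ) ≤ p := p.2
  have h2 : 2 < 12 / (5 * γ) := by rw [lt_div_iff₀ (by linarith)]; linarith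
  rw [div_le_div_iff₀ two_pos (by linarith)]
  nlinarith

/-- For `d = 2` the embeddings into `L^p` with finite `p` would reach the infimum only in the limit,
with constants depending on `p`; interpolation gives the limiting exponent at once. For `d = 3` the
maximum bound with `p = 6` is exact. When the minimum is `1`, the inverse estimate applies. -/
theorem exists_density_bound_betaD (hd : d = 2 ∨ d = 3) (hT : 0 < T) (hγ : 1 < γ) (hα : -1 < α)
    (hB : 0 < B) (hR : 0 < R) :
    ∃ C : ℝ, 0 < C ∧ ∀ {N NT : ℕ} [NeZero N] {ρ : ℕ → Cell d N → ℝ}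
      {u : ℕ → Cell d N → EuclideanSpace ℝ (Fin d)}, 0 < NT → meshSize L N < 1 →
      AprioriBounds L T γ α M R B N NT ρ u →
      mixedNorm (L := L) 2 2 T (extend (T / NT) ρ)
        ≤ ENNReal.ofReal (C * meshSize L N ^ betaD d γ α) := by
  have e2 : (2 : ENNReal) = ENNReal.ofReal 2 := by simp
  have hγ0 : 0 < γ := by linarith
  by_cases hγ2 : 2 ≤ γ
  · obtain ⟨C, hC, h⟩ := exists_density_bound_of_le (d := d) (L := L) (α := α) (M := M) (R := R)
      hT hB two_pos hγ2
    refine ⟨C, hC, fun hNT _ A => ?_⟩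
    rw [betaD, if_pos hγ2]
    have := h hNT A
    rwa [← e2] at this
  rw [not_le] at hγ2
  have hneg : (γ - 2) / γ < 0 := div_neg_of_neg_of_pos (by linarith) hγ0
  have finish : ∀ (C β : ℝ), 0 < C → betaD d γ α ≤ β →
      (∀ {N NT : ℕ} [NeZero N] {ρ : ℕ → Cell d N → ℝ}
        {u : ℕ → Cell d N → EuclideanSpace ℝ (Fin d)}, 0 < NT → meshSize L N < 1 →
        AprioriBounds L T γ α M R B N NT ρ u →
        mixedNorm (L := L) 2 (ENNReal.ofReal 2) T (extend (T / NT) ρ)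
          ≤ ENNReal.ofReal (C * meshSize L N ^ β)) →
      ∃ C : ℝ, 0 < C ∧ ∀ {N NT : ℕ} [NeZero N] {ρ : ℕ → Cell d N → ℝ}
        {u : ℕ → Cell d N → EuclideanSpace ℝ (Fin d)}, 0 < NT → meshSize L N < 1 →
        AprioriBounds L T γ α M R B N NT ρ u →
        mixedNorm (L := L) 2 2 T (extend (T / NT) ρ)
          ≤ ENNReal.ofReal (C * meshSize L N ^ betaD d γ α) := by
    intro C β hC hβ h
    refine ⟨C, hC, fun {N NT} _ {ρ u} hNT hh1 A => ?_⟩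
    have h1 := h hNT hh1 A
    rw [← e2] at h1
    exact h1.trans (ofReal_mul_rpow_le (meshSize_pos L N) hh1 hC.le hβ)
  obtain ⟨C₁, hC₁, h₁⟩ := exists_density_bound_inverse (d := d) (L := L) (α := α) (M := M)
    (R := R) hT hγ hB hγ2.le
  rcases hd with rfl | rfl
  · have hm := min_le_iInf_betaD α
    rcases le_total ((α + 1) / 2) 1 with hc | hc
    · obtain ⟨C, hC, h⟩ := exists_density_bound_interpolation (d := 2) (L := L) (M := M)
        (Or.inl rfl) hT hγ hγ2.le hα hB hR hγ2.le (p := 2) (by linarith)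
        (by push_cast; linarith)
      refine finish C _ hC ?_ h
      rw [betaD, if_neg (not_le.2 hγ2), if_pos rfl]
      rw [min_eq_left hc] at hm
      refine (mul_le_mul_of_nonpos_right hm hneg.le).trans (le_of_eq ?_)
      push_cast; field_simp; ring
    · refine finish C₁ _ hC₁ ?_ fun hNT _ A => h₁ hNT A
      rw [betaD, if_neg (not_le.2 hγ2), if_pos rfl]
      rw [min_eq_right hc] at hm
      refine (mul_le_mul_of_nonpos_right hm hneg.le).trans (le_of_eq ?_)
      push_cast; field_simp; ring
  · rcases le_total ((α + 2) / 3) 1 with hc | hc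
    · obtain ⟨Cs, hCs, hS⟩ := exists_sobolevEmbedding_three L
      obtain ⟨C, hC, h⟩ := exists_density_bound_sup (M := M) hT hγ hγ2.le hα hB hR
        (by norm_num) hCs hS
      refine finish C _ hC (le_of_eq ?_) h
      rw [betaD, if_neg (not_le.2 hγ2), if_neg (by norm_num), min_eq_left hc]
      push_cast; field_simp; ring
    · refine finish C₁ _ hC₁ (le_of_eq ?_) fun hNT _ A => h₁ hNT A
      rw [betaD, if_neg (not_le.2 hγ2), if_neg (by norm_num), min_eq_right hc]
      push_cast; field_simp; ring

theorem exists_density_bound_betaR (hd : d = 2 ∨ d = 3) (hT : 0 < T) (hγ : 1 < γ) (hα : -1 < α)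
    (hB : 0 < B) (hR : 0 < R) :
    ∃ C : ℝ, 0 < C ∧ ∀ {N NT : ℕ} [NeZero N] {ρ : ℕ → Cell d N → ℝ}
      {u : ℕ → Cell d N → EuclideanSpace ℝ (Fin d)}, 0 < NT → meshSize L N < 1 →
      AprioriBounds L T γ α M R B N NT ρ u →
      mixedNorm (L := L) 2 (6 / 5) T (extend (T / NT) ρ)
        ≤ ENNReal.ofReal (C * meshSize L N ^ betaR d γ α) := by
  have e2 : (6 / 5 : ENNReal) = ENNReal.ofReal (6 / 5) := by
    rw [ENNReal.ofReal_div_of_pos (by norm_num)]; simp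
  have hγ0 : 0 < γ := by linarith
  by_cases hγ2 : 6 / 5 ≤ γ
  · obtain ⟨C, hC, h⟩ := exists_density_bound_of_le (d := d) (L := L) (α := α) (M := M) (R := R)
      hT hB (p := 6 / 5) (by norm_num) hγ2
    refine ⟨C, hC, fun hNT _ A => ?_⟩
    rw [betaR, if_pos hγ2, e2]
    exact h hNT A
  rw [not_le] at hγ2
  have hneg : (5 * γ - 6) / (3 * γ) < 0 := div_neg_of_neg_of_pos (by linarith) (by linarith)
  have finish : ∀ (C β : ℝ), 0 < C → betaR d γ α ≤ β →
      (∀ {N NT : ℕ} [NeZero N] {ρ : ℕ → Cell d N → ℝ}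
        {u : ℕ → Cell d N → EuclideanSpace ℝ (Fin d)}, 0 < NT → meshSize L N < 1 →
        AprioriBounds L T γ α M R B N NT ρ u →
        mixedNorm (L := L) 2 (ENNReal.ofReal (6 / 5)) T (extend (T / NT) ρ)
          ≤ ENNReal.ofReal (C * meshSize L N ^ β)) →
      ∃ C : ℝ, 0 < C ∧ ∀ {N NT : ℕ} [NeZero N] {ρ : ℕ → Cell d N → ℝ}
        {u : ℕ → Cell d N → EuclideanSpace ℝ (Fin d)}, 0 < NT → meshSize L N < 1 →
        AprioriBounds L T γ α M R B N NT ρ u →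
        mixedNorm (L := L) 2 (6 / 5) T (extend (T / NT) ρ)
          ≤ ENNReal.ofReal (C * meshSize L N ^ betaR d γ α) := by
    intro C β hC hβ h
    refine ⟨C, hC, fun {N NT} _ {ρ u} hNT hh1 A => ?_⟩
    rw [e2]
    exact (h hNT hh1 A).trans (ofReal_mul_rpow_le (meshSize_pos L N) hh1 hC.le hβ)
  obtain ⟨C₁, hC₁, h₁⟩ := exists_density_bound_inverse (d := d) (L := L) (α := α) (M := M)
    (R := R) hT hγ hB hγ2.le
  -- At `p = 6 / 5` the condition `θ ≤ 1` holds in both dimensions, so interpolation serves for `d =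
  -- 3` as well.
  obtain ⟨C₂, hC₂, h₂⟩ := exists_density_bound_interpolation (d := d) (L := L) (M := M)
    hd hT hγ (by linarith) hα hB hR hγ2.le (p := 6 / 5) (by linarith)
    (by
      have : (d : ℝ) ≤ 3 := by rcases hd with h | h <;> rw [h] <;> norm_num
      nlinarith)
  rcases hd with rfl | rfl
  · have hm := min_le_iInf_betaR hα hγ hγ2
    rcases le_total ((α + 1) / 2) 1 with hc | hc
    · refine finish C₂ _ hC₂ ?_ h₂
      rw [betaR, if_neg (not_le.2 hγ2), if_pos rfl]
      rw [min_eq_left hc] at hm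
      refine (mul_le_mul_of_nonpos_right hm hneg.le).trans (le_of_eq ?_)
      push_cast; field_simp; ring
    · refine finish C₁ _ hC₁ ?_ fun hNT _ A => h₁ hNT A
      rw [betaR, if_neg (not_le.2 hγ2), if_pos rfl]
      rw [min_eq_right hc] at hm
      refine (mul_le_mul_of_nonpos_right hm hneg.le).trans (le_of_eq ?_)
      push_cast; field_simp; ring
  · rcases le_total ((1 + α) / 2) 1 with hc | hc
    · refine finish C₂ _ hC₂ (le_of_eq ?_) h₂
      rw [betaR, if_neg (not_le.2 hγ2), if_neg (by norm_num), min_eq_left hc]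
      push_cast; field_simp; ring
    · refine finish C₁ _ hC₁ (le_of_eq ?_) fun hNT _ A => h₁ hNT A
      rw [betaR, if_neg (not_le.2 hγ2), if_neg (by norm_num), min_eq_right hc]
      push_cast; field_simp; ring

lemma sum_rpow_le_inverse (hγ : 1 < γ) (hB : 0 < B) {q : ℝ} (hq : γ ≤ q) {N : ℕ} [NeZero N]
    {r : Cell d N → ℝ} (hr : ∀ K, 0 < r K) (hrB : meshSize L N ^ d * ∑ K, r K ^ γ ≤ B) :
    meshSize L N ^ d * ∑ K, r K ^ q
      ≤ B ^ ((q - γ) / γ) * B * meshSize L N ^ (-(d * ((q - γ) / γ))) := by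
  have hh := meshSize_pos L N
  refine (sum_rpow_le_of_le (by linarith) hq (by positivity) hr hrB
    (le_of_sum_le (fun K => Real.rpow_nonneg (hr K).le γ) hrB)).trans (le_of_eq ?_)
  rw [Real.mul_rpow hB.le (by positivity), ← Real.rpow_mul hh.le, mul_right_comm]
  congr 2; ring

/-- Every entry of the maxima is one route: the terms with `α` come from the maximum bound, `-3 / (2
* γ)` from the inverse estimate, the others from Hölder's inequality. The largest entry is realized
by its own route. -/
theorem exists_momentum_bound_betaM (hd : d = 2 ∨ d = 3) (hT : 0 < T) (hγ : 1 < γ) (hα : -1 < α)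
    (hM : 0 < M) (hB : 0 < B) (hR : 0 < R) {p : ℝ} (hp : 2 * γ / (γ - 1) ≤ p) :
    ∃ C : ℝ, 0 < C ∧ ∀ {N NT : ℕ} [NeZero N] {ρ : ℕ → Cell d N → ℝ}
      {u : ℕ → Cell d N → EuclideanSpace ℝ (Fin d)}, 0 < NT → meshSize L N < 1 →
      AprioriBounds L T γ α M R B N NT ρ u →
      mixedNorm (L := L) 2 2 T (extend (T / NT) (fun k K => ρ k K • u k K))
        ≤ ENNReal.ofReal (C * meshSize L N ^ betaM d γ α p) := by
  have hγ0 : 0 < γ := by linarith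
  have hL0 : 0 < L := hL.out
  have hp2 : 2 < p := by
    refine lt_of_lt_of_le ?_ hp
    rw [lt_div_iff₀ (by linarith)]; linarith
  have hp0 : 0 < p := by linarith
  have finish : ∀ (C β : ℝ), 0 < C → betaM d γ α p = β →
      (∀ {N NT : ℕ} [NeZero N] {ρ : ℕ → Cell d N → ℝ}
        {u : ℕ → Cell d N → EuclideanSpace ℝ (Fin d)}, 0 < NT → meshSize L N < 1 →
        AprioriBounds L T γ α M R B N NT ρ u →
        mixedNorm (L := L) 2 2 T (extend (T / NT) (fun k K => ρ k K • u k K))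
          ≤ ENNReal.ofReal (C * meshSize L N ^ β)) →
      ∃ C : ℝ, 0 < C ∧ ∀ {N NT : ℕ} [NeZero N] {ρ : ℕ → Cell d N → ℝ}
        {u : ℕ → Cell d N → EuclideanSpace ℝ (Fin d)}, 0 < NT → meshSize L N < 1 →
        AprioriBounds L T γ α M R B N NT ρ u →
        mixedNorm (L := L) 2 2 T (extend (T / NT) (fun k K => ρ k K • u k K))
          ≤ ENNReal.ofReal (C * meshSize L N ^ betaM d γ α p) := by
    rintro C β hC rfl h
    exact ⟨C, hC, h⟩
  have holder : ∀ (q s Cs : ℝ), γ ≤ q → 0 < s → 1 / q + 1 / s = 1 / 2 → 0 < Cs →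
      SobolevEmbedding d L s Cs →
      ∃ C : ℝ, 0 < C ∧ ∀ {N NT : ℕ} [NeZero N] {ρ : ℕ → Cell d N → ℝ}
        {u : ℕ → Cell d N → EuclideanSpace ℝ (Fin d)}, 0 < NT → meshSize L N < 1 →
        AprioriBounds L T γ α M R B N NT ρ u →
        mixedNorm (L := L) 2 2 T (extend (T / NT) (fun k K => ρ k K • u k K))
          ≤ ENNReal.ofReal (C * meshSize L N ^ (-(d * ((q - γ) / γ) / q))) :=
    fun q s Cs hq hs hqs hCs hS =>
      exists_momentum_bound_holder hT hγ hM hB hR (by linarith) hs hqs hCs hS (by positivity)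
        (mul_nonneg (Nat.cast_nonneg _) (div_nonneg (by linarith) hγ0.le))
        (fun N _ r hr hrB => sum_rpow_le_inverse hγ hB hq hr hrB)
  rcases hd with rfl | rfl
  · by_cases hγ2 : γ ≤ 2
    · obtain ⟨Cs, hCs, hS⟩ := exists_sobolevEmbedding_two L hp2.le
      rcases le_total (-(p * (α + 1) + 4) / (2 * p * γ)) ((p * (γ - 2) - 2 * γ) / (p * γ))
        with hc | hc
      · have hp2' : p - 2 ≠ 0 := by linarith
        obtain ⟨C, hC, h⟩ := holder (2 * p / (p - 2)) p Cs
          (by rw [le_div_iff₀ (by linarith)]; nlinarith) hp0 (by field_simp; ring) hCs hS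
        refine finish C _ hC ?_ h
        rw [betaM, if_pos rfl, if_pos hγ2, max_eq_right hc]
        push_cast; field_simp; ring
      · obtain ⟨C, hC, h⟩ := exists_momentum_bound_sup (M := M) hT hγ hγ2 hα hB hR hp0 hCs hS
        refine finish C _ hC ?_ h
        rw [betaM, if_pos rfl, if_pos hγ2, max_eq_left hc]
        push_cast; field_simp; ring
    · have hγ2' : 0 < γ - 2 := by linarith
      obtain ⟨Cs, hCs, hS⟩ := exists_sobolevEmbedding_two L (p := 2 * γ / (γ - 2))
        (by rw [le_div_iff₀ hγ2']; linarith)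
      -- For `γ > 2` Hölder works with `q = γ` itself, and nothing is lost in `h`.
      obtain ⟨C, hC, h⟩ := holder γ (2 * γ / (γ - 2)) Cs le_rfl (by positivity)
        (by field_simp; ring) hCs hS
      refine finish C _ hC ?_ h
      rw [betaM, if_pos rfl, if_neg hγ2]
      simp
  · obtain ⟨Cs, hCs, hS⟩ := exists_sobolevEmbedding_three L
    by_cases hγ2 : γ ≤ 2
    · rcases le_total (max (-(α + 2) / (2 * γ)) ((γ - 3) / γ)) (-3 / (2 * γ)) with hc | hc
      · obtain ⟨C, hC, h⟩ := exists_momentum_bound_inverse (d := 3) (L := L) (α := α) (M := M)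
          (R := R) hT hγ hB
        refine finish C _ hC ?_ fun hNT _ A => h hNT A
        rw [betaM, if_neg (by norm_num), if_pos hγ2, max_eq_right hc]
        push_cast; ring
      rcases le_total (-(α + 2) / (2 * γ)) ((γ - 3) / γ) with hc' | hc'
      · obtain ⟨C, hC, h⟩ := holder 3 6 Cs (by linarith) (by norm_num) (by norm_num) hCs hS
        refine finish C _ hC ?_ h
        rw [betaM, if_neg (by norm_num), if_pos hγ2, max_eq_left hc, max_eq_right hc']
        push_cast; field_simp; ring
      · obtain ⟨C, hC, h⟩ := exists_momentum_bound_sup (M := M) hT hγ hγ2 hα hB hR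
          (by norm_num) hCs hS
        refine finish C _ hC ?_ h
        rw [betaM, if_neg (by norm_num), if_pos hγ2, max_eq_left hc, max_eq_left hc']
        push_cast; field_simp; ring
    · by_cases hγ3 : γ < 3
      · obtain ⟨C, hC, h⟩ := holder 3 6 Cs hγ3.le (by norm_num) (by norm_num) hCs hS
        refine finish C _ hC ?_ h
        rw [betaM, if_neg (by norm_num), if_neg hγ2, if_pos hγ3]
        push_cast; field_simp; ring
      · obtain ⟨C, hC, h⟩ := exists_momentum_bound_holder (d := 3) (L := L) (α := α) (q := 3)
          (p := 6) (m := 0) (Cq := L ^ 3 + B) hT hγ hM hB hR (by norm_num) (by norm_num)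
          (by norm_num) hCs hS (by positivity) le_rfl (fun N _ r hr hrB => by
            have := sum_rpow_le_add (L := L) (q := 3) (by norm_num) (not_lt.1 hγ3) hr hrB
            simpa using this)
        refine finish C _ hC ?_ h
        rw [betaM, if_neg (by norm_num), if_neg hγ2, if_neg hγ3]
        simp

end Exponents

end PenalizedFV

end

open PenalizedFV in
theorem lemmaB3 (d : ℕ) (hd : d = 2 ∨ d = 3) (L T : ℝ) [Fact (0 < L)] (hT : 0 < T)
    (a γ μ lam α : ℝ) (ha : 0 < a) (hγ : 1 < γ) (hμ : 0 < μ) (hlam : 0 ≤ lam) (hα : -1 < α)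
    (M₀ E₀ R : ℝ) :
    ∃ C : ℝ, 0 < C ∧ ∃ Cp : ℝ → ℝ,
      ∀ (Ωf : Set (Torus d L)) (ρ₀ : Torus d L → ℝ) (m₀ : Torus d L → EuclideanSpace ℝ (Fin d)),
        IsInitialData a γ M₀ E₀ R Ωf ρ₀ m₀ →
      ∀ (N NT : ℕ) [NeZero N] (ε : ℝ), meshSize L N < 1 → 0 < NT → 0 < ε → ε < 1 →
      ∀ (ρ : ℕ → Cell d N → ℝ) (u : ℕ → Cell d N → EuclideanSpace ℝ (Fin d)),
        IsFVSolution T a γ μ lam α ε N NT Ωf ρ₀ m₀ ρ u →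
        mixedNorm (L := L) 2 2 T (extend (T / NT) ρ)
            ≤ ENNReal.ofReal (C * meshSize L N ^ betaD d γ α) ∧
        mixedNorm (L := L) 2 (6 / 5) T (extend (T / NT) ρ)
            ≤ ENNReal.ofReal (C * meshSize L N ^ betaR d γ α) ∧
        ∀ p : ℝ, 2 * γ / (γ - 1) ≤ p →
          mixedNorm (L := L) 2 2 T (extend (T / NT) (fun k K => ρ k K • u k K))
            ≤ ENNReal.ofReal (Cp p * meshSize L N ^ betaM d γ α p) := by
  -- No sign of `E₀` or `R` is assumed, so the maximum with `1` provides a positive bound before any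
  -- solution is given.
  set B := max (((γ - 1) / a + 2 + 1 / (2 * a) + 1 / μ)
    * (E₀ + L ^ d * (a / (γ - 1) * R ^ γ))) 1
  have hB : 0 < B := lt_max_of_lt_right one_pos
  -- Otherwise no solution exists, since its initial density is positive, at most `R`, and has mass
  -- `M₀`; any constants will do.
  by_cases hRM : 0 < R ∧ 0 < M₀
  swap
  · refine ⟨1, one_pos, fun _ => 1, fun Ωf ρ₀ m₀ H N NT _ ε _ hNT hε _ ρ u S => ?_⟩
    have A := aprioriBounds_of_isFVSolution hd hT ha hγ hμ hlam hε H hNT S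
    exact absurd ⟨A.bound_pos, A.mass_pos⟩ hRM
  obtain ⟨hR, hM⟩ := hRM
  obtain ⟨C₁, hC₁, h₁⟩ := exists_density_bound_betaD (L := L) (M := M₀) hd hT hγ hα hB hR
  obtain ⟨C₂, hC₂, h₂⟩ := exists_density_bound_betaR (L := L) (M := M₀) hd hT hγ hα hB hR
  have h₃ := fun (p : ℝ) (hp : 2 * γ / (γ - 1) ≤ p) =>
    exists_momentum_bound_betaM (L := L) hd hT hγ hα hM hB hR hp
  -- The constants depend on `p`; below `2 * γ / (γ - 1)` the function takes arbitrary values.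
  choose! Cp _ hCp using h₃
  refine ⟨max C₁ C₂, lt_max_of_lt_left hC₁, Cp,
    fun Ωf ρ₀ m₀ H N NT _ ε hh1 hNT hε _ ρ u S => ?_⟩
  have A := (aprioriBounds_of_isFVSolution hd hT ha hγ hμ hlam hε H hNT S).mono
    (le_max_left _ (1 : ℝ))
  have hh := meshSize_pos L N
  refine ⟨(h₁ hNT hh1 A).trans (ENNReal.ofReal_le_ofReal ?_),
    (h₂ hNT hh1 A).trans (ENNReal.ofReal_le_ofReal ?_), fun p hp => hCp p hp hNT hh1 A⟩
  · exact mul_le_mul_of_nonneg_right (le_max_left _ _) (by positivity)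
  · exact mul_le_mul_of_nonneg_right (le_max_right _ _) (by positivity)
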